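/- An instance of multi-dimensional fair allocation consists of $n\ge 1$ agents, a finite set $M$ of $m\ge 0$ indivisible items, $\ell\ge 1$ dimensions, and nonnegative integers $v_{ijk}$, the value of item $j\in M$ for agent $i\in\{1,\dots,n\}$ in dimension $k\in\{1,\dots,\ell\}$. For $S\subseteq M$ write $v_i(S)_k=\sum_{j\in S}v_{ijk}$. An allocation is a tuple $(A_1,\dots,A_n)$ of pairwise disjoint (possibly empty) subsets of $M$ with union $M$. It is strong simultaneously envy-free up to $c$ goods (strong sEF$c$) if for all distinct agents $i,i'$ there is a set $X\subseteq A_{i'}$ with $|X|\le c$ such that $v_i(A_i)_k\ge v_i(A_{i'}\setminus X)_k$ for every dimension $k$. **Theorem.** For every instance and every integer $c\ge n^2\ell^2$, a strong sEF$c$ allocation exists. Moreover, such an allocation can be computed in polynomial time: there is a single deterministic algorithm that, given an instance (the numbers $n,m,\ell$ and all $v_{ijk}$, written in binary, with $n$, $m$ and $\ell$ part of the input), outputs, in time polynomial in the bit length of the instance, an allocation that is strong sEF$c$ for every $c\ge n^2\ell^2$. (Time is the bit cost on a random access machine with integer arithmetic, where each operation is charged according to the binary lengths of its operands and addresses.)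 -/

import Mathlib

namespace MDFA

/-! ## Multi-dimensional fair allocation -/

/-- An instance of multi-dimensional fair allocation: `n ≥ 1` agents, `m` items, `l ≥ 1`
dimensions, and the nonnegative integer `val i j k`, the value of item `j` for agent `i` in
dimension `k`. -/
structure Inst where
  n : ℕ
  m : ℕ
  l : ℕ
  n_pos : 0 < n
  l_pos : 0 < l
  val : Fin n → Fin m → Fin l → ℕ

/-- The value, in dimension `k`, of a set `S` of items for agent `i`. -/
def Inst.value (I : Inst) (i : Fin I.n) (S : Finset (Fin I.m)) (k : Fin I.l) : ℕ :=
  ∑ j ∈ S, I.val i j k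

/-- An allocation: pairwise disjoint bundles, one per agent (possibly empty), that together
contain all items. -/
structure Allocation (I : Inst) where
  bundle : Fin I.n → Finset (Fin I.m)
  disjoint : ∀ i i', i ≠ i' → Disjoint (bundle i) (bundle i')
  cover : ∀ j, ∃ i, j ∈ bundle i

/-- Strong simultaneous envy-freeness up to `c` goods: one set `X` of at most `c` items removes
the envy of `i` towards `i'` in every dimension. -/
def Allocation.IsStrongSEF {I : Inst} (A : Allocation I) (c : ℕ) : Prop :=
  ∀ i i' : Fin I.n, i ≠ i' → ∃ X : Finset (Fin I.m), X ⊆ A.bundle i' ∧ X.card ≤ c ∧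
    ∀ k : Fin I.l, I.value i (A.bundle i' \ X) k ≤ I.value i (A.bundle i) k

/-! ## Machine model: random access programs with logarithmic (bit) cost

A program is a structured (while-)program. Its memory consists of arrays of integers; a program
text names finitely many of them. The time of a run counts bits, not operations: touching
a number costs its binary length, and so does addressing a cell. -/

/-- Length of an integer in binary, with its sign; always at least one. -/
def bitSize (z : ℤ) : ℕ := z.natAbs.size + 1

/-- Memory contents: the integer in cell `j` of array `a`. -/
abbrev Store : Type := ℕ → ℤ → ℤ

/-- Writing the integer `z` into cell `j` of array `a`. -/
def Store.write (s : Store) (a : ℕ) (j z : ℤ) : Store :=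
  fun b i => if b = a ∧ i = j then z else s b i

/-- Arithmetic operations and comparisons. -/
inductive Op
  | add
  | sub
  | mul
  | div
  | le
  | eq

/-- Division is integer division, with value `0` for divisor `0`; a comparison yields `1` if it
holds and `0` otherwise. -/
def Op.apply : Op → ℤ → ℤ → ℤ
  | .add, x, y => x + y
  | .sub, x, y => x - y
  | .mul, x, y => x * y
  | .div, x, y => x / y
  | .le, x, y => if x ≤ y then 1 else 0
  | .eq, x, y => if x = y then 1 else 0

/-- Expressions: integer constants, cell `i` of array `a` (where the index `i` is an expression
and the array `a` is fixed in the program text), and binary operations. -/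
inductive Expr
  | const (z : ℤ)
  | read (a : ℕ) (i : Expr)
  | bin (o : Op) (e f : Expr)

def Expr.eval (s : Store) : Expr → ℤ
  | .const z => z
  | .read a i => s a (i.eval s)
  | .bin o e f => o.apply (e.eval s) (f.eval s)

/-- Bit cost of evaluating an expression. A constant costs its length, a memory access the
lengths of the address and of the contents, and an operation the product of the lengths of its
operands (as for schoolbook multiplication; this also covers the cheaper operations). -/
def Expr.cost (s : Store) : Expr → ℕ
  | .const z => bitSize z
  | .read a i => i.cost s + bitSize (i.eval s) + bitSize (s a (i.eval s))
  | .bin _ e f => e.cost s + f.cost s + bitSize (e.eval s) * bitSize (f.eval s)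

/-- Programs. `assign a i e` is `a[i] := e`; a test `e` succeeds if its value is nonzero. -/
inductive Prog
  | nop
  | assign (a : ℕ) (i e : Expr)
  | seq (p q : Prog)
  | cond (e : Expr) (p q : Prog)
  | loop (e : Expr) (p : Prog)

/-- `Exec p s t s'`: the program `p`, started with memory `s`, halts after time `t` with
memory `s'`. -/
inductive Exec : Prog → Store → ℕ → Store → Prop
  | nop (s : Store) : Exec .nop s 1 s
  | assign (s : Store) (a : ℕ) (i e : Expr) :
      Exec (.assign a i e) s
        (1 + i.cost s + e.cost s + bitSize (i.eval s) + bitSize (e.eval s))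
        (s.write a (i.eval s) (e.eval s))
  | seq {p q : Prog} {s s' s'' : Store} {t t' : ℕ} :
      Exec p s t s' → Exec q s' t' s'' → Exec (.seq p q) s (t + t') s''
  | cond_true {e : Expr} {p q : Prog} {s s' : Store} {t : ℕ} :
      e.eval s ≠ 0 → Exec p s t s' → Exec (.cond e p q) s (1 + e.cost s + t) s'
  | cond_false {e : Expr} {p q : Prog} {s s' : Store} {t : ℕ} :
      e.eval s = 0 → Exec q s t s' → Exec (.cond e p q) s (1 + e.cost s + t) s'
  | loop_true {e : Expr} {p : Prog} {s s' s'' : Store} {t t' : ℕ} :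
      e.eval s ≠ 0 → Exec p s t s' → Exec (.loop e p) s' t' s'' →
      Exec (.loop e p) s (1 + e.cost s + t + t') s''
  | loop_false {e : Expr} {p : Prog} {s : Store} :
      e.eval s = 0 → Exec (.loop e p) s (1 + e.cost s) s

/-- Initial memory for an input list: the list fills array `0` from cell `0` on, and every other
cell contains `0`. -/
def initStore (w : List ℤ) : Store :=
  fun a j => if a = 0 ∧ 0 ≤ j then w.getD j.toNat 0 else 0

/-- Length of an input list in binary. -/
def inputSize (w : List ℤ) : ℕ := (w.map bitSize).sum

/-- A search problem is solvable in polynomial time: one program halts on every input `x` within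
a time polynomial in the binary length of the encoding of `x`, and the final contents of array
`1` is a correct answer `Answer x` for `x`. -/
def SolvableInPolyTime {α : Type} (encode : α → List ℤ) (Answer : α → (ℤ → ℤ) → Prop) : Prop :=
  ∃ (P : Prog) (q : Polynomial ℕ), ∀ x : α, ∃ (t : ℕ) (s : Store),
    Exec P (initStore (encode x)) t s ∧ t ≤ q.eval (inputSize (encode x)) ∧ Answer x (s 1)

/-- An instance as a list of integers: `n`, `m`, `l`, then all values, ordered by agent, item,
dimension (the value `val i j k` is at position `3 + (i * m + j) * l + k`). -/
def Inst.encode (I : Inst) : List ℤ :=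
  (I.n : ℤ) :: (I.m : ℤ) :: (I.l : ℤ) ::
    (List.ofFn fun i => (List.ofFn fun j => List.ofFn fun k => (I.val i j k : ℤ)).flatten).flatten

/-- The array `out` describes the allocation `A`: cell `j` contains the (zero-based) number of
the agent who gets item `j`. -/
def Allocation.WrittenIn {I : Inst} (A : Allocation I) (out : ℤ → ℤ) : Prop :=
  ∀ (i : Fin I.n) (j : Fin I.m), j ∈ A.bundle i → out (j : ℕ) = (i : ℕ)

end MDFA

/-! Number the pairs of agent `i` and dimension `k` as coordinates `q = i * l + k`; there are `d = n
* l` of them. The allocation is built in two stages.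

Picking. Every coordinate gets `N = n * n * l` consecutive turns, and in each turn a remaining item
of largest value in that coordinate goes to the agent of the coordinate. An agent makes at most `l *
N = n² l²` picks, and the picks of `i'` are the goods that `i` may disregard. Let `h q` be the value
of the last pick for `q`. Every leftover item is worth at most `h q` in `q`; if anything is left
over, the `N` picks of `i` for `q` are worth at least `h q` each. So it is enough to distribute the
leftovers in such a way that in coordinate `q` the leftovers of `i'` exceed those of `i` by at most
`N * h q` (`sum_unpicked_le`).

Rounding. Start from equal shares of every leftover, where all bundles agree in all coordinates.
Call an item unsettled if several agents hold shares of it. For each unsettled item consider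
exchanges between its two leading owners. The `n * d` bundle values impose only `(n - 1) * d`
independent equations on these exchanges, because for each coordinate the changes cancel over the
agents. With more than `(n - 1) * d` unsettled items there is thus a nonzero exchange that preserves
all values (`exists_kernel`); following it until a share vanishes is progress. In the end at most
`(n - 1) * d = N - n * l` items are unsettled. Giving each to its largest shareholder costs at most
`h q` apiece, which leaves a slack of at least `h q`.

Polynomial time. The slack allows approximate arithmetic. Values are rescaled by `scale n m / h q`
and rounded down, so that for leftovers they are small integers independent of the size of the input
values; an item consists of `D = 8 n m²` units. Instead of a kernel vector of the exchange matrix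
`X`, gradient descent `y ↦ L y - Xᵀ X y` finds an almost annihilated `y`. Started at the largest
entry of a kernel vector `u`, the iterates keep a component `L ^ k` along `u`, while their norm
would shrink too fast if `X y` stayed large (`exists_descend_lt`). The good starting item is not
known, so all are tried. A step along `y` changes each bundle value by a small error and creates a
zero share (`isStep_moved`), so the error is charged to at most `n * m` zeros and fits into the
slack (`sum_scaled_le`).

The procedure is a while-program, verified with the rules for `Halts`, which count steps and bound
all numbers in memory by one `M`. The entries of `y` reach `L ^ (L m²)`, but their length is
polynomial; `Run.exec` converts steps and length into bit cost. Existence is read off from the run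
of the program. -/

namespace MDFA

/-! ### Expressions -/

instance : Add Expr := ⟨.bin .add⟩
instance : Sub Expr := ⟨.bin .sub⟩
instance : Mul Expr := ⟨.bin .mul⟩
instance : Div Expr := ⟨.bin .div⟩
instance (k : ℕ) : OfNat Expr k := ⟨.const k⟩

/-- The test `e ≤ f`. -/
def Expr.leq (e f : Expr) : Expr := .bin .le e f

/-- The test `e = f`. -/
def Expr.eqv (e f : Expr) : Expr := .bin .eq e f

/-- The scalar variable stored in cell `0` of array `a`. -/
def Expr.var (a : ℕ) : Expr := .read a 0

section eval
variable (s : Store) (e f : Expr)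
@[simp] theorem Expr.eval_add : (e + f).eval s = e.eval s + f.eval s := rfl
@[simp] theorem Expr.eval_sub : (e - f).eval s = e.eval s - f.eval s := rfl
@[simp] theorem Expr.eval_mul : (e * f).eval s = e.eval s * f.eval s := rfl
@[simp] theorem Expr.eval_div : (e / f).eval s = e.eval s / f.eval s := rfl
@[simp] theorem Expr.eval_zero : (0 : Expr).eval s = 0 := rfl
@[simp] theorem Expr.eval_one : (1 : Expr).eval s = 1 := rfl
@[simp] theorem Expr.eval_ofNat (k : ℕ) [k.AtLeastTwo] :
    (ofNat(k) : Expr).eval s = ofNat(k) := rfl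
@[simp] theorem Expr.eval_leq :
    (e.leq f).eval s = if e.eval s ≤ f.eval s then 1 else 0 := rfl
@[simp] theorem Expr.eval_eqv :
    (e.eqv f).eval s = if e.eval s = f.eval s then 1 else 0 := rfl
@[simp] theorem Expr.eval_var (a : ℕ) : (Expr.var a).eval s = s a 0 := rfl
@[simp] theorem Expr.eval_read (a : ℕ) : (Expr.read a e).eval s = s a (e.eval s) := rfl
end eval

theorem Store.write_of_ne (s : Store) {a b : ℕ} (h : b ≠ a) (j z : ℤ) :
    s.write a j z b = s b := by
  funext i; simp [Store.write, h]

@[simp] theorem Store.write_same (s : Store) (a : ℕ) (j z : ℤ) : s.write a j z a j = z := by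
  simp [Store.write]

theorem Store.write_cell_ne (s : Store) (a : ℕ) {i j : ℤ} (h : i ≠ j) (z : ℤ) :
    s.write a j z a i = s a i := by
  simp [Store.write, h]

/-! ### Sizes -/

theorem bitSize_mul (x y : ℤ) : bitSize (x * y) ≤ bitSize x + bitSize y := by
  unfold bitSize
  have : (x * y).natAbs.size ≤ x.natAbs.size + y.natAbs.size := by
    rw [Nat.size_le, Int.natAbs_mul, pow_add]
    exact Nat.mul_lt_mul'' (Nat.lt_size_self _) (Nat.lt_size_self _)
  omega

theorem bitSize_le_of_natAbs_le_sum {x y z : ℤ} (h : z.natAbs ≤ x.natAbs + y.natAbs) :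
    bitSize z ≤ bitSize x + bitSize y := by
  unfold bitSize
  have : z.natAbs.size ≤ x.natAbs.size + y.natAbs.size + 1 := by
    rw [Nat.size_le]
    have h1 : x.natAbs < 2 ^ (x.natAbs.size + y.natAbs.size) :=
      (Nat.lt_size_self _).trans_le (Nat.pow_le_pow_right (by norm_num) (by omega))
    have h2 : y.natAbs < 2 ^ (x.natAbs.size + y.natAbs.size) :=
      (Nat.lt_size_self _).trans_le (Nat.pow_le_pow_right (by norm_num) (by omega))
    rw [pow_succ]; omega
  omega

theorem bitSize_le_two {z : ℤ} (h : z.natAbs ≤ 1) : bitSize z ≤ 2 := by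
  unfold bitSize
  have : z.natAbs.size ≤ 1 := by rw [Nat.size_le]; omega
  omega

/-- Products force an additive bound, and it serves all operations: the carry bit of a sum is paid
for by the sign bits. Hence a fixed expression lengthens the numbers in memory only by a constant
factor. -/
theorem Op.bitSize_apply (o : Op) (x y : ℤ) :
    bitSize (o.apply x y) ≤ bitSize x + bitSize y := by
  have h2 : 2 ≤ bitSize x + bitSize y := by unfold bitSize; omega
  cases o with
  | add => exact bitSize_le_of_natAbs_le_sum (Int.natAbs_add_le x y)
  | sub => exact bitSize_le_of_natAbs_le_sum (Int.natAbs_sub_le x y)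
  | mul => exact bitSize_mul x y
  | div =>
    exact bitSize_le_of_natAbs_le_sum
      ((Int.natAbs_ediv_le_natAbs x y).trans (Nat.le_add_right _ _))
  | le => exact (bitSize_le_two (by simp only [Op.apply]; split_ifs <;> simp)).trans h2
  | eq => exact (bitSize_le_two (by simp only [Op.apply]; split_ifs <;> simp)).trans h2

/-- All cells contain numbers of absolute value at most `M`. -/
def Store.Bdd (M : ℕ) (s : Store) : Prop := ∀ a j, |s a j| ≤ (M : ℤ)

theorem Store.Bdd.bitSize_le {M : ℕ} {s : Store} (h : s.Bdd M) (a : ℕ) (j : ℤ) :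
    bitSize (s a j) ≤ M.size + 1 := by
  unfold bitSize
  have := Nat.size_le_size (m := (s a j).natAbs) (n := M) (by have := abs_le.mp (h a j); omega)
  omega

theorem Store.Bdd.write {M : ℕ} {s : Store} (h : s.Bdd M) (a : ℕ) (j : ℤ) {z : ℤ}
    (hz : |z| ≤ (M : ℤ)) : (s.write a j z).Bdd M := by
  intro b i
  unfold Store.write
  split_ifs
  · exact hz
  · exact h b i

/-- A factor by which the size of the value of an expression exceeds the sizes in memory. -/
def Expr.sizeWeight : Expr → ℕ
  | .const z => bitSize z
  | .read _ _ => 1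
  | .bin _ e f => e.sizeWeight + f.sizeWeight

/-- A factor by which the cost of an expression exceeds the squared sizes in memory. -/
def Expr.weight : Expr → ℕ
  | .const z => bitSize z
  | .read _ i => i.weight + i.sizeWeight + 1
  | .bin _ e f => e.weight + f.weight + e.sizeWeight * f.sizeWeight

theorem Expr.bitSize_eval_le {M : ℕ} {s : Store} (h : s.Bdd M) (e : Expr) :
    bitSize (e.eval s) ≤ e.sizeWeight * (M.size + 1) := by
  induction e with
  | const z => exact Nat.le_mul_of_pos_right _ (by omega)
  | read a i _ => simpa [Expr.sizeWeight] using h.bitSize_le a _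
  | bin o e f he hf =>
    refine (o.bitSize_apply _ _).trans ?_
    rw [Expr.sizeWeight, add_mul]
    exact Nat.add_le_add he hf

theorem Expr.cost_le {M : ℕ} {s : Store} (h : s.Bdd M) (e : Expr) :
    e.cost s ≤ e.weight * (M.size + 1) ^ 2 := by
  have hB : M.size + 1 ≤ (M.size + 1) ^ 2 := Nat.le_self_pow (by norm_num) _
  induction e with
  | const z => exact Nat.le_mul_of_pos_right _ (by positivity)
  | read a i ih =>
    simp only [Expr.cost, Expr.weight, add_mul, one_mul]
    have h1 := (i.bitSize_eval_le h).trans (Nat.mul_le_mul_left _ hB)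
    have h2 := (h.bitSize_le a (i.eval s)).trans hB
    omega
  | bin o e f he hf =>
    simp only [Expr.cost, Expr.weight, add_mul]
    have h1 := Nat.mul_le_mul (e.bitSize_eval_le h) (f.bitSize_eval_le h)
    have h2 : e.sizeWeight * (M.size + 1) * (f.sizeWeight * (M.size + 1)) =
      e.sizeWeight * f.sizeWeight * (M.size + 1) ^ 2 := by ring
    omega

/-! ### Counting steps -/

/-- The cost of one step of a program, relative to the squared sizes in memory. -/
def Prog.weight : Prog → ℕ
  | .nop => 1
  | .assign _ i e => 1 + i.weight + e.weight + i.sizeWeight + e.sizeWeight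
  | .seq p q => p.weight + q.weight
  | .cond e p q => 1 + e.weight + p.weight + q.weight
  | .loop e p => 1 + e.weight + p.weight

/-- `Run M p s k s'`: the program `p` leads from `s` to `s'` in `k` steps, and all numbers that
are in memory whenever an expression is evaluated have absolute value at most `M`. -/
inductive Run (M : ℕ) : Prog → Store → ℕ → Store → Prop
  | nop (s : Store) : Run M .nop s 1 s
  | assign {s : Store} (a : ℕ) (i e : Expr) (hs : s.Bdd M) :
      Run M (.assign a i e) s 1 (s.write a (i.eval s) (e.eval s))
  | seq {p q : Prog} {s s' s'' : Store} {t t' : ℕ} :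
      Run M p s t s' → Run M q s' t' s'' → Run M (.seq p q) s (t + t') s''
  | cond_true {e : Expr} {p q : Prog} {s s' : Store} {t : ℕ} (hs : s.Bdd M) :
      e.eval s ≠ 0 → Run M p s t s' → Run M (.cond e p q) s (1 + t) s'
  | cond_false {e : Expr} {p q : Prog} {s s' : Store} {t : ℕ} (hs : s.Bdd M) :
      e.eval s = 0 → Run M q s t s' → Run M (.cond e p q) s (1 + t) s'
  | loop_true {e : Expr} {p : Prog} {s s' s'' : Store} {t t' : ℕ} (hs : s.Bdd M) :
      e.eval s ≠ 0 → Run M p s t s' → Run M (.loop e p) s' t' s'' →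
      Run M (.loop e p) s (1 + t + t') s''
  | loop_false {e : Expr} {p : Prog} {s : Store} (hs : s.Bdd M) :
      e.eval s = 0 → Run M (.loop e p) s 1 s

/-- One step evaluates boundedly many fixed expressions on numbers of at most `M.size` bits, at a
cost quadratic in the length. This separates the analysis of costs from that of the algorithm: only
steps and magnitudes remain to be bounded. -/
theorem Run.exec {M : ℕ} {p : Prog} {s s' : Store} {k : ℕ} (h : Run M p s k s') :
    ∃ t, Exec p s t s' ∧ t ≤ k * (p.weight * (M.size + 1) ^ 2) := by
  have hB : M.size + 1 ≤ (M.size + 1) ^ 2 := Nat.le_self_pow (by norm_num) _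
  have h1 : 1 ≤ (M.size + 1) ^ 2 := by omega
  generalize hU : (M.size + 1) ^ 2 = U at *
  have hcost : ∀ {s : Store}, s.Bdd M → ∀ e : Expr, e.cost s ≤ e.weight * U :=
    fun hs e => hU ▸ e.cost_le hs
  induction h with
  | nop s => exact ⟨1, .nop s, by simpa [Prog.weight] using h1⟩
  | assign a i e hs =>
    refine ⟨_, .assign _ a i e, ?_⟩
    have h2 := hcost hs i
    have h3 := hcost hs e
    have h4 := (i.bitSize_eval_le hs).trans (Nat.mul_le_mul_left _ hB)
    have h5 := (e.bitSize_eval_le hs).trans (Nat.mul_le_mul_left _ hB)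
    simp only [Prog.weight, add_mul, one_mul]
    omega
  | seq _ _ ih1 ih2 =>
    obtain ⟨t1, e1, b1⟩ := ih1
    obtain ⟨t2, e2, b2⟩ := ih2
    refine ⟨_, .seq e1 e2, ?_⟩
    rw [add_mul]
    refine Nat.add_le_add (b1.trans ?_) (b2.trans ?_) <;> gcongr <;> simp [Prog.weight]
  | @cond_true e p q s s' t hs he _ ih =>
    obtain ⟨t1, e1, b1⟩ := ih
    refine ⟨_, .cond_true he e1, ?_⟩
    have h2 := hcost hs e
    have h3 : t * (p.weight * U) ≤ t * ((Prog.cond e p q).weight * U) := by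
      gcongr; simp only [Prog.weight]; omega
    have h4 : U + e.weight * U ≤ (Prog.cond e p q).weight * U := by
      rw [← one_add_mul]; gcongr; simp only [Prog.weight]; omega
    rw [add_mul, one_mul]; omega
  | @cond_false e p q s s' t hs he _ ih =>
    obtain ⟨t1, e1, b1⟩ := ih
    refine ⟨_, .cond_false he e1, ?_⟩
    have h2 := hcost hs e
    have h3 : t * (q.weight * U) ≤ t * ((Prog.cond e p q).weight * U) := by
      gcongr; simp only [Prog.weight]; omega
    have h4 : U + e.weight * U ≤ (Prog.cond e p q).weight * U := by
      rw [← one_add_mul]; gcongr; simp only [Prog.weight]; omega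
    rw [add_mul, one_mul]; omega
  | @loop_true e p s s' s'' t t' hs he _ _ ih ih' =>
    obtain ⟨t1, e1, b1⟩ := ih
    obtain ⟨t2, e2, b2⟩ := ih'
    refine ⟨_, .loop_true he e1 e2, ?_⟩
    have h2 := hcost hs e
    have h3 : t * (p.weight * U) ≤ t * ((Prog.loop e p).weight * U) := by
      gcongr; simp only [Prog.weight]; omega
    have h4 : U + e.weight * U ≤ (Prog.loop e p).weight * U := by
      rw [← one_add_mul]; gcongr; simp only [Prog.weight]; omega
    rw [add_mul, add_mul, one_mul]; omega
  | @loop_false e p s hs he =>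
    refine ⟨_, .loop_false he, ?_⟩
    have h2 := hcost hs e
    have h4 : U + e.weight * U ≤ (Prog.loop e p).weight * U := by
      rw [← one_add_mul]; gcongr; simp only [Prog.weight]; omega
    rw [one_mul]; omega

/-! ### Total correctness with step bounds -/

/-- Started in `s`, the program `p` halts within `k` steps in a store satisfying `Q`, with all
numbers staying within `M`. -/
def Halts (M : ℕ) (p : Prog) (k : ℕ) (s : Store) (Q : Store → Prop) : Prop :=
  s.Bdd M → ∃ k' ≤ k, ∃ s', Run M p s k' s' ∧ s'.Bdd M ∧ Q s'

/-- The stores agree outside the arrays in `A`. -/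
def Frame (A : List ℕ) (s s' : Store) : Prop := ∀ a, a ∉ A → s' a = s a

theorem Frame.refl (A : List ℕ) (s : Store) : Frame A s s := fun _ _ => rfl

theorem Frame.trans {A : List ℕ} {s s' s'' : Store} (h : Frame A s s') (h' : Frame A s' s'') :
    Frame A s s'' := fun a ha => (h' a ha).trans (h a ha)

theorem Frame.mono {A A' : List ℕ} {s s' : Store} (h : Frame A s s') (hA : A ⊆ A') :
    Frame A' s s' := fun a ha => h a fun h' => ha (hA h')

theorem Frame.write (s : Store) (a : ℕ) (j z : ℤ) : Frame [a] s (s.write a j z) :=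
  fun b hb => s.write_of_ne (by simpa using hb) j z

section rules
variable {M : ℕ} {s : Store} {Q R : Store → Prop} {p q : Prog} {k k' : ℕ}

theorem Halts.mono (h : Halts M p k s R) (hk : k ≤ k') (hQ : ∀ s', R s' → Q s') :
    Halts M p k' s Q := by
  intro hs
  obtain ⟨n, hn, s', h1, h2, h3⟩ := h hs
  exact ⟨n, hn.trans hk, s', h1, h2, hQ _ h3⟩

theorem Halts.nop (h : Q s) : Halts M .nop 1 s Q := fun hs => ⟨1, le_rfl, s, .nop s, hs, h⟩

theorem Halts.assign {a : ℕ} {i e : Expr} (he : |e.eval s| ≤ (M : ℤ))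
    (h : Q (s.write a (i.eval s) (e.eval s))) : Halts M (.assign a i e) 1 s Q :=
  fun hs => ⟨1, le_rfl, _, .assign a i e hs, hs.write _ _ he, h⟩

theorem Halts.seq (hp : Halts M p k s R) (hq : ∀ s', R s' → Halts M q k' s' Q) :
    Halts M (.seq p q) (k + k') s Q := by
  intro hs
  obtain ⟨n, hn, s', h1, h2, h3⟩ := hp hs
  obtain ⟨n', hn', s'', h1', h2', h3'⟩ := hq s' h3 h2
  exact ⟨n + n', by omega, s'', .seq h1 h1', h2', h3'⟩

theorem Halts.cond {e : Expr} (hp : e.eval s ≠ 0 → Halts M p k s Q)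
    (hq : e.eval s = 0 → Halts M q k' s Q) : Halts M (.cond e p q) (1 + k + k') s Q := by
  intro hs
  by_cases he : e.eval s = 0
  · obtain ⟨n, hn, s', h1, h2, h3⟩ := hq he hs
    exact ⟨1 + n, by omega, s', .cond_false hs he h1, h2, h3⟩
  · obtain ⟨n, hn, s', h1, h2, h3⟩ := hp he hs
    exact ⟨1 + n, by omega, s', .cond_true hs he h1, h2, h3⟩

/-- Counting loop: `c` runs through the numbers below `b`. -/
def forP (c : ℕ) (b : Expr) (p : Prog) : Prog :=
  .seq (.assign c 0 0) (.loop ((Expr.var c + 1).leq b) (.seq p (.assign c 0 (.var c + 1))))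

/-- The invariant has to survive writes to the counter (`hst`), so the increment needs no separate
treatment. Each round pays for the body, a test and an increment; the final `2` is the
initialisation and the failing test. -/
theorem Halts.forP {c : ℕ} {b : Expr} (N : ℕ) (Inv : ℕ → Store → Prop) (hN : N ≤ M)
    (hst : ∀ i s s', Frame [c] s s' → Inv i s → Inv i s')
    (h0 : Inv 0 s)
    (hb : ∀ i s', i ≤ N → Inv i s' → b.eval s' = N)
    (hp : ∀ i s', i < N → Inv i s' → s' c 0 = i →
      Halts M p k s' fun s'' => s'' c 0 = i ∧ Inv (i + 1) s'')
    (hQ : ∀ s', Inv N s' → Q s') : Halts M (forP c b p) (N * (k + 2) + 2) s Q := by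
  have main : ∀ r i s', i + r = N → Inv i s' → s' c 0 = i →
      Halts M (.loop ((Expr.var c + 1).leq b) (.seq p (.assign c 0 (.var c + 1))))
        (r * (k + 2) + 1) s' Q := by
    intro r
    induction r with
    | zero =>
      intro i s' hi hI hc hs'
      refine ⟨1, by omega, s', .loop_false hs' ?_, hs', hQ s' (by simpa [← hi] using hI)⟩
      have := hb i s' (by omega) hI
      simp [hc, this]; omega
    | succ r ih =>
      intro i s' hi hI hc hs'
      obtain ⟨n, hn, s'', h1, h2, h3, h4⟩ := hp i s' (by omega) hI hc hs'
      have hb' : |(Expr.var c + 1).eval s''| ≤ (M : ℤ) := by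
        simp only [Expr.eval_add, Expr.eval_var, h3, Expr.eval_one]
        rw [abs_of_nonneg (by positivity)]; omega
      obtain ⟨n', hn', s3, h5, h6, h7⟩ := ih (i + 1)
        (s''.write c ((0 : Expr).eval s'') ((Expr.var c + 1).eval s'')) (by omega)
        (hst _ _ _ (Frame.write _ _ _ _) h4) (by simp [h3]) (h2.write _ _ hb')
      refine ⟨1 + (n + 1) + n', ?_, s3, .loop_true hs' ?_ (.seq h1 (.assign c _ _ h2)) h5, h6, h7⟩
      · rw [add_mul]; omega
      · have := hb i s' (by omega) hI
        simp [hc, this]; omega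
  have := Halts.seq (M := M) (s := s) (p := .assign c 0 0) (k := 1)
    (R := fun s' => s' c 0 = 0 ∧ Inv 0 s')
    (.assign (by simp) ⟨by simp, hst _ _ _ (Frame.write _ _ _ _) h0⟩)
    (fun s' hs' => main N 0 s' (by simp) hs'.2 (by simpa using hs'.1))
  exact this.mono (by omega) fun _ h => h

/-- Filling the first `b` cells of an array; `p` prepares the value `e` of the cell at `c`. -/
def fillP (arr c : ℕ) (b : Expr) (p : Prog) (e : Expr) : Prog :=
  forP c b (.seq p (.assign arr (.var c) e))

/-- In `hp` the cell about to be filled still has its old contents. This admits updates in place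
where a new entry depends on the old entry of the same cell. -/
theorem Halts.fillP {arr c : ℕ} {b e : Expr} (N : ℕ) (f : ℕ → ℤ) (A : List ℕ) (hN : N ≤ M)
    (hc : c ∉ A) (harr : arr ∉ A) (hca : c ≠ arr)
    (hb : ∀ s', Frame (arr :: c :: A) s s' → b.eval s' = N)
    (hf : ∀ i < N, |f i| ≤ (M : ℤ))
    (hp : ∀ i < N, ∀ s', Frame (arr :: c :: A) s s' → s' c 0 = i → s' arr i = s arr i →
      Halts M p k s' fun s'' => Frame A s' s'' ∧ e.eval s'' = f i)
    (hQ : ∀ s', Frame (arr :: c :: A) s s' → (∀ i < N, s' arr i = f i) → Q s') :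
    Halts M (fillP arr c b p e) (N * (k + 3) + 2) s Q := by
  refine Halts.forP (k := k + 1) N (fun i s' => Frame (arr :: c :: A) s s' ∧
    (∀ j : ℕ, j < i → s' arr j = f j) ∧ ∀ j : ℕ, i ≤ j → s' arr j = s arr j) hN ?_ ?_ ?_ ?_ ?_
  · rintro i s1 s2 hs ⟨h1, h2, h3⟩
    have : s2 arr = s1 arr := hs arr (by simpa using hca.symm)
    rw [this]
    exact ⟨h1.trans (hs.mono (by simp)), h2, h3⟩
  · exact ⟨Frame.refl _ _, by simp, by simp⟩
  · rintro i s' - ⟨h1, -⟩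
    exact hb s' h1
  · rintro i s' hi ⟨h1, h2, h3⟩ hci
    refine Halts.seq (hp i hi s' h1 hci (h3 i le_rfl)) ?_
    rintro s'' ⟨h4, h5⟩
    have hci' : s'' c 0 = i := by rw [h4 c hc, hci]
    have harr' : s'' arr = s' arr := h4 arr harr
    refine Halts.assign (by rw [h5]; exact hf i hi) ⟨?_, ?_, ?_, ?_⟩
    · rw [Store.write_of_ne _ hca, hci']
    · exact (h1.trans (h4.mono (by intro x; simp +contextual))).trans
        ((Frame.write _ _ _ _).mono (by simp))
    · intro j hj
      rw [Expr.eval_var, hci']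
      rcases Nat.lt_succ_iff_lt_or_eq.mp hj with h | rfl
      · rw [Store.write_cell_ne _ _ (by omega), harr', h2 j h]
      · rw [Store.write_same, h5]
    · intro j hj
      rw [Expr.eval_var, hci', Store.write_cell_ne _ _ (by omega), harr', h3 j (by omega)]
  · rintro s' ⟨h1, h2, -⟩
    exact hQ s' h1 h2

/-- `acc` becomes the sum of the values of `e` at the numbers below `b`. -/
def sumP (acc c : ℕ) (b e : Expr) : Prog :=
  .seq (.assign acc 0 0) (forP c b (.assign acc 0 (.var acc + e)))

theorem Halts.sumP {acc c : ℕ} {b e : Expr} (N : ℕ) (f : ℕ → ℤ) (hN : N ≤ M) (hca : c ≠ acc)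
    (hb : ∀ s', Frame [acc, c] s s' → b.eval s' = N)
    (he : ∀ i < N, ∀ s', Frame [acc, c] s s' → s' c 0 = i → e.eval s' = f i)
    (hf : ∀ i ≤ N, |∑ j ∈ Finset.range i, f j| ≤ (M : ℤ))
    (hQ : ∀ s', Frame [acc, c] s s' → s' acc 0 = ∑ j ∈ Finset.range N, f j → Q s') :
    Halts M (sumP acc c b e) (N * 3 + 3) s Q := by
  refine (Halts.seq (k := 1) (k' := N * (1 + 2) + 2)
    (R := fun s' => Frame [acc, c] s s' ∧ s' acc 0 = 0) ?_ ?_).mono (by omega) fun _ h => h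
  · exact .assign (by simp) ⟨(Frame.write _ _ _ _).mono (by simp), by simp⟩
  rintro s0 ⟨hs0, h00⟩
  refine Halts.forP (k := 1) N (fun i s' => Frame [acc, c] s s' ∧
    s' acc 0 = ∑ j ∈ Finset.range i, f j) hN ?_ ?_ ?_ ?_ ?_
  · rintro i s1 s2 hs ⟨h1, h2⟩
    exact ⟨h1.trans (hs.mono (by simp)), by rw [hs acc (by simpa using hca.symm), h2]⟩
  · exact ⟨hs0, by simpa using h00⟩
  · rintro i s' - ⟨h1, -⟩
    exact hb s' h1
  · rintro i s' hi ⟨h1, h2⟩ hci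
    have hv : (Expr.var acc + e).eval s' = ∑ j ∈ Finset.range (i + 1), f j := by
      rw [Expr.eval_add, Expr.eval_var, h2, he i hi s' h1 hci, Finset.sum_range_succ]
    refine .assign (by rw [hv]; exact hf _ hi) ⟨?_, ?_, ?_⟩
    · rw [Store.write_of_ne _ hca, hci]
    · exact h1.trans ((Frame.write _ _ _ _).mono (by simp))
    · rw [hv]; simp
  · rintro s' ⟨h1, h2⟩
    exact hQ s' h1 h2

/-- The first position of a positive maximum of `f` below a bound and the maximum; position `b`
and value `0` if there is no positive value. -/
def argmax (f : ℕ → ℤ) (b : ℕ) : ℕ → ℕ × ℤ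
  | 0 => (b, 0)
  | N + 1 => if (argmax f b N).2 + 1 ≤ f N then (N, f N) else argmax f b N

theorem argmax_nonneg (f : ℕ → ℤ) (b N : ℕ) : 0 ≤ (argmax f b N).2 := by
  induction N with
  | zero => simp [argmax]
  | succ N ih => rw [argmax]; split_ifs <;> (try dsimp only) <;> omega

theorem le_argmax (f : ℕ → ℤ) (b : ℕ) {N i : ℕ} (hi : i < N) : f i ≤ (argmax f b N).2 := by
  induction N with
  | zero => omega
  | succ N ih =>
    rw [argmax]
    rcases Nat.lt_succ_iff_lt_or_eq.mp hi with h | rfl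
    · have := ih h
      split_ifs <;> (try dsimp only) <;> omega
    · split_ifs <;> (try dsimp only) <;> omega

theorem argmax_cases (f : ℕ → ℤ) (b N : ℕ) :
    (argmax f b N = (b, 0) ∧ ∀ i < N, f i ≤ 0) ∨
    ((argmax f b N).1 < N ∧ 0 < (argmax f b N).2 ∧
      f (argmax f b N).1 = (argmax f b N).2) := by
  induction N with
  | zero => simp [argmax]
  | succ N ih =>
    have h0 := argmax_nonneg f b N
    by_cases h : (argmax f b N).2 + 1 ≤ f N
    · right; rw [argmax, if_pos h]; exact ⟨by simp, by simp; omega, rfl⟩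
    · rw [argmax, if_neg h]
      rcases ih with ⟨h1, h2⟩ | ⟨h1, h2, h3⟩
      · left
        refine ⟨h1, fun i hi => ?_⟩
        rcases Nat.lt_succ_iff_lt_or_eq.mp hi with h' | rfl
        · exact h2 i h'
        · rw [h1] at h; simp at h; omega
      · right; exact ⟨by omega, h2, h3⟩

/-- Maximum search; see `argmax`. -/
def argmaxP (best bv c : ℕ) (b init e : Expr) : Prog :=
  .seq (.assign best 0 init) (.seq (.assign bv 0 0)
    (forP c b (.cond ((Expr.var bv + 1).leq e)
      (.seq (.assign best 0 (.var c)) (.assign bv 0 e)) .nop)))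

theorem Halts.argmaxP {best bv c : ℕ} {b init e : Expr} (N b₀ : ℕ) (f : ℕ → ℤ) (hN : N ≤ M)
    (hb₀ : b₀ ≤ M) (h1 : c ≠ best) (h2 : c ≠ bv) (h3 : best ≠ bv)
    (hi : init.eval s = b₀)
    (hb : ∀ s', Frame [best, bv, c] s s' → b.eval s' = N)
    (he : ∀ i < N, ∀ s', Frame [best, bv, c] s s' → s' c 0 = i → e.eval s' = f i)
    (hf : ∀ i < N, |f i| ≤ (M : ℤ))
    (hQ : ∀ s', Frame [best, bv, c] s s' → s' best 0 = (argmax f b₀ N).1 →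
      s' bv 0 = (argmax f b₀ N).2 → Q s') :
    Halts M (argmaxP best bv c b init e) (N * 6 + 4) s Q := by
  refine (Halts.seq (k := 1) (k' := 1 + (N * ((1 + (1 + 1) + 1) + 2) + 2))
    (R := fun s' => Frame [best, bv, c] s s' ∧ s' best 0 = b₀) ?_ ?_).mono (by omega)
    fun _ h => h
  · refine .assign (by rw [hi, abs_of_nonneg (by positivity)]; exact_mod_cast hb₀)
      ⟨(Frame.write _ _ _ _).mono (by simp), by simp [hi]⟩
  rintro s0 ⟨hs0, h00⟩
  refine Halts.seq (R := fun s' => Frame [best, bv, c] s s' ∧ s' best 0 = b₀ ∧ s' bv 0 = 0) ?_ ?_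
  · refine .assign (by simp) ⟨hs0.trans ((Frame.write _ _ _ _).mono (by simp)), ?_, by simp⟩
    rw [Store.write_of_ne _ h3, h00]
  rintro s0 ⟨hs0, h00, h01⟩
  refine Halts.forP (k := 1 + (1 + 1) + 1) N (fun i s' => Frame [best, bv, c] s s' ∧
    s' best 0 = (argmax f b₀ i).1 ∧ s' bv 0 = (argmax f b₀ i).2) hN ?_ ?_ ?_ ?_ ?_
  · rintro i s1 s2 hs ⟨g1, g2, g3⟩
    rw [hs best (by simpa using h1.symm), hs bv (by simpa using h2.symm)]
    exact ⟨g1.trans (hs.mono (by simp)), g2, g3⟩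
  · exact ⟨hs0, h00, h01⟩
  · rintro i s' - ⟨g1, -⟩
    exact hb s' g1
  · rintro i s' hiN ⟨g1, g2, g3⟩ hci
    have hev := he i hiN s' g1 hci
    refine Halts.cond ?_ ?_
    · intro hc
      have hc' : (argmax f b₀ i).2 + 1 ≤ f i := by
        by_contra hcon; apply hc; simp [g3, hev]; omega
      refine Halts.seq (R := fun s'' => Frame [best, bv, c] s s'' ∧ s'' c 0 = i ∧ s'' best 0 = i)
        (.assign ?_ ⟨g1.trans ((Frame.write _ _ _ _).mono (by simp)), ?_, ?_⟩) ?_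
      · rw [Expr.eval_var, hci, abs_of_nonneg (by positivity)]; omega
      · rw [Store.write_of_ne _ h1, hci]
      · simp [hci]
      · rintro s'' ⟨g4, g5, g6⟩
        have hev' := he i hiN s'' g4 g5
        refine .assign (by rw [hev']; exact hf i hiN)
          ⟨?_, g4.trans ((Frame.write _ _ _ _).mono (by simp)), ?_, ?_⟩
        · rw [Store.write_of_ne _ h2, g5]
        · rw [Store.write_of_ne _ h3, g6, argmax, if_pos hc']
        · rw [Expr.eval_zero, Store.write_same, hev', argmax, if_pos hc']
    · intro hc
      have hc' : ¬ (argmax f b₀ i).2 + 1 ≤ f i := by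
        intro hcon; simp [g3, hev, hcon] at hc
      refine .nop ⟨hci, g1, ?_⟩
      rw [argmax, if_neg hc']
      exact ⟨g2, g3⟩
  · rintro s' ⟨g1, g2, g3⟩
    exact hQ s' g1 g2 g3

end rules

open Finset

/-! ### Approximate linear dependencies by gradient descent -/

/-- Matrix times vector. -/
def mulY (X : ℕ → ℕ → ℤ) (m : ℕ) (y : ℕ → ℤ) (r : ℕ) : ℤ := ∑ j ∈ range m, X r j * y j

/-- Iterating `y ↦ L y - Xᵀ X y`. -/
def descend (X : ℕ → ℕ → ℤ) (R m L : ℕ) (y : ℕ → ℤ) : ℕ → ℕ → ℤ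
  | 0 => y
  | k + 1 => fun j =>
      L * descend X R m L y k j - ∑ r ∈ range R, X r j * mulY X m (descend X R m L y k) r

/-- Expand the square of `L v - Xᵀ z` with `z = X v`. The cross term is `-2 L ‖z‖²`, and `‖Xᵀ z‖² ≤
L ‖z‖²` by Cauchy–Schwarz, since `L` bounds the squared Frobenius norm. -/
theorem descend_energy (X : ℕ → ℕ → ℤ) {R m L : ℕ}
    (hL : ∑ j ∈ range m, ∑ r ∈ range R, X r j ^ 2 ≤ (L : ℤ)) (y : ℕ → ℤ) (k : ℕ) :
    ∑ j ∈ range m, descend X R m L y (k + 1) j ^ 2 +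
        L * ∑ r ∈ range R, mulY X m (descend X R m L y k) r ^ 2 ≤
      L ^ 2 * ∑ j ∈ range m, descend X R m L y k j ^ 2 := by
  set v := descend X R m L y k
  set z := mulY X m v
  have h1 : ∑ j ∈ range m, v j * ∑ r ∈ range R, X r j * z r = ∑ r ∈ range R, z r ^ 2 := by
    simp_rw [mul_sum]
    rw [sum_comm]
    refine sum_congr rfl fun r _ => ?_
    rw [sq, show z r * z r = z r * ∑ j ∈ range m, X r j * v j from rfl, mul_sum]
    exact sum_congr rfl fun j _ => by ring
  have h2 : ∑ j ∈ range m, (∑ r ∈ range R, X r j * z r) ^ 2 ≤ L * ∑ r ∈ range R, z r ^ 2 := by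
    calc _ ≤ ∑ j ∈ range m, (∑ r ∈ range R, X r j ^ 2) * ∑ r ∈ range R, z r ^ 2 :=
          sum_le_sum fun j _ => sum_mul_sq_le_sq_mul_sq _ _ _
      _ = (∑ j ∈ range m, ∑ r ∈ range R, X r j ^ 2) * ∑ r ∈ range R, z r ^ 2 := by
          rw [sum_mul]
      _ ≤ _ := mul_le_mul_of_nonneg_right hL (sum_nonneg fun _ _ => sq_nonneg _)
  have h3 : ∑ j ∈ range m, descend X R m L y (k + 1) j ^ 2 =
      L ^ 2 * ∑ j ∈ range m, v j ^ 2 - 2 * L * ∑ j ∈ range m, v j * ∑ r ∈ range R, X r j * z r +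
        ∑ j ∈ range m, (∑ r ∈ range R, X r j * z r) ^ 2 := by
    rw [mul_sum, mul_sum, ← sum_sub_distrib, ← sum_add_distrib]
    refine sum_congr rfl fun j _ => ?_
    simp only [descend, v, z]
    ring
  rw [h3, h1]
  linarith

/-- This limits the length of the numbers in the descent: it grows linearly with the number of
iterations. -/
theorem descend_bound (X : ℕ → ℕ → ℤ) {R m L : ℕ}
    (hL : ∑ j ∈ range m, ∑ r ∈ range R, X r j ^ 2 ≤ (L : ℤ)) {y : ℕ → ℤ}
    (hy : ∑ j ∈ range m, y j ^ 2 ≤ 1) (k : ℕ) :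
    ∑ j ∈ range m, descend X R m L y k j ^ 2 ≤ ((L : ℤ) ^ k) ^ 2 := by
  induction k with
  | zero => simpa [descend] using hy
  | succ k ih =>
    have h := descend_energy X hL y k
    have h0 : 0 ≤ (L : ℤ) * ∑ r ∈ range R, mulY X m (descend X R m L y k) r ^ 2 :=
      mul_nonneg (by positivity) (sum_nonneg fun _ _ => sq_nonneg _)
    have := mul_le_mul_of_nonneg_left ih (sq_nonneg (L : ℤ))
    calc _ ≤ (L : ℤ) ^ 2 * ∑ j ∈ range m, descend X R m L y k j ^ 2 := by linarith
      _ ≤ (L : ℤ) ^ 2 * ((L : ℤ) ^ k) ^ 2 := this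
      _ = _ := by ring

/-- `Xᵀ X` is symmetric and annihilates `u`, so only the summand `L y` acts on the component along
`u`. -/
theorem inner_descend (X : ℕ → ℕ → ℤ) (R m L : ℕ) {u : ℕ → ℚ}
    (hu : ∀ r < R, ∑ j ∈ range m, (X r j : ℚ) * u j = 0) (y : ℕ → ℤ) (k : ℕ) :
    ∑ j ∈ range m, u j * descend X R m L y k j = L ^ k * ∑ j ∈ range m, u j * y j := by
  induction k with
  | zero => simp [descend]
  | succ k ih =>
    have h : ∑ j ∈ range m, u j *
        ((∑ r ∈ range R, X r j * mulY X m (descend X R m L y k) r : ℤ) : ℚ) = 0 := by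
      push_cast
      simp_rw [mul_sum]
      rw [sum_comm]
      refine sum_eq_zero fun r hr => ?_
      have := hu r (mem_range.mp hr)
      calc _ = (∑ j ∈ range m, (X r j : ℚ) * u j) * (mulY X m (descend X R m L y k) r : ℚ) := by
            rw [sum_mul]; exact sum_congr rfl fun j _ => by ring
        _ = 0 := by rw [this, zero_mul]
    calc _ = L * (∑ j ∈ range m, u j * descend X R m L y k j) - ∑ j ∈ range m, u j *
        ((∑ r ∈ range R, X r j * mulY X m (descend X R m L y k) r : ℤ) : ℚ) := by
          rw [mul_sum, ← sum_sub_distrib]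
          refine sum_congr rfl fun j _ => ?_
          simp only [descend]
          push_cast
          ring
      _ = _ := by rw [h, ih]; ring

/-- If `X` has a kernel vector whose largest entry is at `j₀`, then gradient descent from the
unit vector at `j₀` reaches a vector that is almost annihilated. -/
theorem exists_descend_lt (X : ℕ → ℕ → ℤ) {R m L : ℕ} (hL0 : 0 < L)
    (hL : ∑ j ∈ range m, ∑ r ∈ range R, X r j ^ 2 ≤ (L : ℤ)) {u : ℕ → ℚ} {j₀ : ℕ} (hj₀ : j₀ < m)
    (hmax : ∀ j < m, |u j| ≤ |u j₀|) (hne : u j₀ ≠ 0)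
    (hu : ∀ r < R, ∑ j ∈ range m, (X r j : ℚ) * u j = 0) {y : ℕ → ℤ}
    (hy : ∀ j < m, y j = if j = j₀ then 1 else 0) :
    ∃ k < L * m * m, (∑ r ∈ range R, mulY X m (descend X R m L y k) r ^ 2) * m <
      ∑ j ∈ range m, descend X R m L y k j ^ 2 := by
  have hm : 0 < m := by omega
  by_contra! hcon
  -- `L ^ k * |u j₀|` is the inner product of `u` with the `k`-th iterate, hence at most `|u j₀|`
  -- times the sum of the absolute entries. Cauchy–Schwarz turns that sum into the norm.
  have hlow : ∀ k, ((L : ℤ) ^ k) ^ 2 ≤ m * ∑ j ∈ range m, descend X R m L y k j ^ 2 := by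
    intro k
    have h1 : ∑ j ∈ range m, u j * (y j : ℚ) = u j₀ := by
      rw [sum_eq_single_of_mem j₀ (mem_range.mpr hj₀)]
      · simp [hy j₀ hj₀]
      · intro j hj hne; simp [hy j (mem_range.mp hj), hne]
    have h2 := inner_descend X R m L hu y k
    rw [h1] at h2
    set v := descend X R m L y k
    have h3 : (L : ℚ) ^ k * |u j₀| ≤ |u j₀| * ∑ j ∈ range m, |(v j : ℚ)| := by
      calc (L : ℚ) ^ k * |u j₀| = |∑ j ∈ range m, u j * v j| := by
            rw [h2, abs_mul, abs_of_nonneg (by positivity : (0 : ℚ) ≤ (L : ℚ) ^ k)]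
        _ ≤ ∑ j ∈ range m, |u j * v j| := abs_sum_le_sum_abs _ _
        _ ≤ ∑ j ∈ range m, |u j₀| * |(v j : ℚ)| := sum_le_sum fun j hj => by
            rw [abs_mul]
            exact mul_le_mul_of_nonneg_right (hmax j (mem_range.mp hj)) (abs_nonneg _)
        _ = _ := by rw [mul_sum]
    have h4 : (L : ℚ) ^ k ≤ ∑ j ∈ range m, |(v j : ℚ)| := by
      rw [mul_comm] at h3
      exact le_of_mul_le_mul_left h3 (abs_pos.mpr hne)
    have h5 : (L : ℤ) ^ k ≤ ∑ j ∈ range m, |v j| := by exact_mod_cast h4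
    calc ((L : ℤ) ^ k) ^ 2 ≤ (∑ j ∈ range m, |v j|) ^ 2 := by gcongr
      _ ≤ (range m).card * ∑ j ∈ range m, |v j| ^ 2 := sq_sum_le_card_mul_sum_sq
      _ = _ := by simp
  -- If the claim fails, then by `hlow` each iteration loses at least the fraction `1 / (L m²)` of
  -- `L ^ (2 k)`. After `L m²` iterations nothing would be left, against `hlow`.
  have hup : ∀ k ≤ L * m * m, (L : ℤ) * m * m * ∑ j ∈ range m, descend X R m L y k j ^ 2 ≤
      ((L : ℤ) ^ k) ^ 2 * ((L : ℤ) * m * m - k) := by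
    intro k
    induction k with
    | zero =>
      intro _
      have : ∑ j ∈ range m, y j ^ 2 = 1 := by
        rw [sum_eq_single_of_mem j₀ (mem_range.mpr hj₀)]
        · simp [hy j₀ hj₀]
        · intro j hj hne; simp [hy j (mem_range.mp hj), hne]
      simp [descend, this]
    | succ k ih =>
      intro hk
      have h1 := ih (by omega)
      have h2 := descend_energy X hL y k
      have h3 := hcon k (by omega)
      have h4 := hlow k
      set S := ∑ j ∈ range m, descend X R m L y k j ^ 2
      set S' := ∑ j ∈ range m, descend X R m L y (k + 1) j ^ 2
      set Z := ∑ r ∈ range R, mulY X m (descend X R m L y k) r ^ 2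
      set P := ((L : ℤ) ^ k) ^ 2 with hP
      have h5 : P ≤ (m : ℤ) * m * Z := by
        calc P ≤ m * S := h4
          _ ≤ m * (Z * m) := mul_le_mul_of_nonneg_left h3 (by positivity)
          _ = _ := by ring
      have h6 : (L : ℤ) ^ 2 * P ≤ (L : ℤ) ^ 2 * (m * m * Z) :=
        mul_le_mul_of_nonneg_left h5 (by positivity)
      have h7 := mul_le_mul_of_nonneg_left h2 (by positivity : (0 : ℤ) ≤ (L : ℤ) * m * m)
      have h8 := mul_le_mul_of_nonneg_left h1 (sq_nonneg (L : ℤ))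
      have h9 : ((L : ℤ) ^ (k + 1)) ^ 2 = (L : ℤ) ^ 2 * P := by rw [hP]; ring
      rw [h9]
      push_cast
      linarith
  have h1 := hup (L * m * m) le_rfl
  have h2 := hlow (L * m * m)
  push_cast at h1
  rw [sub_self, mul_zero] at h1
  have h3 : (0 : ℤ) < ((L : ℤ) ^ (L * m * m)) ^ 2 := by positivity
  have h4 : 0 < (L : ℤ) * m := by positivity
  nlinarith [mul_le_mul_of_nonneg_left h2 h4.le, mul_pos h4 h3]

/-! ### Minimal ratios -/

/-- Search for the minimum of `c j / b j`, as a pair of numerator and denominator; `(1, 0)` stands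
for infinity. -/
def ratioMin (c b : ℕ → ℤ) : ℕ → ℤ × ℤ
  | 0 => (1, 0)
  | N + 1 => if c N * (ratioMin c b N).2 + 1 ≤ (ratioMin c b N).1 * b N then (c N, b N)
      else ratioMin c b N

/-- Ratios are compared by cross multiplication. Against the default `(1, 0)` the test reads `1 ≤ b
N`, so the first positive denominator always enters. -/
theorem ratioMin_spec {c b : ℕ → ℤ} {N : ℕ} (hc : ∀ j < N, 0 ≤ c j) (hb : ∀ j < N, 0 ≤ b j)
    (hcb : ∀ j < N, 0 < b j → 0 < c j) :
    0 < (ratioMin c b N).1 ∧ 0 ≤ (ratioMin c b N).2 ∧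
    (∀ j < N, (ratioMin c b N).1 * b j ≤ c j * (ratioMin c b N).2) ∧
    (((ratioMin c b N) = (1, 0) ∧ ∀ j < N, b j = 0) ∨
      (0 < (ratioMin c b N).2 ∧ ∃ j < N, ratioMin c b N = (c j, b j))) := by
  induction N with
  | zero => simp [ratioMin]
  | succ N ih =>
    obtain ⟨h1, h2, h3, h4⟩ := ih (fun j hj => hc j (by omega)) (fun j hj => hb j (by omega))
      (fun j hj => hcb j (by omega))
    have hcN := hc N (by omega)
    have hbN := hb N (by omega)
    rw [ratioMin]
    generalize ratioMin c b N = r at *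
    obtain ⟨u, v⟩ := r
    dsimp only at *
    split_ifs with h
    · have hbp : 0 < b N := by
        by_contra hcon
        have : b N = 0 := by omega
        rw [this, mul_zero] at h
        have := mul_nonneg hcN h2
        omega
      have hcp := hcb N (by omega) hbp
      refine ⟨hcp, hbN, fun j hj => ?_, Or.inr ⟨hbp, N, by omega, rfl⟩⟩
      rcases Nat.lt_succ_iff_lt_or_eq.mp hj with hj | rfl
      · rcases h4 with ⟨-, h4⟩ | ⟨h4, -⟩
        · rw [h4 j hj, mul_zero]
          exact mul_nonneg (hc j (by omega)) hbN
        · have h5 := h3 j hj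
          have h6 := hb j (by omega)
          refine le_of_mul_le_mul_right ?_ h4
          calc c N * b j * v = (c N * v) * b j := by ring
            _ ≤ (u * b N) * b j := mul_le_mul_of_nonneg_right (by omega) h6
            _ = (u * b j) * b N := by ring
            _ ≤ (c j * v) * b N := mul_le_mul_of_nonneg_right h5 hbN
            _ = _ := by ring
      · exact le_rfl
    · refine ⟨h1, h2, fun j hj => ?_, ?_⟩
      · rcases Nat.lt_succ_iff_lt_or_eq.mp hj with hj | rfl
        · exact h3 j hj
        · replace h : ¬ c j * v + 1 ≤ u * b j := h
          change u * b j ≤ c j * v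
          omega
      · rcases h4 with ⟨h4, h5⟩ | ⟨h4, j, hj, h5⟩
        · left
          refine ⟨h4, fun j hj => ?_⟩
          rcases Nat.lt_succ_iff_lt_or_eq.mp hj with hj | rfl
          · exact h5 j hj
          · simp only [Prod.mk.injEq] at h4
            rw [h4.1, h4.2] at h
            omega
        · exact Or.inr ⟨h4, j, by omega, h5⟩

/-! ### Fractional allocations and rounding steps -/

/-- The first agent with a largest share of item `j`. -/
def top (n : ℕ) (p : ℕ → ℕ → ℤ) (j : ℕ) : ℕ := (argmax (fun a => p a j) 0 n).1

/-- An agent with a largest share of item `j` among the agents other than the top one; the top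
one if no other agent has a share. -/
def second (n : ℕ) (p : ℕ → ℕ → ℤ) (j : ℕ) : ℕ :=
  (argmax (fun a => p a j * (1 - if a = top n p j then 1 else 0)) (top n p j) n).1

/-- The shares of item `j` are nonnegative and add up to `D`. -/
def IsDistr (n D : ℕ) (p : ℕ → ℕ → ℤ) (j : ℕ) : Prop :=
  (∀ a < n, 0 ≤ p a j) ∧ ∑ a ∈ range n, p a j = D

section distr
variable {n D : ℕ} {p : ℕ → ℕ → ℤ} {j : ℕ}

theorem IsDistr.top_spec (hD : 0 < D) (h : IsDistr n D p j) :
    top n p j < n ∧ 0 < p (top n p j) j ∧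
    ∀ a < n, p a j ≤ p (top n p j) j := by
  rcases argmax_cases (fun a => p a j) 0 n with ⟨-, h1⟩ | ⟨h1, h2, h3⟩
  · exfalso
    have := sum_nonpos fun a ha => h1 a (mem_range.mp ha)
    have h2 := h.2
    omega
  · refine ⟨h1, h3 ▸ h2, fun a ha => ?_⟩
    have := le_argmax (fun a => p a j) 0 ha
    rw [← h3] at this
    exact this

theorem IsDistr.second_lt (hD : 0 < D) (h : IsDistr n D p j) : second n p j < n := by
  rcases argmax_cases (fun a => p a j * (1 - if a = top n p j then 1 else 0))
    (top n p j) n with ⟨h0, -⟩ | ⟨h1, -⟩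
  · rw [second, h0]; exact (h.top_spec hD).1
  · exact h1

theorem IsDistr.second_pos (hD : 0 < D) (h : IsDistr n D p j) : 0 < p (second n p j) j := by
  rcases argmax_cases (fun a => p a j * (1 - if a = top n p j then 1 else 0))
    (top n p j) n with ⟨h0, -⟩ | ⟨-, h2, h3⟩
  · rw [second, h0]; exact (h.top_spec hD).2.1
  · rw [← h3] at h2
    unfold second
    split_ifs at h2 with h4
    · simp at h2
    · simpa using h2

/-- The search for `second` gives weight zero to the top agent, so it can return that agent only by
default, when no other share is positive. -/
theorem IsDistr.eq_zero_of_second_eq (h : IsDistr n D p j)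
    (hs : second n p j = top n p j) {a : ℕ} (ha : a < n)
    (hat : a ≠ top n p j) : p a j = 0 := by
  rcases argmax_cases (fun a => p a j * (1 - if a = top n p j then 1 else 0))
    (top n p j) n with ⟨-, h1⟩ | ⟨-, h2, h3⟩
  · have h2 := h1 a ha
    simp [hat] at h2
    exact le_antisymm h2 (h.1 a ha)
  · exfalso
    rw [← h3] at h2
    rw [second] at hs
    simp [hs] at h2

theorem IsDistr.top_eq_of_second_eq (hD : 0 < D) (h : IsDistr n D p j)
    (hs : second n p j = top n p j) : p (top n p j) j = D := by
  rw [← h.2]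
  refine (sum_eq_single_of_mem (f := fun a => p a j) _ (mem_range.mpr (h.top_spec hD).1) fun a ha hat => ?_).symm
  exact h.eq_zero_of_second_eq hs (mem_range.mp ha) hat

end distr

theorem IsDistr.le {n D : ℕ} {p : ℕ → ℕ → ℤ} {j : ℕ} (h : IsDistr n D p j) {a : ℕ} (ha : a < n) :
    p a j ≤ D := by
  rw [← h.2]
  exact single_le_sum (f := fun a => p a j) (fun b hb => h.1 b (mem_range.mp hb))
    (mem_range.mpr ha)

/-! ### Exchanges between the two leading owners and their effect on bundle values -/

/-- The effect on the shares of moving one unit of item `j` from the second to the top agent. -/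
def swapDir (n : ℕ) (p : ℕ → ℕ → ℤ) (a j : ℕ) : ℤ :=
  (if top n p j = a then 1 else 0) - (if second n p j = a then 1 else 0)

/-- The effects of these moves on the values of the bundles; row `a * d + q` is the value of the
bundle of `a` in coordinate `q`. -/
def swapMat (n d : ℕ) (w : ℕ → ℕ → ℤ) (p : ℕ → ℕ → ℤ) (r j : ℕ) : ℤ :=
  w (r % d) j * swapDir n p (r / d) j

theorem swapDir_eq_zero {n : ℕ} {p : ℕ → ℕ → ℤ} {j : ℕ} (h : second n p j = top n p j) (a : ℕ) :
    swapDir n p a j = 0 := by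
  simp [swapDir, h]

theorem abs_swapDir_le (n : ℕ) (p : ℕ → ℕ → ℤ) (a j : ℕ) : |swapDir n p a j| ≤ 1 := by
  unfold swapDir; split_ifs <;> simp

theorem sum_swapDir {n D : ℕ} {p : ℕ → ℕ → ℤ} {j : ℕ} (hD : 0 < D) (h : IsDistr n D p j) :
    ∑ a ∈ range n, swapDir n p a j = 0 := by
  simp [swapDir, sum_sub_distrib, (h.top_spec hD).1, h.second_lt hD]

theorem swapMat_row {n d : ℕ} {w p : ℕ → ℕ → ℤ} (a j : ℕ) {q : ℕ} (hq : q < d) :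
    swapMat n d w p (a * d + q) j = w q j * swapDir n p a j := by
  have hd : 0 < d := by omega
  have h1 : (a * d + q) % d = q := by rw [Nat.mul_add_mod', Nat.mod_eq_of_lt hq]
  have h2 : (a * d + q) / d = a := by
    rw [mul_comm, Nat.mul_add_div hd, Nat.div_eq_of_lt hq, add_zero]
  rw [swapMat, h1, h2]

/-- The entries of the items that are not yet settled are bounded by `C`. -/
def SmallOn (n m d C : ℕ) (w p : ℕ → ℕ → ℤ) : Prop :=
  ∀ q < d, ∀ j < m, second n p j ≠ top n p j → |w q j| ≤ C

theorem SmallOn.abs_swapMat_le {n m d C : ℕ} {w p : ℕ → ℕ → ℤ} (h : SmallOn n m d C w p)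
    {r j : ℕ} (hr : r < n * d) (hj : j < m) : |swapMat n d w p r j| ≤ C := by
  have hd : 0 < d := Nat.pos_of_ne_zero fun h0 => by simp [h0] at hr
  rw [swapMat, abs_mul]
  by_cases hs : second n p j = top n p j
  · simp [swapDir_eq_zero hs]
  · calc _ ≤ (C : ℤ) * 1 := mul_le_mul (h _ (Nat.mod_lt _ hd) _ hj hs) (abs_swapDir_le _ _ _ _)
          (abs_nonneg _) (by positivity)
      _ = C := mul_one _

theorem SmallOn.sum_sq_le {n m d C : ℕ} {w p : ℕ → ℕ → ℤ} (h : SmallOn n m d C w p) :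
    ∑ j ∈ range m, ∑ r ∈ range (n * d), swapMat n d w p r j ^ 2 ≤
      ((n * d * m * C ^ 2 : ℕ) : ℤ) := by
  calc _ ≤ ∑ j ∈ range m, ∑ r ∈ range (n * d), (C : ℤ) ^ 2 :=
        sum_le_sum fun j hj => sum_le_sum fun r hr =>
          sq_le_sq.mpr ((h.abs_swapMat_le (mem_range.mp hr) (mem_range.mp hj)).trans (le_abs_self _))
    _ = _ := by simp; ring

/-- The items that are not yet settled. -/
def unsettled (n m : ℕ) (p : ℕ → ℕ → ℤ) : Finset ℕ :=
  (range m).filter fun j => second n p j ≠ top n p j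

/-- A dimension count on the rows of the first `n - 1` agents. Settled items have zero columns, so
`u` is sought with support in the unsettled items, which keeps `j₀` unsettled. -/
theorem exists_kernel {n m d D : ℕ} {w p : ℕ → ℕ → ℤ} (hD : 0 < D)
    (hp : ∀ j < m, IsDistr n D p j) (hF : (n - 1) * d < (unsettled n m p).card) :
    ∃ u : ℕ → ℚ, ∃ j₀ < m, (∀ j < m, |u j| ≤ |u j₀|) ∧ u j₀ ≠ 0 ∧
      second n p j₀ ≠ top n p j₀ ∧ ∀ r < n * d, ∑ j ∈ range m, (swapMat n d w p r j : ℚ) * u j = 0 := by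
  set F := unsettled n m p with hFdef
  let T : (F → ℚ) →ₗ[ℚ] (Fin ((n - 1) * d) → ℚ) :=
    (Matrix.of fun (r : Fin ((n - 1) * d)) (j : F) => (swapMat n d w p r j : ℚ)).mulVecLin
  obtain ⟨x, hx, hx0⟩ := (Submodule.ne_bot_iff _).mp
    (LinearMap.ker_ne_bot_of_finrank_lt (f := T) (by simpa using hF))
  have hFm : F ⊆ range m := filter_subset _ _
  let u : ℕ → ℚ := fun j => if h : j ∈ F then x ⟨j, h⟩ else 0
  have hsum : ∀ g : ℕ → ℚ, ∑ j ∈ range m, g j * u j = ∑ j : F, g j * x j := by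
    intro g
    rw [← sum_subset hFm (fun j _ hj => by simp [u, hj]), ← sum_coe_sort]
    exact sum_congr rfl fun j _ => by simp [u]
  have hlow : ∀ r < (n - 1) * d, ∑ j ∈ range m, (swapMat n d w p r j : ℚ) * u j = 0 := by
    intro r hr
    rw [hsum]
    exact congrFun (LinearMap.mem_ker.mp hx) ⟨r, hr⟩
  obtain ⟨i, hi⟩ := Function.ne_iff.mp hx0
  have him : (i : ℕ) ∈ range m := hFm i.2
  obtain ⟨j₀, hj₀, hmax⟩ := exists_max_image (range m) (fun j => |u j|) ⟨_, him⟩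
  have hne : u j₀ ≠ 0 := by
    intro h0
    have := hmax i him
    rw [h0, abs_zero] at this
    exact hi (by simpa [u] using abs_nonpos_iff.mp this)
  refine ⟨u, j₀, mem_range.mp hj₀, fun j hj => hmax j (mem_range.mpr hj), hne, ?_, ?_⟩
  · by_contra hs
    exact hne (dif_neg (by simp [hFdef, unsettled, hs]))
  · intro r hr
    have hd : 0 < d := Nat.pos_of_ne_zero fun h0 => by simp [h0] at hr
    have hn : 0 < n := Nat.pos_of_ne_zero fun h0 => by simp [h0] at hr
    have hq : r % d < d := Nat.mod_lt _ hd
    have ha : r / d < n := Nat.div_lt_of_lt_mul (by rwa [mul_comm])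
    have hr' : r = r / d * d + r % d := (Nat.div_add_mod' r d).symm
    rcases Nat.lt_or_ge (r / d) (n - 1) with h | h
    · refine hlow r ?_
      calc r < (r / d + 1) * d := by rw [add_mul]; omega
        _ ≤ (n - 1) * d := Nat.mul_le_mul_right _ (by omega)
    · have han : r / d = n - 1 := by omega
      -- An exchange preserves the total of an item, so for a fixed coordinate the rows of all
      -- agents add up to zero. Thus the rows of the last agent come for free.
      have hz : ∑ a ∈ range n, ∑ j ∈ range m, (swapMat n d w p (a * d + r % d) j : ℚ) * u j = 0 := by
        rw [sum_comm]
        refine sum_eq_zero fun j hj => ?_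
        rw [← sum_mul]
        have := sum_swapDir hD (hp j (mem_range.mp hj))
        have h2 : ∑ a ∈ range n, (swapMat n d w p (a * d + r % d) j : ℚ) = 0 := by
          simp_rw [swapMat_row _ _ hq]
          rw [← Int.cast_sum, ← mul_sum, this]
          simp
        rw [h2, zero_mul]
      obtain ⟨n', rfl⟩ : ∃ n', n = n' + 1 := ⟨n - 1, by omega⟩
      rw [sum_range_succ, sum_eq_zero, zero_add] at hz
      · rw [hr', han]
        simpa using hz
      · intro a ha
        have ha := mem_range.mp ha
        refine hlow _ ?_
        calc a * d + r % d < (a + 1) * d := by rw [add_mul]; omega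
          _ ≤ (n' + 1 - 1) * d := Nat.mul_le_mul_right _ (by omega)

/-! ### The step along an almost annihilated direction -/

/-- The number of units of the top agent (for a move of negative amount `y`) or the second agent
(for a positive amount) that can be moved. -/
def capacity (n : ℕ) (p : ℕ → ℕ → ℤ) (y : ℕ → ℤ) (j : ℕ) : ℤ :=
  if 0 ≤ y j then p (second n p j) j else p (top n p j) j

/-- The step length of a move in direction `y`. -/
def stepLen (n m : ℕ) (p : ℕ → ℕ → ℤ) (y : ℕ → ℤ) : ℤ × ℤ :=
  ratioMin (capacity n p y) (fun j => |y j|) m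

/-- The shares after moving in direction `y` as far as possible, rounded down. -/
def moved (n m : ℕ) (p : ℕ → ℕ → ℤ) (y : ℕ → ℤ) (a j : ℕ) : ℤ :=
  p a j + (stepLen n m p y).1 * y j / (stepLen n m p y).2 * swapDir n p a j

/-- The number of zero shares. -/
def zeros (n m : ℕ) (p : ℕ → ℕ → ℤ) : ℕ := ((range n ×ˢ range m).filter fun x => p x.1 x.2 = 0).card

theorem zeros_le (n m : ℕ) (p : ℕ → ℕ → ℤ) : zeros n m p ≤ n * m := by
  unfold zeros
  refine (card_filter_le _ _).trans ?_
  simp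

/-- The outcome `p'` of one rounding step from `p`. -/
structure IsStep (n m d D C : ℕ) (w p p' : ℕ → ℕ → ℤ) : Prop where
  distr : ∀ j < m, IsDistr n D p' j
  zero : ∀ a < n, ∀ j < m, p a j = 0 → p' a j = 0
  new : ∃ a < n, ∃ j < m, p a j ≠ 0 ∧ p' a j = 0
  err : ∀ a < n, ∀ q < d, |∑ j ∈ range m, w q j * (p' a j - p a j)| ≤ D + m * C

theorem IsStep.zeros_lt {n m d D C : ℕ} {w p p' : ℕ → ℕ → ℤ} (h : IsStep n m d D C w p p') :
    zeros n m p + 1 ≤ zeros n m p' := by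
  obtain ⟨a, ha, j, hj, h1, h2⟩ := h.new
  refine card_lt_card ⟨?_, fun hsub => h1 ?_⟩
  · rintro ⟨a, j⟩ hx
    simp only [mem_filter, mem_product, mem_range] at hx ⊢
    exact ⟨hx.1, h.zero a hx.1.1 j hx.1.2 hx.2⟩
  · have := @hsub (a, j) (by simp [ha, hj, h2])
    simpa [ha, hj] using this

/-- The smallest ratio of capacity to `|y j|` is the longest admissible step. Rounding it down to
whole units is harmless for nonnegativity because capacities are integers. Zero shares persist
because both parties of an exchange have positive shares. -/
theorem isStep_moved {n m d D C : ℕ} {w p : ℕ → ℕ → ℤ} (hD : 0 < D)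
    (hp : ∀ j < m, IsDistr n D p j) (hC : SmallOn n m d C w p) {y : ℕ → ℤ}
    (hy : ∀ j < m, second n p j = top n p j → y j = 0)
    (hlt : (∑ r ∈ range (n * d), mulY (swapMat n d w p) m y r ^ 2) * m <
      ∑ j ∈ range m, y j ^ 2) : IsStep n m d D C w p (moved n m p y) := by
  have htop := fun j hj => (hp j hj).top_spec hD
  have hsec := fun j hj => (hp j hj).second_pos hD
  have hsecn := fun j hj => (hp j hj).second_lt hD
  have hcap : ∀ j < m, 0 < capacity n p y j := by
    intro j hj
    unfold capacity
    split_ifs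
    · exact hsec j hj
    · exact (htop j hj).2.1
  have hcapD : ∀ j < m, capacity n p y j ≤ D := by
    intro j hj
    unfold capacity
    split_ifs
    · exact (hp j hj).le (hsecn j hj)
    · exact (hp j hj).le (htop j hj).1
  obtain ⟨h1, h2, h3, h4⟩ := ratioMin_spec (c := capacity n p y) (b := fun j => |y j|) (N := m)
    (fun j hj => (hcap j hj).le) (fun j _ => abs_nonneg _) (fun j hj _ => hcap j hj)
  rw [← stepLen] at h1 h2 h3 h4
  -- The default ratio `(1, 0)` would mean `y = 0`, which the strict inequality `hlt` excludes.
  replace h4 : 0 < (stepLen n m p y).2 ∧ ∃ j < m, stepLen n m p y = (capacity n p y j, |y j|) := by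
    rcases h4 with ⟨-, h4⟩ | h4
    · exfalso
      have h0 : ∑ j ∈ range m, y j ^ 2 = 0 := sum_eq_zero fun j hj => by
        rw [abs_eq_zero.mp (h4 j (mem_range.mp hj))]; simp
      have : 0 ≤ (∑ r ∈ range (n * d), mulY (swapMat n d w p) m y r ^ 2) * m :=
        mul_nonneg (sum_nonneg fun _ _ => sq_nonneg _) (by positivity)
      omega
    · exact h4
  obtain ⟨hden, jm, hjm, hjeq⟩ := h4
  unfold moved
  set num := (stepLen n m p y).1 with hnum
  set den := (stepLen n m p y).2 with hdendef
  set δ : ℕ → ℤ := fun j => num * y j / den with hδ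
  have hδle : ∀ j < m, δ j ≤ p (second n p j) j := by
    intro j hj
    have h5 := h3 j hj
    have h6 := hsec j hj
    refine Int.ediv_le_of_le_mul hden ?_
    by_cases hyj : 0 ≤ y j
    · simpa [capacity, hyj, abs_of_nonneg hyj] using h5
    · exact (mul_nonpos_of_nonneg_of_nonpos h1.le (by omega)).trans (by positivity)
  have hδge : ∀ j < m, -p (top n p j) j ≤ δ j := by
    intro j hj
    have h5 := h3 j hj
    have h6 := (htop j hj).2.1
    rw [hδ, Int.le_ediv_iff_mul_le hden]
    by_cases hyj : 0 ≤ y j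
    · have : 0 ≤ num * y j := by positivity
      nlinarith
    · rw [capacity, if_neg hyj, abs_of_neg (by omega)] at h5
      linarith
  have hδ0 : ∀ j < m, second n p j = top n p j → δ j = 0 := by
    intro j hj hs
    simp [hδ, hy j hj hs]
  refine ⟨fun j hj => ⟨fun a ha => ?_, ?_⟩, fun a ha j hj h0 => ?_, ?_, fun a ha q hq => ?_⟩
  · have h5 := hδle j hj
    have h6 := hδge j hj
    have h7 := (hp j hj).1 a ha
    change 0 ≤ p a j + δ j * swapDir n p a j
    unfold swapDir
    split_ifs with ht hs hs
    · simpa using h7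
    · rw [← ht]; simp; omega
    · rw [← hs]; simp; omega
    · simpa using h7
  · rw [sum_add_distrib, (hp j hj).2, ← mul_sum, sum_swapDir hD (hp j hj)]
    simp
  · have h5 : top n p j ≠ a := fun h => by have := (htop j hj).2.1; rw [h, h0] at this; omega
    have h6 : second n p j ≠ a := fun h => by have := hsec j hj; rw [h, h0] at this; omega
    simp [swapDir, h5, h6, h0]
  -- At the minimiser `den = |y jm|`, so the division is exact there and one of the two shares
  -- becomes exactly zero.
  · have hnumv : num = capacity n p y jm := by rw [hnum, hjeq]
    have hdenv : den = |y jm| := by rw [hdendef, hjeq]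
    have hyne : y jm ≠ 0 := abs_pos.mp (hdenv ▸ hden)
    have hst : second n p jm ≠ top n p jm := fun h => hyne (hy jm hjm h)
    by_cases hyj : 0 ≤ y jm
    · refine ⟨second n p jm, hsecn jm hjm, jm, hjm, (hsec jm hjm).ne', ?_⟩
      have hq : num * y jm / den = p (second n p jm) jm := by
        rw [hdenv, abs_of_nonneg hyj, Int.mul_ediv_cancel _ hyne, hnumv, capacity, if_pos hyj]
      rw [hq]
      simp [swapDir, hst.symm]
    · refine ⟨top n p jm, (htop jm hjm).1, jm, hjm, (htop jm hjm).2.1.ne', ?_⟩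
      have hq : num * y jm / den = -p (top n p jm) jm := by
        rw [hdenv, abs_of_neg (by omega), Int.ediv_neg, Int.mul_ediv_cancel _ hyne, hnumv,
          capacity, if_neg hyj]
      rw [hq]
      simp [swapDir, hst]
  · set r := a * d + q with hr
    have hrn : r < n * d := by
      calc r < (a + 1) * d := by rw [add_mul]; omega
        _ ≤ n * d := Nat.mul_le_mul_right _ ha
    set X := swapMat n d w p
    set z := mulY X m y with hz
    have e1 : ∑ j ∈ range m, w q j * (p a j + num * y j / den * swapDir n p a j - p a j) =
        ∑ j ∈ range m, X r j * δ j := by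
      refine sum_congr rfl fun j _ => ?_
      simp only [X, hr, swapMat_row a j hq, hδ]
      ring
    rw [e1]
    -- The change of the bundle value splits into the defect `X y` of the direction and the
    -- remainders of the divisions, each remainder below `den`.
    have e2 : den * ∑ j ∈ range m, X r j * δ j =
        num * z r - ∑ j ∈ range m, X r j * (num * y j % den) := by
      rw [hz, mulY, mul_sum, mul_sum, ← sum_sub_distrib]
      refine sum_congr rfl fun j _ => ?_
      have := Int.mul_ediv_add_emod (num * y j) den
      simp only [hδ]
      linear_combination (X r j) * this
    have e3 : |∑ j ∈ range m, X r j * (num * y j % den)| ≤ m * C * den := by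
      calc _ ≤ ∑ j ∈ range m, |X r j * (num * y j % den)| := abs_sum_le_sum_abs _ _
        _ ≤ ∑ j ∈ range m, (C : ℤ) * den := sum_le_sum fun j hj => by
            rw [abs_mul]
            refine mul_le_mul (hC.abs_swapMat_le hrn (mem_range.mp hj)) ?_ (abs_nonneg _)
              (by positivity)
            rw [abs_of_nonneg (Int.emod_nonneg _ hden.ne')]
            exact (Int.emod_lt_of_pos _ hden).le
        _ = _ := by simp; ring
    -- Each `num * |y j|` is at most `D * den`, so `num² ‖y‖² ≤ m (D den)²`; the factor `m` in `hlt`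
    -- cancels the `m` here.
    have e4 : |num * z r| ≤ D * den := by
      have hm : (0 : ℤ) < m := by have : 0 < m := by omega
                                  exact_mod_cast this
      refine abs_le_of_sq_le_sq ?_ (by positivity)
      refine le_of_mul_le_mul_right ?_ hm
      have f1 : z r ^ 2 ≤ ∑ r ∈ range (n * d), z r ^ 2 :=
        single_le_sum (f := fun r => z r ^ 2) (fun _ _ => sq_nonneg _) (mem_range.mpr hrn)
      have f2 : num ^ 2 * ∑ j ∈ range m, y j ^ 2 ≤ m * (D * den) ^ 2 := by
        rw [mul_sum]
        calc _ ≤ ∑ j ∈ range m, ((D : ℤ) * den) ^ 2 := sum_le_sum fun j hj => by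
              have hj := mem_range.mp hj
              rw [← sq_abs (y j), ← mul_pow]
              have g1 := h3 j hj
              have g2 : capacity n p y j * den ≤ D * den :=
                mul_le_mul_of_nonneg_right (hcapD j hj) hden.le
              exact pow_le_pow_left₀ (by positivity) (g1.trans g2) 2
          _ = _ := by simp
      calc (num * z r) ^ 2 * m = num ^ 2 * (z r ^ 2 * m) := by ring
        _ ≤ num ^ 2 * ∑ j ∈ range m, y j ^ 2 := by
          refine mul_le_mul_of_nonneg_left ?_ (sq_nonneg _)
          exact (mul_le_mul_of_nonneg_right f1 hm.le).trans hlt.le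
        _ ≤ _ := by linarith
    refine le_of_mul_le_mul_left ?_ hden
    rw [← abs_of_pos hden, ← abs_mul, abs_of_pos hden, e2]
    calc _ ≤ |num * z r| + |∑ j ∈ range m, X r j * (num * y j % den)| := abs_sub _ _
      _ ≤ D * den + m * C * den := add_le_add e4 e3
      _ = _ := by ring

/-! ### Picking sequences -/

/-- The state of the picking sequence after `c` turns: `τ j` is the turn in which item `j` was
picked, counted from `1`, or `0` if it is still there. In turn `t + 1`, an item of largest value in
coordinate `t / N` is picked, if there is one, and `h q` is the value of the last pick for `q`. -/
structure IsPick (m N c : ℕ) (v : ℕ → ℕ → ℕ) (τ h : ℕ → ℕ) : Prop where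
  le : ∀ j < m, τ j ≤ c
  inj : ∀ j < m, ∀ j' < m, τ j = τ j' → τ j ≠ 0 → j = j'
  surj : (∃ j < m, τ j = 0) → ∀ t < c, ∃ j < m, τ j = t + 1
  high : ∀ j < m, τ j ≠ 0 → h ((τ j - 1) / N) ≤ v ((τ j - 1) / N) j
  low : ∀ j < m, τ j = 0 → ∀ q, q * N < c → v q j ≤ h q

/-- The attractiveness of item `j` in turn `c + 1`. -/
def pickScore (N c : ℕ) (v : ℕ → ℕ → ℕ) (τ : ℕ → ℕ) (j : ℕ) : ℤ :=
  (if (τ j : ℤ) = 0 then 1 else 0) * ((v (c / N) j : ℤ) + 1)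

theorem isPick_zero (m N : ℕ) (v : ℕ → ℕ → ℕ) : IsPick m N 0 v (fun _ => 0) (fun _ => 0) :=
  ⟨by simp, by simp, by simp, by simp, by simp⟩

/-- A remaining item scores at least `1`, even if worthless. So maximum `0` means that nothing is
left, and the clauses on remaining items are vacuous. -/
theorem IsPick.skip {m N c : ℕ} {v : ℕ → ℕ → ℕ} {τ h : ℕ → ℕ} (H : IsPick m N c v τ h)
    (h0 : (argmax (pickScore N c v τ) 0 m).2 = 0) : IsPick m N (c + 1) v τ h := by
  have hno : ∀ j < m, τ j ≠ 0 := by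
    intro j hj hτ
    have := le_argmax (pickScore N c v τ) 0 hj
    simp only [h0, pickScore, hτ, Nat.cast_zero, if_true, one_mul] at this
    omega
  exact ⟨fun j hj => (H.le j hj).trans (by omega), H.inj,
    fun ⟨j, hj, hτ⟩ => (hno j hj hτ).elim, H.high, fun j hj hτ => (hno j hj hτ).elim⟩

theorem IsPick.pick {m N c : ℕ} {v : ℕ → ℕ → ℕ} {τ h : ℕ → ℕ} (hN : 0 < N)
    (H : IsPick m N c v τ h) (h0 : (argmax (pickScore N c v τ) 0 m).2 ≠ 0) :
    ∃ b < m, (argmax (pickScore N c v τ) 0 m).1 = b ∧ τ b = 0 ∧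
      (argmax (pickScore N c v τ) 0 m).2 - 1 = v (c / N) b ∧
      IsPick m N (c + 1) v (Function.update τ b (c + 1))
        (Function.update h (c / N) (v (c / N) b)) := by
  rcases argmax_cases (pickScore N c v τ) 0 m with ⟨h1, -⟩ | ⟨h1, h2, h3⟩
  · exact (h0 (by rw [h1])).elim
  have hle := fun j (hj : j < m) => le_argmax (pickScore N c v τ) 0 hj
  set b := (argmax (pickScore N c v τ) 0 m).1
  rw [← h3] at h2 hle
  rw [← h3]
  have hb : τ b = 0 := by
    by_contra hcon
    simp [pickScore, hcon] at h2
  have hbs : pickScore N c v τ b = v (c / N) b + 1 := by simp [pickScore, hb]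
  have hmax : ∀ j < m, τ j = 0 → v (c / N) j ≤ v (c / N) b := by
    intro j hj hτ
    have := hle j hj
    rw [hbs] at this
    simp only [pickScore, hτ, Nat.cast_zero, if_true, one_mul] at this
    omega
  refine ⟨b, h1, rfl, hb, by rw [hbs]; ring, ?_⟩
  have hupd : ∀ j, j ≠ b → Function.update τ b (c + 1) j = τ j := fun j hj =>
    Function.update_of_ne hj _ _
  have hdiv : c / N * N ≤ c := Nat.div_mul_le_self _ _
  refine ⟨fun j hj => ?_, fun j hj j' hj' he hne => ?_, fun ⟨j, hj, hτ⟩ t ht => ?_,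
    fun j hj hτ => ?_, fun j hj hτ q hq => ?_⟩
  · by_cases hjb : j = b
    · subst hjb; simp
    · rw [hupd j hjb]; exact (H.le j hj).trans (by omega)
  · by_cases hjb : j = b
    · by_cases hjb' : j' = b
      · rw [hjb, hjb']
      · rw [hjb, hupd j' hjb', Function.update_self] at he
        have := H.le j' hj'
        omega
    · rw [hupd j hjb] at he hne
      by_cases hjb' : j' = b
      · rw [hjb', Function.update_self] at he
        have := H.le j hj
        omega
      · rw [hupd j' hjb'] at he
        exact H.inj j hj j' hj' he hne
  · rcases Nat.lt_succ_iff_lt_or_eq.mp ht with ht | rfl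
    · obtain ⟨i, hi, hti⟩ := H.surj ⟨b, h1, hb⟩ t ht
      exact ⟨i, hi, by rw [hupd i (by rintro rfl; omega), hti]⟩
    · exact ⟨b, h1, by simp⟩
  · by_cases hjb : j = b
    · subst hjb; simp
    · rw [hupd j hjb] at hτ ⊢
      have h4 := H.high j hj hτ
      -- If `j` was picked earlier for the same coordinate, `b` was still available after that turn;
      -- so the new threshold is at most the old one, which `j` meets.
      by_cases hq : (τ j - 1) / N = c / N
      · rw [hq, Function.update_self]
        rw [hq] at h4
        refine (H.low b h1 hb (c / N) ?_).trans h4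
        have h5 : (τ j - 1) / N * N ≤ τ j - 1 := Nat.div_mul_le_self _ _
        have := H.le j hj
        rw [hq] at h5
        omega
      · rwa [Function.update_of_ne hq]
  · have hjb : j ≠ b := by rintro rfl; simp at hτ
    rw [hupd j hjb] at hτ
    by_cases hqc : q = c / N
    · subst hqc; simpa using hmax j hj hτ
    · rw [Function.update_of_ne hqc]
      refine H.low j hj hτ q ?_
      -- The only coordinate that gets its first turn now is `c / N`, and that case is settled.
      rcases Nat.lt_or_ge (q * N) c with h5 | h5
      · exact h5
      · exfalso
        apply hqc
        have : c = q * N := by omega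
        rw [this, Nat.mul_div_cancel _ hN]

/-! ### The rounded allocation -/

/-- The number of units into which an item is divided, per agent. -/
def unit (m : ℕ) : ℕ := 8 * m * m

/-- The scale of the rounded values. -/
def scale (n m : ℕ) : ℕ := 4 * n * m

/-- The shares after the picking sequence: equal shares of the items that are still there. -/
def initShare (n m l : ℕ) (τ : ℕ → ℕ) (a j : ℕ) : ℤ :=
  if τ j = 0 then unit m else if (τ j - 1) / (n * n * l * l) = a then (n * unit m : ℕ) else 0

/-- The scaled and rounded values. -/
def scaled (n m : ℕ) (v : ℕ → ℕ → ℕ) (h : ℕ → ℕ) (q j : ℕ) : ℤ := (v q j * scale n m / h q : ℕ)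

/-- The invariant of the rounding procedure. -/
structure IsNear (n m d D C : ℕ) (w p₀ p : ℕ → ℕ → ℤ) : Prop where
  distr : ∀ j < m, IsDistr n D p j
  zero : ∀ a < n, ∀ j < m, p₀ a j = 0 → p a j = 0
  err : ∀ a < n, ∀ q < d, |∑ j ∈ range m, w q j * (p a j - p₀ a j)| ≤ zeros n m p * (D + m * C)

/-- The error of a step is charged to the zero share that it creates, so no bound on the number of
steps is needed. -/
theorem IsNear.step {n m d D C : ℕ} {w p₀ p p' : ℕ → ℕ → ℤ} (h : IsNear n m d D C w p₀ p)
    (h' : IsStep n m d D C w p p') : IsNear n m d D C w p₀ p' := by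
  refine ⟨h'.distr, fun a ha j hj h0 => h'.zero a ha j hj (h.zero a ha j hj h0),
    fun a ha q hq => ?_⟩
  have h1 := h.err a ha q hq
  have h2 := h'.err a ha q hq
  have h3 : ((zeros n m p + 1 : ℕ) : ℤ) ≤ (zeros n m p' : ℕ) := by exact_mod_cast h'.zeros_lt
  have h4 : ∑ j ∈ range m, w q j * (p' a j - p₀ a j) = ∑ j ∈ range m, w q j * (p a j - p₀ a j) +
      ∑ j ∈ range m, w q j * (p' a j - p a j) := by
    rw [← sum_add_distrib]
    exact sum_congr rfl fun j _ => by ring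
  rw [h4]
  calc _ ≤ _ := abs_add_le _ _
    _ ≤ (zeros n m p : ℤ) * (D + m * C) + (D + m * C) := add_le_add h1 h2
    _ = ((zeros n m p + 1 : ℕ) : ℤ) * (D + m * C) := by push_cast; ring
    _ ≤ _ := mul_le_mul_of_nonneg_right h3 (by positivity)

theorem unsettled_subset_of_step {n m d D C : ℕ} {w p p' : ℕ → ℕ → ℤ} (hD : 0 < D)
    (hp : ∀ j < m, IsDistr n D p j) (h' : IsStep n m d D C w p p') :
    unsettled n m p' ⊆ unsettled n m p := by
  intro j hj
  simp only [unsettled, mem_filter, mem_range] at hj ⊢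
  refine ⟨hj.1, fun hs => hj.2 ?_⟩
  have hd := h'.distr j hj.1
  have key : ∀ a < n, 0 < p' a j → a = top n p j := by
    intro a ha hpos
    by_contra hne
    have := h'.zero a ha j hj.1 ((hp j hj.1).eq_zero_of_second_eq hs ha hne)
    omega
  rw [key _ (hd.second_lt hD) (hd.second_pos hD), key _ (hd.top_spec hD).1 (hd.top_spec hD).2.1]

section final
variable {n m l : ℕ} {v : ℕ → ℕ → ℕ} {τ h : ℕ → ℕ} {p : ℕ → ℕ → ℤ}

theorem owner_lt (H : IsPick m (n * n * l) (n * l * (n * n * l)) v τ h) {j : ℕ} (hj : j < m)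
    (hτ : τ j ≠ 0) : (τ j - 1) / (n * n * l * l) < n := by
  refine Nat.div_lt_of_lt_mul ?_
  have := H.le j hj
  have e : n * n * l * l * n = n * l * (n * n * l) := by ring
  omega

theorem initShare_distr (H : IsPick m (n * n * l) (n * l * (n * n * l)) v τ h) {j : ℕ}
    (hj : j < m) : IsDistr n (n * unit m) (initShare n m l τ) j := by
  refine ⟨fun a _ => by unfold initShare; split_ifs <;> positivity, ?_⟩
  unfold initShare
  by_cases hτ : τ j = 0
  · simp [hτ]
  · simp only [hτ, if_false]
    rw [sum_ite_eq, if_pos (mem_range.mpr (owner_lt H hj hτ))]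

theorem isNear_initShare (d C : ℕ) (w : ℕ → ℕ → ℤ)
    (H : IsPick m (n * n * l) (n * l * (n * n * l)) v τ h) :
    IsNear n m d (n * unit m) C w (initShare n m l τ) (initShare n m l τ) :=
  ⟨fun _ hj => initShare_distr H hj, fun _ _ _ _ h0 => h0, fun a _ q _ => by simp; positivity⟩

/-- Zero shares persist, so the agent who picked `j` remains its only owner. -/
theorem picked_settled {d D C : ℕ} {w : ℕ → ℕ → ℤ} (hD : 0 < D)
    (hn : IsNear n m d D C w (initShare n m l τ) p) {j : ℕ} (hj : j < m) (hτ : τ j ≠ 0) :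
    top n p j = (τ j - 1) / (n * n * l * l) ∧ second n p j = top n p j := by
  have hd := hn.distr j hj
  have key : ∀ a < n, 0 < p a j → a = (τ j - 1) / (n * n * l * l) := by
    intro a ha hpos
    by_contra hne
    have := hn.zero a ha j hj (by simp [initShare, hτ, Ne.symm hne])
    omega
  have h1 := key _ (hd.top_spec hD).1 (hd.top_spec hD).2.1
  exact ⟨h1, by rw [key _ (hd.second_lt hD) (hd.second_pos hD), h1]⟩

/-- Only leftovers can be unsettled, and their values are at most `h q`. Picked items may have huge
scaled values, but they never enter the matrix. -/
theorem smallOn_scaled {C : ℕ} {w : ℕ → ℕ → ℤ} {D : ℕ} (hD : 0 < D) (hN : 0 < n * n * l)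
    (H : IsPick m (n * n * l) (n * l * (n * n * l)) v τ h)
    (hn : IsNear n m (n * l) D C w (initShare n m l τ) p) :
    SmallOn n m (n * l) (scale n m) (scaled n m v h) p := by
  intro q hq j hj hs
  have hτ : τ j = 0 := by
    by_contra hτ
    exact hs (picked_settled hD hn hj hτ).2
  have hv := H.low j hj hτ q (Nat.mul_lt_mul_of_pos_right hq hN)
  rw [scaled, abs_of_nonneg (by positivity)]
  have : v q j * scale n m / h q ≤ scale n m := by
    refine Nat.div_le_of_le_mul ?_
    exact Nat.mul_le_mul_right _ hv
  exact_mod_cast this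

theorem card_picked_le (hn0 : 0 < n) (hl : 0 < l)
    (H : IsPick m (n * n * l) (n * l * (n * n * l)) v τ h) (a : ℕ) :
    ((range m).filter fun j => τ j ≠ 0 ∧ (τ j - 1) / (n * n * l * l) = a).card ≤
      n * n * l * l := by
  have hK : 0 < n * n * l * l := by positivity
  generalize n * n * l * l = K at *
  calc _ ≤ (Ico (a * K) (a * K + K)).card := by
        refine card_le_card_of_injOn (fun j => τ j - 1) ?_ ?_
        · intro j hj
          simp only [coe_filter, mem_range, Set.mem_ofPred_eq] at hj
          obtain ⟨-, -, h2⟩ := hj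
          have := Nat.div_add_mod (τ j - 1) K
          have hlt := Nat.mod_lt (τ j - 1) hK
          rw [h2, mul_comm] at this
          simp only [coe_Ico, Set.mem_Ico]
          omega
        · intro j hj j' hj' he
          simp only [coe_filter, mem_range, Set.mem_ofPred_eq] at hj hj'
          exact H.inj j hj.1 j' hj'.1 (by dsimp only at he; omega) hj.2.1
    _ = K := by simp

/-- As long as an item is left over, no turn was skipped, so all turns of coordinate `q` produced
picks. -/
theorem le_card_picks (H : IsPick m (n * n * l) (n * l * (n * n * l)) v τ h)
    (hex : ∃ j < m, τ j = 0) {q : ℕ} (hq : q < n * l) :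
    n * n * l ≤ ((range m).filter fun j => τ j ≠ 0 ∧ (τ j - 1) / (n * n * l) = q).card := by
  generalize n * n * l = N at *
  choose! g hgm hgτ using H.surj hex
  have hlt : ∀ t < N, q * N + t < n * l * N := by
    intro t ht
    calc q * N + t < (q + 1) * N := by rw [add_mul]; omega
      _ ≤ _ := Nat.mul_le_mul_right _ hq
  calc N = (range N).card := by simp
    _ ≤ _ := by
      refine card_le_card_of_injOn (fun t => g (q * N + t)) ?_ ?_
      · intro t ht
        have ht : t < N := by simpa using ht
        simp only [coe_filter, mem_range, Set.mem_ofPred_eq]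
        refine ⟨hgm _ (hlt t ht), by rw [hgτ _ (hlt t ht)]; omega, ?_⟩
        rw [hgτ _ (hlt t ht), Nat.add_sub_cancel, mul_comm, Nat.mul_add_div (by omega),
          Nat.div_eq_of_lt ht, add_zero]
      · intro t ht t' ht' he
        have ht : t < N := by simpa using ht
        have ht' : t' < N := by simpa using ht'
        have := congrArg τ he
        dsimp only at this
        rw [hgτ _ (hlt t ht), hgτ _ (hlt t' ht')] at this
        omega

/-- Among the items that were not picked, the bundles differ by less than `n² l` times the largest
value. -/
theorem sum_scaled_le (hn0 : 0 < n) (hl : 0 < l) (hm : 0 < m)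
    (H : IsPick m (n * n * l) (n * l * (n * n * l)) v τ h)
    (hn : IsNear n m (n * l) (n * unit m) (scale n m) (scaled n m v h) (initShare n m l τ) p)
    (hF : (unsettled n m p).card ≤ (n - 1) * (n * l)) {i i' q : ℕ} (hi : i < n) (hi' : i' < n)
    (hii : i ≠ i') (hq : q < n * l) :
    ∑ j ∈ (range m).filter (fun j => τ j = 0 ∧ top n p j = i'), scaled n m v h q j + m ≤
      (n * n * l : ℕ) * scale n m +
        ∑ j ∈ (range m).filter (fun j => τ j = 0 ∧ top n p j = i), scaled n m v h q j := by
  set w := scaled n m v h with hw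
  set p₀ := initShare n m l τ with hp₀
  set D := n * unit m with hDdef
  set Q := scale n m with hQ
  have hD : 0 < D := by simp only [hDdef, unit]; positivity
  have hw0 : ∀ j, 0 ≤ w q j := fun j => by simp only [hw, scaled]; positivity
  have hwQ : ∀ j < m, τ j = 0 → w q j ≤ Q := by
    intro j hj hτ
    have hv := H.low j hj hτ q (Nat.mul_lt_mul_of_pos_right hq (by positivity))
    have : v q j * Q / h q ≤ Q := Nat.div_le_of_le_mul (Nat.mul_le_mul_right _ hv)
    simp only [hw, scaled]
    exact_mod_cast this
  set R := (range m).filter fun j => τ j = 0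
  -- the bundles as sums of indicators
  have hind : ∀ a, ∑ j ∈ (range m).filter (fun j => τ j = 0 ∧ top n p j = a), w q j =
      ∑ j ∈ R, w q j * (if top n p j = a then 1 else 0) := by
    intro a
    simp only [R, mul_ite, mul_one, mul_zero]
    rw [← sum_filter, filter_filter]
  rw [hind, hind]
  -- rounding
  have hround : ∀ j ∈ R, (D : ℤ) * (w q j * (if top n p j = i' then 1 else 0) -
      w q j * (if top n p j = i then 1 else 0)) ≤ w q j * (p i' j - p i j) +
        if second n p j ≠ top n p j then (D : ℤ) * Q else 0 := by
    intro j hj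
    obtain ⟨hjm, hτ⟩ := mem_filter.mp hj
    have hjm := mem_range.mp hjm
    have hdj := hn.distr j hjm
    obtain ⟨t1, t2, t3⟩ := hdj.top_spec hD
    have g1 := hdj.1 i hi
    have g2 := hdj.1 i' hi'
    have g3 := hdj.le hi
    -- A settled item is not changed by rounding. For an unsettled one the loss is one item and not
    -- two: if `i'` receives it, the share of `i'` was at least that of `i`.
    have hb : (D : ℤ) * ((if top n p j = i' then 1 else 0) - (if top n p j = i then 1 else 0)) ≤
        p i' j - p i j + if second n p j ≠ top n p j then (D : ℤ) else 0 := by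
      by_cases hs : second n p j = top n p j
      · have z1 := fun a ha hne => hdj.eq_zero_of_second_eq hs (a := a) ha hne
        have z2 := hdj.top_eq_of_second_eq hD hs
        by_cases e1 : top n p j = i'
        · have e2 : top n p j ≠ i := fun e => hii (e.symm.trans e1)
          rw [e1] at z2
          simp [hs, e1, hii.symm, z1 i hi (Ne.symm e2), z2]
        · by_cases e2 : top n p j = i
          · rw [e2] at z2
            simp [hs, e2, hii, z1 i' hi' (Ne.symm e1), z2]
          · simp [hs, e1, e2, z1 i' hi' (Ne.symm e1), z1 i hi (Ne.symm e2)]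
      · have t4 := t3 i hi
        rw [if_pos hs]
        split_ifs with e1 e2
        · omega
        · rw [e1] at t4; linarith
        · linarith
        · linarith
    calc _ = w q j * ((D : ℤ) * ((if top n p j = i' then 1 else 0) -
          (if top n p j = i then 1 else 0))) := by ring
      _ ≤ w q j * (p i' j - p i j + if second n p j ≠ top n p j then (D : ℤ) else 0) :=
        mul_le_mul_of_nonneg_left hb (hw0 j)
      _ ≤ _ := by
        rw [mul_add]
        gcongr
        split_ifs
        · rw [mul_comm (D : ℤ)]
          exact mul_le_mul_of_nonneg_right (hwQ j hjm hτ) (by positivity)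
        · simp
  have hsum := sum_le_sum hround
  rw [← mul_sum, sum_sub_distrib, sum_add_distrib] at hsum
  have hcard : ∑ j ∈ R, (if second n p j ≠ top n p j then (D : ℤ) * Q else 0) ≤
      ((n - 1) * (n * l) : ℕ) * ((D : ℤ) * Q) := by
    rw [← sum_filter, sum_const, nsmul_eq_mul]
    refine mul_le_mul_of_nonneg_right ?_ (by positivity)
    have : (R.filter fun j => second n p j ≠ top n p j) ⊆ unsettled n m p := by
      intro j hj
      simp only [R, unsettled, mem_filter] at hj ⊢
      exact ⟨hj.1.1, hj.2⟩
    exact_mod_cast (card_le_card this).trans hF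
  -- the shares
  have hshare : ∑ j ∈ R, w q j * (p i' j - p i j) =
      ∑ j ∈ range m, w q j * (p i' j - p₀ i' j) - ∑ j ∈ range m, w q j * (p i j - p₀ i j) := by
    rw [← sum_sub_distrib]
    simp only [R, sum_filter]
    refine sum_congr rfl fun j hj => ?_
    have hjm := mem_range.mp hj
    -- A leftover starts with equal shares, so `p₀` cancels in the difference. A picked item has
    -- kept its initial shares and contributes nothing.
    by_cases hτ : τ j = 0
    · simp only [hτ, if_true, hp₀, initShare]; ring
    · obtain ⟨k1, k2⟩ := picked_settled hD hn hjm hτ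
      have hdj := hn.distr j hjm
      have key : ∀ a < n, p a j = p₀ a j := by
        intro a ha
        by_cases hat : a = top n p j
        · rw [hat, hdj.top_eq_of_second_eq hD k2]
          simp [hp₀, initShare, hτ, k1, hDdef]
        · rw [hdj.eq_zero_of_second_eq k2 ha hat]
          rw [k1] at hat
          simp [hp₀, initShare, hτ, Ne.symm hat]
      rw [key i hi, key i' hi']
      simp [hτ]
  have hz : (zeros n m p : ℤ) * (D + m * Q) ≤ (n * m : ℕ) * ((D : ℤ) + m * Q) :=
    mul_le_mul_of_nonneg_right (by exact_mod_cast zeros_le n m p) (by positivity)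
  have a1 := (abs_le.mp (hn.err i hi q hq)).1
  have a2 := (abs_le.mp (hn.err i' hi' q hq)).2
  set S' := ∑ j ∈ R, w q j * (if top n p j = i' then 1 else 0)
  set S := ∑ j ∈ R, w q j * (if top n p j = i then 1 else 0)
  have hfin : (D : ℤ) * (S' - S) ≤ 2 * ((n * m : ℕ) * ((D : ℤ) + m * Q)) +
      ((n - 1) * (n * l) : ℕ) * ((D : ℤ) * Q) := by
    rw [hshare] at hsum
    linarith
  have hDpos : (0 : ℤ) < D := by exact_mod_cast hD
  -- The `1` that is gained here is worth `D * Q` and has to absorb all approximation errors.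
  have hd1 : (((n - 1) * (n * l) : ℕ) : ℤ) ≤ (n * n * l : ℕ) - 1 := by
    have : (n - 1) * (n * l) + 1 ≤ n * n * l := by
      obtain ⟨n', rfl⟩ : ∃ n', n = n' + 1 := ⟨n - 1, by omega⟩
      have : 0 < (n' + 1) * l := by positivity
      calc _ ≤ n' * ((n' + 1) * l) + (n' + 1) * l := Nat.add_le_add (by simp) this
        _ = _ := by ring
    omega
  have hfin2 := mul_le_mul_of_nonneg_right hd1 (by positivity : (0 : ℤ) ≤ (D : ℤ) * Q)
  refine le_of_mul_le_mul_left ?_ hDpos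
  have hDv : (D : ℤ) = n * (8 * m * m) := by simp [hDdef, unit]
  have hQv : (Q : ℤ) = 4 * n * m := by simp [hQ, scale]
  have hmn : (m : ℤ) ≤ n * m := by
    have : m ≤ n * m := Nat.le_mul_of_pos_left _ hn0
    exact_mod_cast this
  have hDm : (D : ℤ) * m ≤ D * (n * m) := mul_le_mul_of_nonneg_left hmn hDpos.le
  -- The constants of `unit` and `scale` are chosen for this balance. The slack is `D Q = 4 D n m`;
  -- the steps use `2 n m (D + m Q) = 3 D n m`, and rounding the values uses `D m ≤ D n m`.
  have h2 : 2 * (n * m : ℤ) * (m * Q) = D * (n * m) := by rw [hDv, hQv]; ring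
  have h3 : (D : ℤ) * Q = 4 * (D * (n * m)) := by rw [hQv]; ring
  push_cast at hfin hfin2 ⊢
  nlinarith

/-- The picks of `i` for coordinate `q` are worth `n² l * h q` and outweigh the imbalance of the
leftovers. Undoing the scaling loses less than `h q` per item, which the summand `m` in
`sum_scaled_le` provides. -/
theorem sum_unpicked_le (hn0 : 0 < n) (hl : 0 < l) (hm : 0 < m)
    (H : IsPick m (n * n * l) (n * l * (n * n * l)) v τ h)
    (hn : IsNear n m (n * l) (n * unit m) (scale n m) (scaled n m v h) (initShare n m l τ) p)
    (hF : (unsettled n m p).card ≤ (n - 1) * (n * l)) {i i' k : ℕ} (hi : i < n) (hi' : i' < n)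
    (hii : i ≠ i') (hk : k < l) :
    ∑ j ∈ (range m).filter (fun j => τ j = 0 ∧ top n p j = i'), v (i * l + k) j ≤
      ∑ j ∈ (range m).filter (fun j => top n p j = i), v (i * l + k) j := by
  have hD : 0 < n * unit m := by simp only [unit]; positivity
  set q := i * l + k with hqdef
  have hq : q < n * l := by
    calc q < (i + 1) * l := by rw [add_mul]; omega
      _ ≤ _ := Nat.mul_le_mul_right _ hi
  by_cases hex : ∃ j < m, τ j = 0
  swap
  · rw [sum_eq_zero]
    · exact Nat.zero_le _
    · intro j hj
      simp only [mem_filter, mem_range] at hj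
      exact (hex ⟨j, hj.1, hj.2.1⟩).elim
  have hsplit : ∑ j ∈ (range m).filter (fun j => top n p j = i), v q j =
      ∑ j ∈ (range m).filter (fun j => τ j = 0 ∧ top n p j = i), v q j +
      ∑ j ∈ (range m).filter (fun j => τ j ≠ 0 ∧ top n p j = i), v q j := by
    rw [← sum_filter_add_sum_filter_not _ (fun j => τ j = 0), filter_filter, filter_filter]
    simp only [and_comm, ne_eq]
  have hpick : n * n * l * h q ≤
      ∑ j ∈ (range m).filter (fun j => τ j ≠ 0 ∧ top n p j = i), v q j := by
    set S := (range m).filter fun j => τ j ≠ 0 ∧ (τ j - 1) / (n * n * l) = q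
    calc n * n * l * h q ≤ S.card * h q := Nat.mul_le_mul_right _ (le_card_picks H hex hq)
      _ = ∑ j ∈ S, h q := by simp
      _ ≤ ∑ j ∈ S, v q j := by
        refine sum_le_sum fun j hj => ?_
        simp only [S, mem_filter, mem_range] at hj
        obtain ⟨h1, h2, h3⟩ := hj
        have := H.high j h1 h2
        rwa [h3] at this
      _ ≤ _ := by
        refine sum_le_sum_of_subset fun j hj => ?_
        simp only [S, mem_filter, mem_range] at hj ⊢
        obtain ⟨h1, h2, h3⟩ := hj
        refine ⟨h1, h2, ?_⟩
        rw [(picked_settled hD hn h1 h2).1, ← Nat.div_div_eq_div_mul, h3, hqdef, mul_comm i,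
          Nat.mul_add_div hl, Nat.div_eq_of_lt hk, add_zero]
  rw [hsplit]
  set R' := (range m).filter fun j => τ j = 0 ∧ top n p j = i'
  set R := (range m).filter fun j => τ j = 0 ∧ top n p j = i
  suffices ∑ j ∈ R', v q j ≤ ∑ j ∈ R, v q j + n * n * l * h q by omega
  have hlow : ∀ j < m, τ j = 0 → v q j ≤ h q := fun j hj hτ =>
    H.low j hj hτ q (Nat.mul_lt_mul_of_pos_right hq (by positivity))
  -- For `h q = 0` the scaled values carry no information, but then all leftovers are worthless in
  -- `q`.
  rcases Nat.eq_zero_or_pos (h q) with h0 | hpos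
  · rw [sum_eq_zero]
    · exact Nat.zero_le _
    · intro j hj
      simp only [R', mem_filter, mem_range] at hj
      have := hlow j hj.1 hj.2.1
      omega
  have hmain := sum_scaled_le hn0 hl hm H hn hF hi hi' hii hq
  simp only [scaled] at hmain
  set Q := scale n m with hQ
  have hQpos : 0 < Q := by simp only [hQ, scale]; positivity
  have hmain' : ∑ j ∈ R', v q j * Q / h q + m ≤ n * n * l * Q + ∑ j ∈ R, v q j * Q / h q := by
    exact_mod_cast hmain
  refine Nat.le_of_mul_le_mul_right ?_ hQpos
  have b1 : (∑ j ∈ R', v q j) * Q ≤ h q * (∑ j ∈ R', v q j * Q / h q + m) := by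
    calc (∑ j ∈ R', v q j) * Q = ∑ j ∈ R', v q j * Q := sum_mul _ _ _
      _ ≤ ∑ j ∈ R', h q * (v q j * Q / h q + 1) := sum_le_sum fun j _ => by
          have := Nat.div_add_mod (v q j * Q) (h q)
          have := Nat.mod_lt (v q j * Q) hpos
          rw [mul_add]; omega
      _ = h q * (∑ j ∈ R', v q j * Q / h q + R'.card) := by
          rw [← mul_sum, sum_add_distrib]; simp
      _ ≤ _ := by
          gcongr
          exact (card_filter_le _ _).trans (by simp)
  have b2 : h q * ∑ j ∈ R, v q j * Q / h q ≤ (∑ j ∈ R, v q j) * Q := by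
    rw [mul_sum, sum_mul]
    exact sum_le_sum fun j _ => Nat.mul_div_le _ _
  calc _ ≤ h q * (∑ j ∈ R', v q j * Q / h q + m) := b1
    _ ≤ h q * (n * n * l * Q + ∑ j ∈ R, v q j * Q / h q) := Nat.mul_le_mul_left _ hmain'
    _ = n * n * l * h q * Q + h q * ∑ j ∈ R, v q j * Q / h q := by ring
    _ ≤ n * n * l * h q * Q + (∑ j ∈ R, v q j) * Q := by omega
    _ = _ := by ring

end final

/-! ### The program -/

/-- Arrays of the program. -/
abbrev aIn : ℕ := 0
abbrev aOut : ℕ := 1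
abbrev aShare : ℕ := 2
abbrev aTurn : ℕ := 3
abbrev aPrice : ℕ := 4
abbrev aWeight : ℕ := 5
abbrev aTop : ℕ := 6
abbrev aSecond : ℕ := 7
abbrev aMat : ℕ := 8
abbrev aVec : ℕ := 9
abbrev aImage : ℕ := 10

/-- Scalar variables. -/
abbrev vBest : ℕ := 11
abbrev vMax : ℕ := 12
abbrev vAcc : ℕ := 13
abbrev vNormImage : ℕ := 14
abbrev vNorm : ℕ := 15
abbrev vNum : ℕ := 16
abbrev vDen : ℕ := 17

/-- Loop counters. -/
abbrev cRound : ℕ := 20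
abbrev cItem : ℕ := 21
abbrev cIter : ℕ := 22
abbrev cFill : ℕ := 23
abbrev cInner : ℕ := 24

open MDFA.Expr

def nE : Expr := read aIn 0
def mE : Expr := read aIn 1
def lE : Expr := read aIn 2
def dE : Expr := nE * lE
def turnsE : Expr := nE * nE * lE
def scaleE : Expr := 4 * nE * mE
def unitE : Expr := 8 * mE * mE
-- The number of matrix entries times the largest possible square of an entry.
def lipE : Expr := nE * dE * mE * (scaleE * scaleE)
def iterE : Expr := lipE * mE * mE

/-- The remainder of a division. -/
def Expr.mod (e f : Expr) : Expr := e - e / f * f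

/-- The value of item `j` in coordinate `q`. -/
def valE (q j : Expr) : Expr := read aIn (3 + (q / lE * mE + j) * lE + q.mod lE)

def pickP : Prog :=
  forP cRound (nE * lE * turnsE)
    (.seq (argmaxP vBest vMax cInner mE 0
        ((read aTurn (var cInner)).eqv 0 * (valE (var cRound / turnsE) (var cInner) + 1)))
      (.cond (leq 1 (var vMax))
        (.seq (.assign aTurn (var vBest) (var cRound + 1))
          (.assign aPrice (var cRound / turnsE) (var vMax - 1)))
        .nop))

def initShareP : Prog :=
  fillP aShare cFill (nE * mE) .nop
    ((read aTurn ((var cFill).mod mE)).eqv 0 * unitE +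
      (1 - (read aTurn ((var cFill).mod mE)).eqv 0) *
        (((read aTurn ((var cFill).mod mE) - 1) / (turnsE * lE)).eqv (var cFill / mE)) *
          (nE * unitE))

def scaledP : Prog :=
  fillP aWeight cFill (nE * lE * mE) .nop
    (valE (var cFill / mE) ((var cFill).mod mE) * scaleE / read aPrice (var cFill / mE))

def topP (a : ℕ) : Prog :=
  fillP a cFill mE
    (argmaxP vBest vMax cInner nE 0 (read aShare (var cInner * mE + var cFill))) (var vBest)

def secondP : Prog :=
  fillP aSecond cFill mE
    (argmaxP vBest vMax cInner nE (read aTop (var cFill))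
      (read aShare (var cInner * mE + var cFill) *
        (1 - (var cInner).eqv (read aTop (var cFill))))) (var vBest)

def swapE (a j : Expr) : Expr := (read aTop j).eqv a - (read aSecond j).eqv a

def matP : Prog :=
  fillP aMat cFill (nE * dE * mE) .nop
    (read aWeight ((var cFill / mE).mod dE * mE + (var cFill).mod mE) *
      swapE (var cFill / mE / dE) ((var cFill).mod mE))

/-- The second factor clears the vector if the chosen item is settled, so that no iterate ever has
weight on settled items. -/
def startP : Prog :=
  fillP aVec cFill mE .nop
    ((var cFill).eqv (var cItem) *
      (1 - (read aSecond (var cFill)).eqv (read aTop (var cFill))))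

def imageP : Prog :=
  fillP aImage cFill (nE * dE)
    (sumP vAcc cInner mE (read aMat (var cFill * mE + var cInner) * read aVec (var cInner)))
    (var vAcc)

/-- Overwriting the vector in place is sound: `X y` was saved before, and apart from it the new
entry needs only its own old value. -/
def descendP : Prog :=
  fillP aVec cFill mE
    (sumP vAcc cInner (nE * dE)
      (read aMat (var cInner * mE + var cFill) * read aImage (var cInner)))
    (lipE * read aVec (var cFill) - var vAcc)

def capacityE : Expr :=
  leq 0 (read aVec (var cFill)) * read aShare (read aSecond (var cFill) * mE + var cFill) +
    (1 - leq 0 (read aVec (var cFill))) * read aShare (read aTop (var cFill) * mE + var cFill)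

def absE : Expr := read aVec (var cFill) * (2 * leq 0 (read aVec (var cFill)) - 1)

def ratioP : Prog :=
  .seq (.assign vNum 0 1) (.seq (.assign vDen 0 0)
    (forP cFill mE (.cond (leq (capacityE * var vDen + 1) (var vNum * absE))
      (.seq (.assign vNum 0 capacityE) (.assign vDen 0 absE)) .nop)))

def moveP : Prog :=
  fillP aShare cFill (nE * mE) .nop
    (read aShare (var cFill) +
      var vNum * read aVec ((var cFill).mod mE) / var vDen *
        swapE (var cFill / mE) ((var cFill).mod mE))

/-- The zero vector never passes the test and is fixed by the descent. Clearing after a move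
therefore makes the remaining iterations idle. -/
def clearP : Prog := fillP aVec cFill mE .nop 0

def iterP : Prog :=
  .seq imageP (.seq (sumP vNormImage cFill (nE * dE) (read aImage (var cFill) * read aImage (var cFill)))
    (.seq (sumP vNorm cFill mE (read aVec (var cFill) * read aVec (var cFill)))
      (.cond (leq (var vNormImage * mE + 1) (var vNorm))
        (.seq ratioP (.seq moveP clearP)) descendP)))

def itemP : Prog :=
  .seq (topP aTop) (.seq secondP (.seq matP (.seq startP (forP cIter iterE iterP))))

/-- Every round that ends with too many unsettled items has created a zero share, and there are only
`n * m` shares; hence `n * m + 1` rounds. -/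
def mainP : Prog :=
  .seq pickP (.seq initShareP (.seq scaledP
    (.seq (forP cRound (nE * mE + 1) (forP cItem mE itemP)) (topP aOut))))

/-- The program for fair allocation. -/
def fairP : Prog := .cond mE mainP .nop

/-! ### Evaluation of its expressions -/

/-- The input array contains the instance with values `v` at most `V`. -/
structure IsInput (n m l V : ℕ) (v : ℕ → ℕ → ℕ) (inp : ℤ → ℤ) : Prop where
  cell_n : inp 0 = n
  cell_m : inp 1 = m
  cell_l : inp 2 = l
  n_pos : 0 < n
  m_pos : 0 < m
  l_pos : 0 < l
  val : ∀ q < n * l, ∀ j < m, inp ((3 + (q / l * m + j) * l + q % l : ℕ) : ℤ) = v q j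
  val_le : ∀ q < n * l, ∀ j < m, v q j ≤ V

/-- A bound for the operator norm squared. -/
def lip (n m l : ℕ) : ℕ := n * (n * l) * m * scale n m ^ 2

/-- The number of iterations of the descent. -/
def iters (n m l : ℕ) : ℕ := lip n m l * m * m

/-- A bound for the entries of the vectors in the descent. -/
def vecBound (n m l : ℕ) : ℕ := lip n m l ^ iters n m l

/-- The number `M` bounds all numbers that occur. -/
structure IsBig (M n m l V : ℕ) : Prop where
  val : V + 1 ≤ M
  wt : V * scale n m ≤ M
  turns : n * l * (n * n * l) ≤ M
  nm : n * m + 1 ≤ M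
  items : m ≤ M
  agents : n ≤ M
  nlm : n * l * m ≤ M
  mat : n * (n * l) * m ≤ M
  rows : n * (n * l) ≤ M
  iters : iters n m l ≤ M
  unit : n * unit m ≤ M
  vec : vecBound n m l ≤ M
  vec_sq : vecBound n m l ^ 2 ≤ M
  image : m * (scale n m * vecBound n m l) ≤ M
  image_sq : n * (n * l) * (m * (scale n m * vecBound n m l)) ^ 2 ≤ M
  scale_le : scale n m ≤ M
  back : n * (n * l) * (scale n m * (m * (scale n m * vecBound n m l))) ≤ M

section
variable {n m l V : ℕ} {v : ℕ → ℕ → ℕ} {inp : ℤ → ℤ} {s : Store}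

theorem IsInput.eval_n (hI : IsInput n m l V v inp) (hs : s 0 = inp) : nE.eval s = n := by
  simp [nE, hs, hI.cell_n]

theorem IsInput.eval_m (hI : IsInput n m l V v inp) (hs : s 0 = inp) : mE.eval s = m := by
  simp [mE, hs, hI.cell_m]

theorem IsInput.eval_l (hI : IsInput n m l V v inp) (hs : s 0 = inp) : lE.eval s = l := by
  rw [← hI.cell_l, ← hs]; rfl

theorem IsInput.eval_d (hI : IsInput n m l V v inp) (hs : s 0 = inp) :
    dE.eval s = ((n * l : ℕ) : ℤ) := by
  simp [dE, hI.eval_n hs, hI.eval_l hs]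

theorem IsInput.eval_turns (hI : IsInput n m l V v inp) (hs : s 0 = inp) :
    turnsE.eval s = ((n * n * l : ℕ) : ℤ) := by
  simp [turnsE, hI.eval_n hs, hI.eval_l hs]

theorem IsInput.eval_scale (hI : IsInput n m l V v inp) (hs : s 0 = inp) :
    scaleE.eval s = (scale n m : ℕ) := by
  simp [scaleE, scale, hI.eval_n hs, hI.eval_m hs]

theorem IsInput.eval_unit (hI : IsInput n m l V v inp) (hs : s 0 = inp) :
    unitE.eval s = (unit m : ℕ) := by
  simp [unitE, unit, hI.eval_m hs]

theorem IsInput.eval_lip (hI : IsInput n m l V v inp) (hs : s 0 = inp) :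
    lipE.eval s = (lip n m l : ℕ) := by
  simp [lipE, lip, hI.eval_n hs, hI.eval_m hs, hI.eval_d hs, hI.eval_scale hs, sq]

theorem IsInput.eval_iter (hI : IsInput n m l V v inp) (hs : s 0 = inp) :
    iterE.eval s = (iters n m l : ℕ) := by
  simp [iterE, iters, hI.eval_lip hs, hI.eval_m hs]

theorem Expr.eval_mod {e f : Expr} {a b : ℕ} (he : e.eval s = a) (hf : f.eval s = b) :
    (e.mod f).eval s = ((a % b : ℕ) : ℤ) := by
  simp only [Expr.mod, eval_sub, eval_mul, eval_div, he, hf]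
  have := Nat.div_add_mod' a b
  have h : ((a / b * b + a % b : ℕ) : ℤ) = a := by rw [this]
  push_cast at h ⊢
  linarith

theorem IsInput.eval_val (hI : IsInput n m l V v inp) (hs : s 0 = inp) {e f : Expr} {q j : ℕ}
    (he : e.eval s = q) (hf : f.eval s = j) (hq : q < n * l) (hj : j < m) :
    (valE e f).eval s = v q j := by
  rw [← hI.val q hq j hj, valE, eval_read, hs]
  congr 1
  simp only [eval_add, eval_mul, eval_div, eval_ofNat, hI.eval_l hs, hI.eval_m hs, he, hf,
    eval_mod he (hI.eval_l hs)]
  push_cast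
  rfl

end

theorem Halts.fillE {M : ℕ} {s : Store} {Q : Store → Prop} {arr c : ℕ} {b e : Expr} (N : ℕ)
    (f : ℕ → ℤ) (hN : N ≤ M) (hca : c ≠ arr)
    (hb : ∀ s', Frame [arr, c] s s' → b.eval s' = N)
    (hf : ∀ i < N, |f i| ≤ (M : ℤ))
    (he : ∀ i < N, ∀ s', Frame [arr, c] s s' → s' c 0 = i → s' arr i = s arr i → e.eval s' = f i)
    (hQ : ∀ s', Frame [arr, c] s s' → (∀ i < N, s' arr i = f i) → Q s') :
    Halts M (MDFA.fillP arr c b .nop e) (N * 4 + 2) s Q :=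
  Halts.fillP (k := 1) N f [] hN (by simp) (by simp) hca hb hf
    (fun i hi s' hs hc ha => .nop ⟨Frame.refl _ _, he i hi s' hs hc ha⟩) hQ

/-! ### Correctness of the program: picking, shares and tables -/

section
variable {M n m l V : ℕ} {v : ℕ → ℕ → ℕ} {inp : ℤ → ℤ} {s : Store}

/-- The shares in memory. -/
def HasShares (n m : ℕ) (s : Store) (p : ℕ → ℕ → ℤ) : Prop :=
  ∀ a < n, ∀ j < m, s aShare ((a * m + j : ℕ) : ℤ) = p a j

theorem div_lt_of_lt_mul' {c a b : ℕ} (h : c < a * b) : c / b < a :=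
  Nat.div_lt_of_lt_mul (by rwa [mul_comm])

theorem mod_lt_of_lt_mul {c a b : ℕ} (h : c < a * b) : c % b < b :=
  Nat.mod_lt _ (Nat.pos_of_ne_zero fun h0 => by simp [h0] at h)

theorem mul_add_lt_mul {a b i j : ℕ} (hi : i < a) (hj : j < b) : i * b + j < a * b :=
  calc i * b + j < (i + 1) * b := by rw [add_mul]; omega
    _ ≤ a * b := Nat.mul_le_mul_right _ hi

theorem mul_add_div' {b : ℕ} (a : ℕ) {j : ℕ} (hj : j < b) : (a * b + j) / b = a := by
  rw [mul_comm, Nat.mul_add_div (by omega), Nat.div_eq_of_lt hj, add_zero]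

theorem mul_add_mod'' {b : ℕ} (a : ℕ) {j : ℕ} (hj : j < b) : (a * b + j) % b = j := by
  rw [Nat.mul_add_mod', Nat.mod_eq_of_lt hj]

theorem halts_pickP (hI : IsInput n m l V v inp) (hM : IsBig M n m l V) (hs : s 0 = inp)
    (h3 : s aTurn = 0) (h4 : s aPrice = 0) :
    Halts M pickP (n * l * (n * n * l) * (m * 6 + 11) + 2) s fun s' =>
      Frame [aTurn, aPrice, vBest, vMax, cRound, cInner] s s' ∧
      ∃ τ h : ℕ → ℕ, (∀ j < m, s' aTurn j = τ j) ∧ (∀ q < n * l, s' aPrice q = h q) ∧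
        IsPick m (n * n * l) (n * l * (n * n * l)) v τ h := by
  have hN : 0 < n * n * l := by
    have := hI.n_pos; have := hI.l_pos; positivity
  refine (Halts.forP (k := (m * 6 + 4) + (1 + (1 + 1) + 1)) (n * l * (n * n * l)) (fun c s' =>
    Frame [aTurn, aPrice, vBest, vMax, cRound, cInner] s s' ∧
      ∃ τ h : ℕ → ℕ, (∀ j < m, s' aTurn j = τ j) ∧ (∀ q < n * l, s' aPrice q = h q) ∧
        IsPick m (n * n * l) c v τ h) hM.turns ?_ ?_ ?_ ?_ ?_).mono (by ring_nf; omega)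
    fun _ h => h
  · rintro i s1 s2 hf ⟨h1, τ, h, h2, h3, h4⟩
    rw [hf aTurn (by decide), hf aPrice (by decide)]
    exact ⟨h1.trans (hf.mono (by simp)), τ, h, h2, h3, h4⟩
  · exact ⟨Frame.refl _ _, fun _ => 0, fun _ => 0, by simp [h3], by simp [h4], isPick_zero _ _ _⟩
  · rintro i s' - ⟨h1, -⟩
    have hs' : s' 0 = inp := by rw [h1 0 (by decide), hs]
    simp only [eval_mul, hI.eval_n hs', hI.eval_l hs', hI.eval_turns hs']
    push_cast; ring
  · rintro c s' hc ⟨h1, τ, h, h2, h3, h4⟩ hcr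
    have hs' : s' 0 = inp := by rw [h1 0 (by decide), hs]
    have hq : c / (n * n * l) < n * l := div_lt_of_lt_mul' hc
    refine Halts.seq (R := fun s'' => Frame [vBest, vMax, cInner] s' s'' ∧
      s'' vBest 0 = (argmax (pickScore (n * n * l) c v τ) 0 m).1 ∧
      s'' vMax 0 = (argmax (pickScore (n * n * l) c v τ) 0 m).2)
      (Halts.argmaxP m 0 (pickScore (n * n * l) c v τ) hM.items (by simp) (by decide) (by decide)
        (by decide) (by simp) ?_ ?_ ?_ fun s'' g1 g2 g3 => ⟨g1, g2, g3⟩) ?_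
    · intro s'' hf
      exact hI.eval_m (by rw [hf 0 (by decide), hs'])
    · intro j hj s'' hf hcj
      have hs'' : s'' 0 = inp := by rw [hf 0 (by decide), hs']
      have e1 : (var cRound / turnsE).eval s'' = ((c / (n * n * l) : ℕ) : ℤ) := by
        rw [eval_div, hI.eval_turns hs'', eval_var, hf cRound (by decide), hcr]
        norm_cast
      rw [eval_mul, eval_add, hI.eval_val hs'' e1 (j := j) (by simpa using hcj) hq hj]
      simp [hcj, hf aTurn (by decide), h2 j hj, pickScore]
    · intro j hj
      have := hI.val_le _ hq j hj
      have hle := hM.val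
      unfold pickScore
      split_ifs
      · rw [abs_of_nonneg (by positivity)]; omega
      · simp
    · rintro s'' ⟨g1, g2, g3⟩
      have hs'' : s'' 0 = inp := by rw [g1 0 (by decide), hs']
      have hcr'' : s'' cRound 0 = c := by rw [g1 cRound (by decide), hcr]
      refine Halts.cond ?_ ?_
      · intro hne
        have h0 : (argmax (pickScore (n * n * l) c v τ) 0 m).2 ≠ 0 := by
          intro h0
          simp [g3, h0] at hne
        obtain ⟨b, hbm, hb1, hbτ, hb2, hb3⟩ := h4.pick hN h0
        refine Halts.seq (R := fun s3 => s3 = s''.write aTurn b (c + 1)) (.assign ?_ ?_) ?_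
        · simp only [eval_add, eval_var, hcr'', eval_one]
          rw [abs_of_nonneg (by positivity)]
          have := hM.turns; omega
        · simp only [eval_add, eval_var, hcr'', eval_one, g2, hb1]
        · rintro s3 rfl
          have e2 : (var cRound / turnsE).eval (s''.write aTurn b (c + 1)) =
              ((c / (n * n * l) : ℕ) : ℤ) := by
            rw [eval_div, hI.eval_turns (by rw [Store.write_of_ne _ (by decide), hs'']), eval_var,
              Store.write_of_ne _ (by decide), hcr'']
            norm_cast
          have e3 : (var vMax - 1).eval (s''.write aTurn b (c + 1)) = v (c / (n * n * l)) b := by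
            rw [eval_sub, eval_var, eval_one, Store.write_of_ne _ (by decide), g3, hb2]
          have hvM := hI.val_le _ hq b hbm
          have := hM.val
          refine .assign ?_ ⟨?_, ?_, _, _, ?_, ?_, hb3⟩
          · rw [e3, abs_of_nonneg (by positivity)]; omega
          · rw [Store.write_of_ne _ (by decide), Store.write_of_ne _ (by decide), hcr'']
          · refine ((h1.trans (g1.mono (by simp))).trans
              ((Frame.write _ _ _ _).mono (by simp))).trans ((Frame.write _ _ _ _).mono (by simp))
          · intro j hj
            rw [Store.write_of_ne _ (by decide)]
            by_cases hjb : j = b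
            · subst hjb; simp
            · rw [Store.write_cell_ne _ _ (by exact_mod_cast hjb), g1 aTurn (by decide), h2 j hj,
                Function.update_of_ne hjb]
          · intro q hq'
            rw [e2, e3]
            by_cases hqc : q = c / (n * n * l)
            · subst hqc; simp
            · rw [Store.write_cell_ne _ _ (by exact_mod_cast hqc),
                Store.write_of_ne _ (by decide), g1 aPrice (by decide), h3 q hq',
                Function.update_of_ne hqc]
      · intro he
        have h0 : (argmax (pickScore (n * n * l) c v τ) 0 m).2 = 0 := by
          by_contra h0
          have := argmax_nonneg (pickScore (n * n * l) c v τ) 0 m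
          simp [g3] at he
          omega
        refine .nop ⟨hcr'', h1.trans (g1.mono (by simp)), τ, h, ?_, ?_, h4.skip h0⟩
        · rw [g1 aTurn (by decide)]; exact h2
        · rw [g1 aPrice (by decide)]; exact h3
  · rintro s' h
    exact h

theorem halts_initShareP (hI : IsInput n m l V v inp) (hM : IsBig M n m l V) (hs : s 0 = inp)
    {τ h : ℕ → ℕ} (hτ : ∀ j < m, s aTurn j = τ j) (H : IsPick m (n * n * l) (n * l * (n * n * l)) v τ h) :
    Halts M initShareP (n * m * 4 + 2) s fun s' =>
      Frame [aShare, cFill] s s' ∧ HasShares n m s' (initShare n m l τ) := by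
  refine Halts.fillE (n * m) (fun c => initShare n m l τ (c / m) (c % m))
    (by have := hM.nm; omega) (by decide) ?_ ?_ ?_ ?_
  · intro s' hf
    have hs' : s' 0 = inp := by rw [hf 0 (by decide), hs]
    simp [hI.eval_n hs', hI.eval_m hs']
  · intro c hc
    have hd := initShare_distr H (mod_lt_of_lt_mul hc)
    rw [abs_of_nonneg (hd.1 _ (div_lt_of_lt_mul' hc))]
    exact (hd.le (div_lt_of_lt_mul' hc)).trans (by exact_mod_cast hM.unit)
  · intro c hc s' hf hci _
    have hs' : s' 0 = inp := by rw [hf 0 (by decide), hs]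
    have hj := mod_lt_of_lt_mul hc
    have e1 := eval_mod (e := var cFill) (by simpa using hci) (hI.eval_m hs')
    have e2 : (read aTurn ((var cFill).mod mE)).eval s' = τ (c % m) := by
      rw [eval_read, e1, hf aTurn (by decide), hτ _ hj]
    simp only [eval_add, eval_mul, eval_sub, eval_one, eval_eqv, eval_zero, e2, hI.eval_unit hs',
      eval_div, hI.eval_turns hs', hI.eval_l hs', eval_var, hci, hI.eval_m hs', hI.eval_n hs',
      initShare]
    -- For `τ = 0` the integer `τ - 1` is negative and differs from the truncated difference in
    -- `initShare`; the factor `1 - [τ = 0]` removes that term.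
    by_cases h0 : τ (c % m) = 0
    · simp [h0]
    · have e3 : ((τ (c % m) : ℤ) - 1) / (((n * n * l : ℕ) : ℤ) * l) =
          (((τ (c % m) - 1) / (n * n * l * l) : ℕ) : ℤ) := by
        push_cast [Nat.one_le_iff_ne_zero.mpr h0]
        rfl
      rw [e3]
      have e4 : (c : ℤ) / m = ((c / m : ℕ) : ℤ) := by norm_cast
      rw [e4]
      simp only [Nat.cast_eq_zero, h0, if_false, Nat.cast_inj]
      split_ifs <;> simp
  · intro s' hf hc
    refine ⟨hf, fun a ha j hj => ?_⟩
    rw [hc _ (mul_add_lt_mul ha hj), mul_add_div' _ hj, mul_add_mod'' _ hj]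

/-- The weights in memory. -/
def HasWeights (n m l : ℕ) (s : Store) (w : ℕ → ℕ → ℤ) : Prop :=
  ∀ q < n * l, ∀ j < m, s aWeight ((q * m + j : ℕ) : ℤ) = w q j

theorem halts_scaledP (hI : IsInput n m l V v inp) (hM : IsBig M n m l V) (hs : s 0 = inp)
    {h : ℕ → ℕ} (hh : ∀ q < n * l, s aPrice q = h q) :
    Halts M scaledP (n * l * m * 4 + 2) s fun s' =>
      Frame [aWeight, cFill] s s' ∧ HasWeights n m l s' (scaled n m v h) := by
  refine Halts.fillE (n * l * m) (fun c => scaled n m v h (c / m) (c % m)) hM.nlm (by decide)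
    ?_ ?_ ?_ ?_
  · intro s' hf
    have hs' : s' 0 = inp := by rw [hf 0 (by decide), hs]
    simp [hI.eval_n hs', hI.eval_m hs', hI.eval_l hs']
  · intro c hc
    have h1 := hI.val_le _ (div_lt_of_lt_mul' hc) _ (mod_lt_of_lt_mul hc)
    rw [scaled, abs_of_nonneg (by positivity)]
    have h2 : v (c / m) (c % m) * scale n m / h (c / m) ≤ M :=
      (Nat.div_le_self _ _).trans ((Nat.mul_le_mul_right _ h1).trans hM.wt)
    exact_mod_cast h2
  · intro c hc s' hf hci _
    have hs' : s' 0 = inp := by rw [hf 0 (by decide), hs]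
    have hj := mod_lt_of_lt_mul hc
    have hq := div_lt_of_lt_mul' hc
    have e1 := eval_mod (e := var cFill) (by simpa using hci) (hI.eval_m hs')
    have e2 : (var cFill / mE).eval s' = ((c / m : ℕ) : ℤ) := by
      rw [eval_div, eval_var, hci, hI.eval_m hs']; norm_cast
    rw [eval_div, eval_mul, hI.eval_val hs' e2 e1 hq hj, hI.eval_scale hs', eval_read, e2,
      hf aPrice (by decide), hh _ hq, scaled]
    norm_cast
  · intro s' hf hc
    refine ⟨hf, fun a ha j hj => ?_⟩
    rw [hc _ (mul_add_lt_mul ha hj), mul_add_div' _ hj, mul_add_mod'' _ hj]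

theorem HasShares.frame {s s' : Store} {p : ℕ → ℕ → ℤ} (h : HasShares n m s p)
    (hs : s' aShare = s aShare) : HasShares n m s' p := by
  unfold HasShares; rw [hs]; exact h

theorem halts_topP (hI : IsInput n m l V v inp) (hM : IsBig M n m l V) (hs : s 0 = inp)
    {D : ℕ} {p : ℕ → ℕ → ℤ} (hp : HasShares n m s p) (hD : 0 < D) (hDM : D ≤ M)
    (hd : ∀ j < m, IsDistr n D p j) {a : ℕ}
    (ha : a = aTop ∨ a = aOut) :
    Halts M (topP a) (m * (n * 6 + 7) + 2) s fun s' =>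
      Frame [a, cFill, vBest, vMax, cInner] s s' ∧ ∀ j < m, s' a j = top n p j := by
  have ha0 : a ≠ 0 := by rcases ha with rfl | rfl <;> decide
  have ha2 : a ≠ aShare := by rcases ha with rfl | rfl <;> decide
  have haL : a ∉ [vBest, vMax, cInner] := by rcases ha with rfl | rfl <;> decide
  have hca : cFill ≠ a := by rcases ha with rfl | rfl <;> decide
  refine Halts.fillP (k := n * 6 + 4) m (fun j => top n p j) [vBest, vMax, cInner] hM.items
    (by decide) haL hca ?_ ?_ ?_ ?_
  · intro s' hf
    exact hI.eval_m (by rw [hf 0 (by simp [ha0.symm]), hs])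
  · intro j hj
    rw [abs_of_nonneg (by positivity)]
    have := ((hd j hj).top_spec hD).1
    have := hM.agents
    omega
  · intro j hj s' hf hcj _
    have hs' : s' 0 = inp := by rw [hf 0 (by simp [ha0.symm]), hs]
    refine Halts.argmaxP n 0 (fun a => p a j) hM.agents (by simp) (by decide) (by decide) (by decide)
      (by simp) ?_ ?_ ?_ ?_
    · intro s'' hf'
      exact hI.eval_n (by rw [hf' 0 (by decide), hs'])
    · intro i hi s'' hf' hci
      have hs'' : s'' 0 = inp := by rw [hf' 0 (by decide), hs']
      rw [← hp i hi j hj]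
      simp only [eval_read, eval_add, eval_mul, eval_var, hci, hI.eval_m hs'', hf' cFill (by decide),
        hcj, hf' aShare (by decide), hf aShare (by simp [ha2.symm])]
      push_cast; rfl
    · intro i hi
      rw [abs_of_nonneg ((hd j hj).1 i hi)]
      exact ((hd j hj).le hi).trans (by exact_mod_cast hDM)
    · intro s'' hf' hb _
      exact ⟨hf', by rw [eval_var, hb]; rfl⟩
  · intro s' hf h
    exact ⟨hf, h⟩

theorem halts_secondP (hI : IsInput n m l V v inp) (hM : IsBig M n m l V) (hs : s 0 = inp)
    {D : ℕ} {p : ℕ → ℕ → ℤ} (hp : HasShares n m s p) (hD : 0 < D) (hDM : D ≤ M)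
    (hd : ∀ j < m, IsDistr n D p j) (ht : ∀ j < m, s aTop j = top n p j) :
    Halts M secondP (m * (n * 6 + 7) + 2) s fun s' =>
      Frame [aSecond, cFill, vBest, vMax, cInner] s s' ∧ ∀ j < m, s' aSecond j = second n p j := by
  refine Halts.fillP (k := n * 6 + 4) m (fun j => second n p j) [vBest, vMax, cInner] hM.items
    (by decide) (by decide) (by decide) ?_ ?_ ?_ ?_
  · intro s' hf
    exact hI.eval_m (by rw [hf 0 (by decide), hs])
  · intro j hj
    rw [abs_of_nonneg (by positivity)]
    have := (hd j hj).second_lt hD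
    have := hM.agents
    omega
  · intro j hj s' hf hcj _
    have hs' : s' 0 = inp := by rw [hf 0 (by decide), hs]
    have ht' : (read aTop (var cFill)).eval s' = top n p j := by
      rw [eval_read, eval_var, hcj, hf aTop (by decide), ht j hj]
    refine Halts.argmaxP n (top n p j)
      (fun a => p a j * (1 - if a = top n p j then 1 else 0)) hM.agents ?_ (by decide) (by decide)
      (by decide) ht' ?_ ?_ ?_ ?_
    · exact ((hd j hj).top_spec hD).1.le.trans hM.agents
    · intro s'' hf'
      exact hI.eval_n (by rw [hf' 0 (by decide), hs'])
    · intro i hi s'' hf' hci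
      have hs'' : s'' 0 = inp := by rw [hf' 0 (by decide), hs']
      have e1 : (read aTop (var cFill)).eval s'' = top n p j := by
        rw [eval_read, eval_var, hf' cFill (by decide), hf' aTop (by decide), ← ht', eval_read,
          eval_var]
      have e2 : (read aShare (var cInner * mE + var cFill)).eval s'' = p i j := by
        rw [← hp i hi j hj]
        simp only [eval_read, eval_add, eval_mul, eval_var, hci, hI.eval_m hs'',
          hf' cFill (by decide), hcj, hf' aShare (by decide), hf aShare (by decide)]
        push_cast; rfl
      rw [eval_mul, e2, eval_sub, eval_one, eval_eqv, e1, eval_var, hci]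
      simp
    · intro i hi
      have h1 := (hd j hj).1 i hi
      have h2 := (hd j hj).le hi
      have h3 : (D : ℤ) ≤ M := by exact_mod_cast hDM
      split_ifs
      · simp
      · rw [sub_zero, mul_one, abs_of_nonneg h1]; omega
    · intro s'' hf' hb _
      exact ⟨hf', by rw [eval_var, hb]; rfl⟩
  · intro s' hf h
    exact ⟨hf, h⟩

theorem eval_swapE {p : ℕ → ℕ → ℤ} {ea ej : Expr} {a j : ℕ} (ha : ea.eval s = a)
    (hj : ej.eval s = j) (h6 : s aTop j = top n p j) (h7 : s aSecond j = second n p j) :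
    (swapE ea ej).eval s = swapDir n p a j := by
  simp [swapE, swapDir, ha, hj, h6, h7]

/-- The matrix in memory. -/
def HasMat (R m : ℕ) (s : Store) (X : ℕ → ℕ → ℤ) : Prop :=
  ∀ r < R, ∀ j < m, s aMat ((r * m + j : ℕ) : ℤ) = X r j

theorem halts_matP (hI : IsInput n m l V v inp) (hM : IsBig M n m l V) (hs : s 0 = inp)
    {w p : ℕ → ℕ → ℤ} (hw : HasWeights n m l s w) (hsm : SmallOn n m (n * l) (scale n m) w p)
    (ht : ∀ j < m, s aTop j = top n p j) (hse : ∀ j < m, s aSecond j = second n p j) :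
    Halts M matP (n * (n * l) * m * 4 + 2) s fun s' =>
      Frame [aMat, cFill] s s' ∧ HasMat (n * (n * l)) m s' (swapMat n (n * l) w p) := by
  refine Halts.fillE (n * (n * l) * m) (fun c => swapMat n (n * l) w p (c / m) (c % m)) hM.mat
    (by decide) ?_ ?_ ?_ ?_
  · intro s' hf
    have hs' : s' 0 = inp := by rw [hf 0 (by decide), hs]
    simp [hI.eval_n hs', hI.eval_m hs', hI.eval_d hs']
  · intro c hc
    exact (hsm.abs_swapMat_le (div_lt_of_lt_mul' hc) (mod_lt_of_lt_mul hc)).trans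
      (by exact_mod_cast hM.scale_le)
  · intro c hc s' hf hci _
    have hs' : s' 0 = inp := by rw [hf 0 (by decide), hs]
    have hj := mod_lt_of_lt_mul hc
    have hr := div_lt_of_lt_mul' hc
    have e1 := eval_mod (e := var cFill) (by simpa using hci) (hI.eval_m hs')
    have e2 : (var cFill / mE).eval s' = ((c / m : ℕ) : ℤ) := by
      rw [eval_div, eval_var, hci, hI.eval_m hs']; norm_cast
    have e3 := eval_mod e2 (hI.eval_d hs')
    have e4 : (var cFill / mE / dE).eval s' = ((c / m / (n * l) : ℕ) : ℤ) := by
      rw [eval_div, e2, hI.eval_d hs']; norm_cast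
    rw [eval_mul, eval_swapE (p := p) (n := n) e4 e1 (by rw [hf aTop (by decide), ht _ hj])
      (by rw [hf aSecond (by decide), hse _ hj]), swapMat, ← hw _ (mod_lt_of_lt_mul hr) _ hj]
    simp only [eval_read, eval_add, eval_mul, e1, e3, hI.eval_m hs', hf aWeight (by decide)]
    push_cast; rfl
  · intro s' hf hc
    refine ⟨hf, fun a ha j hj => ?_⟩
    rw [hc _ (mul_add_lt_mul ha hj), mul_add_div' _ hj, mul_add_mod'' _ hj]

/-- The vector at which the descent for item `j₀` starts. -/
def startVec (n : ℕ) (p : ℕ → ℕ → ℤ) (j₀ j : ℕ) : ℤ :=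
  (if j = j₀ then 1 else 0) * (1 - if second n p j = top n p j then 1 else 0)

theorem abs_startVec_le (p : ℕ → ℕ → ℤ) (j₀ j : ℕ) : |startVec n p j₀ j| ≤ 1 := by
  unfold startVec; split_ifs <;> simp

theorem halts_startP (hI : IsInput n m l V v inp) (hM : IsBig M n m l V) (hs : s 0 = inp)
    {p : ℕ → ℕ → ℤ} {j₀ : ℕ} (hj₀ : s cItem 0 = j₀)
    (ht : ∀ j < m, s aTop j = top n p j) (hse : ∀ j < m, s aSecond j = second n p j) :
    Halts M startP (m * 4 + 2) s fun s' =>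
      Frame [aVec, cFill] s s' ∧ ∀ j < m, s' aVec j = startVec n p j₀ j := by
  refine Halts.fillE m (fun j => startVec n p j₀ j) hM.items (by decide) ?_ ?_ ?_
    fun s' hf h => ⟨hf, h⟩
  · intro s' hf
    exact hI.eval_m (by rw [hf 0 (by decide), hs])
  · intro j _
    refine (abs_startVec_le _ _ _).trans ?_
    have := hM.nm
    omega
  · intro j hj s' hf hci _
    simp [hci, hf cItem (by decide), hj₀, hf aTop (by decide), hf aSecond (by decide), ht j hj,
      hse j hj, startVec]

end

theorem abs_sum_range_le {f : ℕ → ℤ} {N : ℕ} {C : ℕ} (h : ∀ j < N, |f j| ≤ C) {i : ℕ}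
    (hi : i ≤ N) : |∑ j ∈ range i, f j| ≤ ((N * C : ℕ) : ℤ) := by
  calc _ ≤ ∑ j ∈ range i, |f j| := abs_sum_le_sum_abs _ _
    _ ≤ ∑ j ∈ range i, (C : ℤ) := sum_le_sum fun j hj => h j (by have := mem_range.mp hj; omega)
    _ = ((i * C : ℕ) : ℤ) := by simp
    _ ≤ _ := by exact_mod_cast Nat.mul_le_mul_right _ hi

theorem abs_mul_le_cast {x y : ℤ} {A B : ℕ} (hx : |x| ≤ A) (hy : |y| ≤ B) :
    |x * y| ≤ ((A * B : ℕ) : ℤ) := by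
  rw [abs_mul]
  push_cast
  exact mul_le_mul hx hy (abs_nonneg _) (by positivity)

theorem abs_le_of_sum_sq_le {y : ℕ → ℤ} {m K : ℕ} (h : ∑ j ∈ range m, y j ^ 2 ≤ (K : ℤ) ^ 2) {j : ℕ}
    (hj : j < m) : |y j| ≤ K :=
  abs_le_of_sq_le_sq ((single_le_sum (f := fun j => y j ^ 2) (fun _ _ => sq_nonneg _)
    (mem_range.mpr hj)).trans h) (by positivity)

theorem descend_eq_zero {X : ℕ → ℕ → ℤ} {R m L : ℕ} {y : ℕ → ℤ} {j : ℕ}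
    (hX : ∀ r < R, X r j = 0) (hy : y j = 0) (k : ℕ) : descend X R m L y k j = 0 := by
  induction k with
  | zero => exact hy
  | succ k ih =>
    simp only [descend]
    rw [ih, sum_eq_zero]
    · simp
    · intro r hr
      rw [hX r (mem_range.mp hr), zero_mul]

/-! ### Correctness of the program: descent and step for one starting item -/

section
variable {M n m l V : ℕ} {v : ℕ → ℕ → ℕ} {inp : ℤ → ℤ} {s : Store} {X : ℕ → ℕ → ℤ} {y : ℕ → ℤ}

/-- The vector in memory. -/
def HasVec (m : ℕ) (s : Store) (y : ℕ → ℤ) : Prop := ∀ j < m, s aVec j = y j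

theorem abs_mulY_le {R : ℕ} {A K : ℕ} (hX : ∀ r < R, ∀ j < m, |X r j| ≤ A) (hy : ∀ j < m, |y j| ≤ K)
    {r : ℕ} (hr : r < R) : |mulY X m y r| ≤ ((m * (A * K) : ℕ) : ℤ) :=
  abs_sum_range_le (fun j hj => abs_mul_le_cast (hX r hr j hj) (hy j hj)) le_rfl

theorem halts_imageP (hI : IsInput n m l V v inp) (hM : IsBig M n m l V) (hs : s 0 = inp)
    (hmat : HasMat (n * (n * l)) m s X) (hvec : HasVec m s y)
    (hX : ∀ r < n * (n * l), ∀ j < m, |X r j| ≤ scale n m) (hy : ∀ j < m, |y j| ≤ vecBound n m l) :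
    Halts M imageP (n * (n * l) * (m * 3 + 6) + 2) s fun s' =>
      Frame [aImage, cFill, vAcc, cInner] s s' ∧
      ∀ r < n * (n * l), s' aImage r = mulY X m y r := by
  refine Halts.fillP (k := m * 3 + 3) (n * (n * l)) (mulY X m y) [vAcc, cInner] hM.rows
    (by decide) (by decide) (by decide) ?_ ?_ ?_ fun s' hf h => ⟨hf, h⟩
  · intro s' hf
    have hs' : s' 0 = inp := by rw [hf 0 (by decide), hs]
    simp [hI.eval_n hs', hI.eval_d hs']
  · intro r hr
    exact (abs_mulY_le hX hy hr).trans (by exact_mod_cast hM.image)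
  · intro r hr s' hf hcr _
    have hs' : s' 0 = inp := by rw [hf 0 (by decide), hs]
    refine Halts.sumP m (fun j => X r j * y j) hM.items (by decide) ?_ ?_ ?_ ?_
    · intro s'' hf'
      exact hI.eval_m (by rw [hf' 0 (by decide), hs'])
    · intro j hj s'' hf' hcj
      have hs'' : s'' 0 = inp := by rw [hf' 0 (by decide), hs']
      rw [← hmat r hr j hj, ← hvec j hj]
      simp only [eval_read, eval_add, eval_mul, eval_var, hcj, hI.eval_m hs'',
        hf' cFill (by decide), hcr, hf' aMat (by decide), hf aMat (by decide),
        hf' aVec (by decide), hf aVec (by decide)]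
      push_cast; rfl
    · intro i hi
      exact (abs_sum_range_le (fun j hj => abs_mul_le_cast (hX r hr j hj) (hy j hj)) hi).trans
        (by exact_mod_cast hM.image)
    · intro s'' hf' h
      exact ⟨hf', h⟩

theorem halts_descendP (hI : IsInput n m l V v inp) (hM : IsBig M n m l V) (hs : s 0 = inp)
    (hmat : HasMat (n * (n * l)) m s X) (hvec : HasVec m s y)
    (him : ∀ r < n * (n * l), s aImage r = mulY X m y r)
    (hX : ∀ r < n * (n * l), ∀ j < m, |X r j| ≤ scale n m) (hy : ∀ j < m, |y j| ≤ vecBound n m l)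
    (hnext : ∀ j < m, |descend X (n * (n * l)) m (lip n m l) y 1 j| ≤ vecBound n m l) :
    Halts M descendP (m * (n * (n * l) * 3 + 6) + 2) s fun s' =>
      Frame [aVec, cFill, vAcc, cInner] s s' ∧
      HasVec m s' (descend X (n * (n * l)) m (lip n m l) y 1) := by
  refine Halts.fillP (k := n * (n * l) * 3 + 3) m _ [vAcc, cInner] hM.items
    (by decide) (by decide) (by decide) ?_ ?_ ?_ fun s' hf h => ⟨hf, h⟩
  · intro s' hf
    exact hI.eval_m (by rw [hf 0 (by decide), hs])
  · intro j hj
    exact (hnext j hj).trans (by exact_mod_cast hM.vec)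
  · intro j hj s' hf hcj hkeep
    have hs' : s' 0 = inp := by rw [hf 0 (by decide), hs]
    refine Halts.sumP (n * (n * l)) (fun r => X r j * mulY X m y r) hM.rows (by decide) ?_ ?_ ?_ ?_
    · intro s'' hf'
      have hs'' : s'' 0 = inp := by rw [hf' 0 (by decide), hs']
      simp [hI.eval_n hs'', hI.eval_d hs'']
    · intro r hr s'' hf' hcr
      have hs'' : s'' 0 = inp := by rw [hf' 0 (by decide), hs']
      rw [← hmat r hr j hj, ← him r hr]
      simp only [eval_read, eval_add, eval_mul, eval_var, hcr, hI.eval_m hs'',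
        hf' cFill (by decide), hcj, hf' aMat (by decide), hf aMat (by decide),
        hf' aImage (by decide), hf aImage (by decide)]
      push_cast; rfl
    · intro i hi
      exact (abs_sum_range_le
        (fun r hr => abs_mul_le_cast (hX r hr j hj) (abs_mulY_le hX hy hr)) hi).trans
        (by exact_mod_cast hM.back)
    · intro s'' hf' h
      have hs'' : s'' 0 = inp := by rw [hf' 0 (by decide), hs']
      refine ⟨hf', ?_⟩
      rw [eval_sub, eval_mul, hI.eval_lip hs'', eval_read, eval_var, eval_var, h,
        hf' cFill (by decide), hcj, hf' aVec (by decide), hkeep, hvec j hj]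
      rfl

/-- Top and second agents in memory. -/
def HasTops (n m : ℕ) (s : Store) (p : ℕ → ℕ → ℤ) : Prop :=
  (∀ j < m, s aTop j = top n p j) ∧ ∀ j < m, s aSecond j = second n p j

theorem halts_ratioP (hI : IsInput n m l V v inp) (hM : IsBig M n m l V) (hs : s 0 = inp)
    {D : ℕ} (hD : 0 < D) (hDM : D ≤ M) {p : ℕ → ℕ → ℤ} (hp : HasShares n m s p)
    (hd : ∀ j < m, IsDistr n D p j) (ht : HasTops n m s p) (hvec : HasVec m s y)
    (hy : ∀ j < m, |y j| ≤ vecBound n m l) :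
    Halts M ratioP (m * 6 + 4) s fun s' => Frame [vNum, vDen, cFill] s s' ∧
      s' vNum 0 = (stepLen n m p y).1 ∧ s' vDen 0 = (stepLen n m p y).2 := by
  refine (Halts.seq (k := 1) (k' := 1 + (m * ((1 + (1 + 1) + 1) + 2) + 2))
    (R := fun s' => Frame [vNum, vDen, cFill] s s' ∧ s' vNum 0 = 1) ?_ ?_).mono (by omega)
    fun _ h => h
  · refine .assign ?_ ⟨(Frame.write _ _ _ _).mono (by simp), by simp⟩
    have := hM.nm
    rw [eval_one, abs_one]; omega
  rintro s1 ⟨hf1, h11⟩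
  refine Halts.seq (R := fun s' => Frame [vNum, vDen, cFill] s s' ∧ s' vNum 0 = 1 ∧ s' vDen 0 = 0)
    (.assign (by simp) ⟨hf1.trans ((Frame.write _ _ _ _).mono (by simp)), ?_, by simp⟩) ?_
  · rw [Store.write_of_ne _ (by decide), h11]
  rintro s2 ⟨hf2, h21, h22⟩
  refine Halts.forP (k := 1 + (1 + 1) + 1) m (fun i s' => Frame [vNum, vDen, cFill] s s' ∧
    s' vNum 0 = (ratioMin (capacity n p y) (fun j => |y j|) i).1 ∧
    s' vDen 0 = (ratioMin (capacity n p y) (fun j => |y j|) i).2) hM.items ?_ ?_ ?_ ?_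
    fun s' h => h
  · rintro i s3 s4 hf ⟨g1, g2, g3⟩
    rw [hf vNum (by decide), hf vDen (by decide)]
    exact ⟨g1.trans (hf.mono (by simp)), g2, g3⟩
  · exact ⟨hf2, h21, h22⟩
  · rintro i s' - ⟨hf, -⟩
    exact hI.eval_m (by rw [hf 0 (by decide), hs])
  · rintro j s' hj ⟨hf, g1, g2⟩ hcj
    have hcap : ∀ s'', Frame [vNum, vDen, cFill] s s'' → s'' cFill 0 = j →
        capacityE.eval s'' = capacity n p y j := by
      intro s'' hf hcj
      have hs'' : s'' 0 = inp := by rw [hf 0 (by decide), hs]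
      have e1 := hp _ ((hd j hj).second_lt hD) j hj
      have e2 := hp _ ((hd j hj).top_spec hD).1 j hj
      push_cast at e1 e2
      simp only [capacityE, eval_add, eval_mul, eval_leq, eval_zero, eval_read, eval_var, hcj,
        hf aVec (by decide), hvec j hj, hf aShare (by decide), hf aTop (by decide),
        hf aSecond (by decide), ht.1 j hj, ht.2 j hj, hI.eval_m hs'', eval_sub, eval_one,
        e1, e2, capacity]
      split_ifs <;> simp
    have habs : ∀ s'', Frame [vNum, vDen, cFill] s s'' → s'' cFill 0 = j →
        absE.eval s'' = |y j| := by
      intro s'' hf hcj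
      simp only [absE, eval_mul, eval_leq, eval_zero, eval_read, eval_var, hcj,
        hf aVec (by decide), hvec j hj, eval_sub, eval_one, eval_ofNat]
      split_ifs with h
      · rw [abs_of_nonneg h]; ring
      · rw [abs_of_neg (by omega)]; ring
    have hcapM : |capacity n p y j| ≤ (M : ℤ) := by
      have hDM' : (D : ℤ) ≤ M := by exact_mod_cast hDM
      unfold capacity
      split_ifs
      · have h1 := (hd j hj).1 _ ((hd j hj).second_lt hD)
        have h2 := (hd j hj).le ((hd j hj).second_lt hD)
        rw [abs_of_nonneg h1]; omega
      · have h1 := (hd j hj).1 _ ((hd j hj).top_spec hD).1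
        have h2 := (hd j hj).le ((hd j hj).top_spec hD).1
        rw [abs_of_nonneg h1]; omega
    have hcond : (leq (capacityE * var vDen + 1) (var vNum * absE)).eval s' =
        if capacity n p y j * (ratioMin (capacity n p y) (fun j => |y j|) j).2 + 1 ≤
          (ratioMin (capacity n p y) (fun j => |y j|) j).1 * |y j| then 1 else 0 := by
      simp only [eval_leq, eval_add, eval_mul, hcap s' hf hcj, habs s' hf hcj, eval_var, g1, g2,
        eval_one]
    refine Halts.cond ?_ ?_
    · intro hne
      rw [hcond] at hne
      have hc : capacity n p y j * (ratioMin (capacity n p y) (fun j => |y j|) j).2 + 1 ≤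
          (ratioMin (capacity n p y) (fun j => |y j|) j).1 * |y j| := by
        by_contra hc
        simp only [hc, if_false] at hne
        exact hne rfl
      refine Halts.seq (R := fun s'' => Frame [vNum, vDen, cFill] s s'' ∧ s'' cFill 0 = j ∧
        s'' vNum 0 = capacity n p y j) (.assign (by rw [hcap s' hf hcj]; exact hcapM)
        ⟨hf.trans ((Frame.write _ _ _ _).mono (by simp)), ?_, ?_⟩) ?_
      · rw [Store.write_of_ne _ (by decide), hcj]
      · rw [hcap s' hf hcj]; simp
      rintro s'' ⟨hf', hcj', k1⟩
      refine .assign ?_ ⟨?_, hf'.trans ((Frame.write _ _ _ _).mono (by simp)), ?_, ?_⟩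
      · rw [habs s'' hf' hcj', abs_abs]
        exact (hy j hj).trans (by exact_mod_cast hM.vec)
      · rw [Store.write_of_ne _ (by decide), hcj']
      · rw [Store.write_of_ne _ (by decide), k1, ratioMin, if_pos hc]
      · rw [habs s'' hf' hcj', ratioMin, if_pos hc]; simp
    · intro he
      rw [hcond] at he
      have hc : ¬ capacity n p y j * (ratioMin (capacity n p y) (fun j => |y j|) j).2 + 1 ≤
          (ratioMin (capacity n p y) (fun j => |y j|) j).1 * |y j| := by
        intro hc
        simp only [hc, if_true] at he
        exact one_ne_zero he
      refine .nop ⟨hcj, hf, ?_⟩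
      rw [ratioMin, if_neg hc]
      exact ⟨g1, g2⟩

theorem halts_moveP (hI : IsInput n m l V v inp) (hM : IsBig M n m l V) (hs : s 0 = inp)
    {D : ℕ} (hDM : D ≤ M) {p : ℕ → ℕ → ℤ} (hp : HasShares n m s p)
    (ht : HasTops n m s p) (hvec : HasVec m s y)
    (hd : ∀ j < m, IsDistr n D (moved n m p y) j) (h1 : s vNum 0 = (stepLen n m p y).1)
    (h2 : s vDen 0 = (stepLen n m p y).2) :
    Halts M moveP (n * m * 4 + 2) s fun s' => Frame [aShare, cFill] s s' ∧
      HasShares n m s' (moved n m p y) := by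
  refine Halts.fillE (n * m) (fun c => moved n m p y (c / m) (c % m))
    (by have := hM.nm; omega) (by decide) ?_ ?_ ?_ ?_
  · intro s' hf
    have hs' : s' 0 = inp := by rw [hf 0 (by decide), hs]
    simp [hI.eval_n hs', hI.eval_m hs']
  · intro c hc
    have hd := hd _ (mod_lt_of_lt_mul hc)
    rw [abs_of_nonneg (hd.1 _ (div_lt_of_lt_mul' hc))]
    exact (hd.le (div_lt_of_lt_mul' hc)).trans (by exact_mod_cast hDM)
  · intro c hc s' hf hci hkeep
    have hs' : s' 0 = inp := by rw [hf 0 (by decide), hs]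
    have hj := mod_lt_of_lt_mul hc
    have e1 := eval_mod (e := var cFill) (by simpa using hci) (hI.eval_m hs')
    have e2 : (var cFill / mE).eval s' = ((c / m : ℕ) : ℤ) := by
      rw [eval_div, eval_var, hci, hI.eval_m hs']; norm_cast
    have e3 : s aShare c = p (c / m) (c % m) := by
      rw [← hp _ (div_lt_of_lt_mul' hc) _ hj, Nat.div_add_mod']
    rw [eval_add, eval_mul, eval_swapE (p := p) (n := n) e2 e1
      (by rw [hf aTop (by decide), ht.1 _ hj]) (by rw [hf aSecond (by decide), ht.2 _ hj])]
    simp only [eval_read, eval_mul, eval_div, eval_var, hci, hkeep, e3, e1, hf aVec (by decide),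
      hvec _ hj, hf vNum (by decide), hf vDen (by decide), h1, h2, moved]
  · intro s' hf hc
    refine ⟨hf, fun a ha j hj => ?_⟩
    rw [hc _ (mul_add_lt_mul ha hj), mul_add_div' _ hj, mul_add_mod'' _ hj]

theorem halts_clearP (hI : IsInput n m l V v inp) (hM : IsBig M n m l V) (hs : s 0 = inp) :
    Halts M clearP (m * 4 + 2) s fun s' => Frame [aVec, cFill] s s' ∧ HasVec m s' fun _ => 0 := by
  refine Halts.fillE m (fun _ => 0) hM.items (by decide) ?_ (by simp) (by simp)
    fun s' hf h => ⟨hf, h⟩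
  intro s' hf
  exact hI.eval_m (by rw [hf 0 (by decide), hs])

/-- The vector `y` is almost annihilated by `X`. -/
def Passes (R m : ℕ) (X : ℕ → ℕ → ℤ) (y : ℕ → ℤ) : Prop :=
  (∑ r ∈ range R, mulY X m y r ^ 2) * m < ∑ j ∈ range m, y j ^ 2

/-- A bound for the number of steps of `iterP`. -/
def iterSteps (n m l : ℕ) : ℕ :=
  (n * (n * l) * (m * 3 + 6) + 2) + ((n * (n * l) * 3 + 3) + ((m * 3 + 3) +
    (1 + ((m * 6 + 4) + ((n * m * 4 + 2) + (m * 4 + 2))) + (m * (n * (n * l) * 3 + 6) + 2))))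

/-- The arrays changed by `iterP`. -/
abbrev iterArrays : List ℕ :=
  [aShare, aVec, aImage, vAcc, vNormImage, vNorm, vNum, vDen, cFill, cInner]

/-- The data for a move are required only if `y` passes the test. So the lemma also covers the idle
iterations after a move, when the tables of top and second agents are outdated. -/
theorem halts_iterP (hI : IsInput n m l V v inp) (hM : IsBig M n m l V) (hs : s 0 = inp)
    (hmat : HasMat (n * (n * l)) m s X) (hvec : HasVec m s y)
    (hX : ∀ r < n * (n * l), ∀ j < m, |X r j| ≤ scale n m)
    (hy : ∑ j ∈ range m, y j ^ 2 ≤ (vecBound n m l : ℤ) ^ 2)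
    (hnext : ∀ j < m, |descend X (n * (n * l)) m (lip n m l) y 1 j| ≤ vecBound n m l)
    {D : ℕ} (hD : 0 < D) (hDM : D ≤ M) {p : ℕ → ℕ → ℤ}
    (hpass : Passes (n * (n * l)) m X y → HasShares n m s p ∧ (∀ j < m, IsDistr n D p j) ∧
      HasTops n m s p ∧ ∀ j < m, IsDistr n D (moved n m p y) j) :
    Halts M iterP (iterSteps n m l) s fun s' => Frame iterArrays s s' ∧
      ((Passes (n * (n * l)) m X y ∧ HasShares n m s' (moved n m p y) ∧ HasVec m s' fun _ => 0) ∨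
       (¬ Passes (n * (n * l)) m X y ∧ s' aShare = s aShare ∧
          HasVec m s' (descend X (n * (n * l)) m (lip n m l) y 1))) := by
  have hy1 : ∀ j < m, |y j| ≤ vecBound n m l := fun j hj => abs_le_of_sum_sq_le hy hj
  refine Halts.seq (halts_imageP hI hM hs hmat hvec hX hy1) ?_
  rintro s1 ⟨hf1, him1⟩
  have hs1 : s1 0 = inp := by rw [hf1 0 (by decide), hs]
  refine Halts.seq (R := fun s' => Frame [vNormImage, cFill] s1 s' ∧
    s' vNormImage 0 = ∑ r ∈ range (n * (n * l)), mulY X m y r ^ 2) (Halts.sumP (n * (n * l))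
    (fun r => mulY X m y r ^ 2) hM.rows (by decide) ?_ ?_ ?_ fun s' hf h => ⟨hf, h⟩) ?_
  · intro s' hf
    have hs' : s' 0 = inp := by rw [hf 0 (by decide), hs1]
    simp [hI.eval_n hs', hI.eval_d hs']
  · intro r hr s' hf hc
    simp [hc, hf aImage (by decide), him1 r hr, sq]
  · intro i hi
    refine (abs_sum_range_le (C := (m * (scale n m * vecBound n m l)) ^ 2) (fun r hr => ?_) hi).trans
      (by exact_mod_cast hM.image_sq)
    rw [abs_pow]
    exact_mod_cast pow_le_pow_left₀ (abs_nonneg _) (abs_mulY_le hX hy1 hr) 2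
  rintro s2 ⟨hf2, hn2⟩
  have hs2 : s2 0 = inp := by rw [hf2 0 (by decide), hs1]
  refine Halts.seq (R := fun s' => Frame [vNorm, cFill] s2 s' ∧
    s' vNorm 0 = ∑ j ∈ range m, y j ^ 2) (Halts.sumP m
    (fun j => y j ^ 2) hM.items (by decide) ?_ ?_ ?_ fun s' hf h => ⟨hf, h⟩) ?_
  · intro s' hf
    exact hI.eval_m (by rw [hf 0 (by decide), hs2])
  · intro j hj s' hf hc
    simp [hc, hf aVec (by decide), hf2 aVec (by decide), hf1 aVec (by decide), hvec j hj, sq]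
  · intro i hi
    rw [abs_of_nonneg (sum_nonneg fun _ _ => sq_nonneg _)]
    refine (sum_le_sum_of_subset_of_nonneg (range_mono hi) fun _ _ _ => sq_nonneg _).trans
      (hy.trans (by exact_mod_cast hM.vec_sq))
  rintro s3 ⟨hf3, hn3⟩
  have hs3 : s3 0 = inp := by rw [hf3 0 (by decide), hs2]
  have hf : Frame [aImage, vAcc, vNormImage, vNorm, cFill, cInner] s s3 :=
    ((hf1.mono (by simp)).trans (hf2.mono (by simp))).trans (hf3.mono (by simp))
  have hvec3 : HasVec m s3 y := fun j hj => by rw [hf aVec (by decide), hvec j hj]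
  have hcond : (leq (var vNormImage * mE + 1) (var vNorm)).eval s3 =
      if (∑ r ∈ range (n * (n * l)), mulY X m y r ^ 2) * m + 1 ≤ ∑ j ∈ range m, y j ^ 2
        then 1 else 0 := by
    simp only [eval_leq, eval_add, eval_mul, eval_var, hI.eval_m hs3, hn3,
      hf3 vNormImage (by decide), hn2, eval_one]
  refine Halts.cond ?_ ?_
  · intro hne
    have hP : Passes (n * (n * l)) m X y := by
      rw [hcond] at hne
      by_contra hc
      rw [if_neg (by unfold Passes at hc; omega)] at hne
      exact hne rfl
    obtain ⟨hp, hd, ht, hd'⟩ := hpass hP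
    have ht3 : HasTops n m s3 p := by
      unfold HasTops
      rw [hf aTop (by decide), hf aSecond (by decide)]
      exact ht
    refine Halts.seq (halts_ratioP hI hM hs3 hD hDM (hp.frame (hf aShare (by decide))) hd ht3
      hvec3 hy1) ?_
    rintro s4 ⟨hf4, h41, h42⟩
    have hs4 : s4 0 = inp := by rw [hf4 0 (by decide), hs3]
    refine Halts.seq (halts_moveP hI hM hs4 hDM (p := p) (y := y)
      (hp.frame (by rw [hf4 aShare (by decide), hf aShare (by decide)])) ?_ ?_ hd' h41 h42) ?_
    · unfold HasTops
      rw [hf4 aTop (by decide), hf4 aSecond (by decide)]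
      exact ht3
    · unfold HasVec
      rw [hf4 aVec (by decide)]
      exact hvec3
    rintro s5 ⟨hf5, hp5⟩
    have hs5 : s5 0 = inp := by rw [hf5 0 (by decide), hs4]
    refine (halts_clearP hI hM hs5).mono le_rfl ?_
    rintro s6 ⟨hf6, h6⟩
    refine ⟨?_, Or.inl ⟨hP, hp5.frame (hf6 aShare (by decide)), h6⟩⟩
    exact (((hf.mono (by simp)).trans (hf4.mono (by simp))).trans (hf5.mono (by simp))).trans
      (hf6.mono (by simp))
  · intro he
    have hP : ¬ Passes (n * (n * l)) m X y := by
      intro hP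
      rw [hcond, if_pos (by unfold Passes at hP; omega)] at he
      exact one_ne_zero he
    refine (halts_descendP hI hM hs3 (X := X) (y := y) ?_ hvec3 ?_ hX hy1 hnext).mono le_rfl ?_
    · unfold HasMat
      rw [hf aMat (by decide)]
      exact hmat
    · rw [hf3 aImage (by decide), hf2 aImage (by decide)]
      exact him1
    rintro s4 ⟨hf4, h4⟩
    refine ⟨(hf.mono (by simp)).trans (hf4.mono (by simp)), Or.inr ⟨hP, ?_, h4⟩⟩
    rw [hf4 aShare (by decide), hf aShare (by decide)]

/-- The descent for item `j₀` reaches an almost annihilated vector. -/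
def CanStep (n m l : ℕ) (w p : ℕ → ℕ → ℤ) (j₀ : ℕ) : Prop :=
  ∃ k < iters n m l, Passes (n * (n * l)) m (swapMat n (n * l) w p)
    (descend (swapMat n (n * l) w p) (n * (n * l)) m (lip n m l) (startVec n p j₀) k)

/-- A bound for the number of steps of `itemP`. -/
def itemSteps (n m l : ℕ) : ℕ :=
  (m * (n * 6 + 7) + 2) + ((m * (n * 6 + 7) + 2) + ((n * (n * l) * m * 4 + 2) +
    ((m * 4 + 2) + (iters n m l * (iterSteps n m l + 2) + 2))))

/-- The arrays changed by `itemP`. -/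
abbrev itemArrays : List ℕ :=
  [aShare, aTop, aSecond, aMat, aVec, aImage, vBest, vMax, vAcc, vNormImage, vNorm, vNum, vDen,
    cIter, cFill, cInner]

theorem lip_pos (hI : IsInput n m l V v inp) : 0 < lip n m l := by
  have := hI.n_pos; have := hI.m_pos; have := hI.l_pos
  unfold lip scale
  positivity

theorem halts_itemP (hI : IsInput n m l V v inp) (hM : IsBig M n m l V) (hs : s 0 = inp)
    {D : ℕ} (hD : 0 < D) (hDM : D ≤ M) {w p : ℕ → ℕ → ℤ} (hp : HasShares n m s p)
    (hd : ∀ j < m, IsDistr n D p j) (hw : HasWeights n m l s w)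
    (hsm : SmallOn n m (n * l) (scale n m) w p) {j₀ : ℕ} (hj₀ : s cItem 0 = j₀) :
    Halts M itemP (itemSteps n m l) s fun s' => Frame itemArrays s s' ∧
      ∃ p', HasShares n m s' p' ∧
        ((p' = p ∧ ¬ CanStep n m l w p j₀) ∨ IsStep n m (n * l) D (scale n m) w p p') := by
  refine Halts.seq (halts_topP hI hM hs hp hD hDM hd (Or.inl rfl)) ?_
  rintro s1 ⟨hf1, ht1⟩
  have hs1 : s1 0 = inp := by rw [hf1 0 (by decide), hs]
  refine Halts.seq (halts_secondP hI hM hs1 (hp.frame (hf1 aShare (by decide))) hD hDM hd ht1) ?_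
  rintro s2 ⟨hf2, hse2⟩
  have hs2 : s2 0 = inp := by rw [hf2 0 (by decide), hs1]
  have ht2 : ∀ j < m, s2 aTop j = top n p j := by rw [hf2 aTop (by decide)]; exact ht1
  refine Halts.seq (halts_matP hI hM hs2 (w := w) (p := p) ?_ hsm ht2 hse2) ?_
  · unfold HasWeights
    rw [hf2 aWeight (by decide), hf1 aWeight (by decide)]
    exact hw
  rintro s3 ⟨hf3, hmat3⟩
  have hs3 : s3 0 = inp := by rw [hf3 0 (by decide), hs2]
  refine Halts.seq (halts_startP hI hM hs3 (p := p) (j₀ := j₀) ?_ ?_ ?_) ?_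
  · rw [hf3 cItem (by decide), hf2 cItem (by decide), hf1 cItem (by decide), hj₀]
  · rw [hf3 aTop (by decide)]; exact ht2
  · rw [hf3 aSecond (by decide)]; exact hse2
  rintro s4 ⟨hf4, hvec4⟩
  have hs4 : s4 0 = inp := by rw [hf4 0 (by decide), hs3]
  have hf : Frame itemArrays s s4 :=
    (((hf1.mono (by simp)).trans (hf2.mono (by simp))).trans (hf3.mono (by simp))).trans
      (hf4.mono (by simp))
  have hp4 : HasShares n m s4 p := hp.frame (by
    rw [hf4 aShare (by decide), hf3 aShare (by decide), hf2 aShare (by decide),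
      hf1 aShare (by decide)])
  have ht4 : HasTops n m s4 p := by
    unfold HasTops
    rw [hf4 aTop (by decide), hf4 aSecond (by decide), hf3 aTop (by decide),
      hf3 aSecond (by decide)]
    exact ⟨ht2, hse2⟩
  have hmat4 : HasMat (n * (n * l)) m s4 (swapMat n (n * l) w p) := by
    unfold HasMat
    rw [hf4 aMat (by decide)]
    exact hmat3
  set X := swapMat n (n * l) w p with hXdef
  have hX : ∀ r < n * (n * l), ∀ j < m, |X r j| ≤ scale n m := fun r hr j hj =>
    hsm.abs_swapMat_le hr hj
  set y : ℕ → ℕ → ℤ := descend X (n * (n * l)) m (lip n m l) (startVec n p j₀) with hydef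
  have hL : ∑ j ∈ range m, ∑ r ∈ range (n * (n * l)), X r j ^ 2 ≤ (lip n m l : ℤ) := hsm.sum_sq_le
  have hy0 : ∑ j ∈ range m, startVec n p j₀ j ^ 2 ≤ 1 := by
    calc _ ≤ ∑ j ∈ range m, if j = j₀ then (1 : ℤ) else 0 := sum_le_sum fun j _ => by
          unfold startVec; split_ifs <;> simp
      _ ≤ 1 := by rw [sum_ite_eq']; split_ifs <;> simp
  have hyb : ∀ k ≤ iters n m l, ∑ j ∈ range m, y k j ^ 2 ≤ (vecBound n m l : ℤ) ^ 2 := by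
    intro k hk
    refine (descend_bound X hL hy0 k).trans ?_
    have : lip n m l ^ k ≤ vecBound n m l := Nat.pow_le_pow_right (lip_pos hI) hk
    exact pow_le_pow_left₀ (by positivity) (by exact_mod_cast this) 2
  -- Settled items have zero columns and start with entry zero, so the descent never reaches them.
  have hzero : ∀ k, ∀ j < m, second n p j = top n p j → y k j = 0 := by
    intro k j hj hst
    refine descend_eq_zero (fun r _ => ?_) (by simp [startVec, hst]) k
    simp [hXdef, swapMat, swapDir_eq_zero hst]
  -- Either all earlier iterates failed and memory holds the `k`-th one, or a step has been made and
  -- the vector is zero.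
  refine Halts.forP (k := iterSteps n m l) (iters n m l) (fun k s' => Frame itemArrays s s' ∧
    Frame (cIter :: iterArrays) s4 s' ∧
    ∃ p', HasShares n m s' p' ∧ ((p' = p ∧ HasVec m s' (y k) ∧
        ∀ k' < k, ¬ Passes (n * (n * l)) m X (y k')) ∨
      (IsStep n m (n * l) D (scale n m) w p p' ∧ HasVec m s' fun _ => 0))) hM.iters ?_ ?_ ?_ ?_ ?_
  · rintro k s5 s6 hf56 ⟨g1, g2, p', g3, g4⟩
    have e : s6 aShare = s5 aShare := hf56 _ (by decide)
    have e' : s6 aVec = s5 aVec := hf56 _ (by decide)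
    unfold HasVec at g4 ⊢
    rw [e']
    exact ⟨g1.trans (hf56.mono (by simp)), g2.trans (hf56.mono (by simp)), p', g3.frame e, g4⟩
  · exact ⟨hf, Frame.refl _ _, p, hp4, Or.inl ⟨rfl, hvec4, by simp⟩⟩
  · rintro k s' - ⟨hf', -⟩
    exact hI.eval_iter (by rw [hf' 0 (by decide), hs])
  · rintro k s' hk ⟨g1, g2, p', g3, g4⟩ hck
    have hs' : s' 0 = inp := by rw [g1 0 (by decide), hs]
    have hmat' : HasMat (n * (n * l)) m s' X := by
      unfold HasMat
      rw [g2 aMat (by decide)]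
      exact hmat4
    rcases g4 with ⟨rfl, hv, hno⟩ | ⟨hst, hv⟩
    · have ht' : HasTops n m s' p' := by
        unfold HasTops
        rw [g2 aTop (by decide), g2 aSecond (by decide)]
        exact ht4
      have hstep : Passes (n * (n * l)) m X (y k) →
          IsStep n m (n * l) D (scale n m) w p' (moved n m p' (y k)) := fun hP =>
        isStep_moved hD hd hsm (hzero k) hP
      refine (halts_iterP hI hM hs' hmat' hv hX (hyb k hk.le)
        (fun j hj => abs_le_of_sum_sq_le (hyb (k + 1) hk) hj) hD hDM
        fun hP => ⟨g3, hd, ht', (hstep hP).distr⟩).mono le_rfl ?_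
      rintro s'' ⟨hf'', h''⟩
      refine ⟨by rw [hf'' cIter (by decide), hck], g1.trans (hf''.mono (by simp)),
        g2.trans (hf''.mono (by simp)), ?_⟩
      rcases h'' with ⟨hP, k1, k2⟩ | ⟨hP, k1, k2⟩
      · exact ⟨_, k1, Or.inr ⟨hstep hP, k2⟩⟩
      · refine ⟨p', g3.frame k1, Or.inl ⟨rfl, k2, fun k' hk' => ?_⟩⟩
        rcases Nat.lt_succ_iff_lt_or_eq.mp hk' with h | rfl
        · exact hno k' h
        · exact hP
    · have hnP : ¬ Passes (n * (n * l)) m X fun _ => 0 := by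
        simp [Passes, mulY]
      have hnext : descend X (n * (n * l)) m (lip n m l) (fun _ => 0) 1 = fun _ => 0 := by
        funext j; simp [descend, mulY]
      refine (halts_iterP hI hM hs' hmat' hv hX (by simp)
        (fun j hj => by rw [hnext]; simp) hD hDM (p := p') fun hP => (hnP hP).elim).mono le_rfl ?_
      rintro s'' ⟨hf'', h''⟩
      refine ⟨by rw [hf'' cIter (by decide), hck], g1.trans (hf''.mono (by simp)),
        g2.trans (hf''.mono (by simp)), ?_⟩
      rcases h'' with ⟨hP, -⟩ | ⟨-, k1, k2⟩
      · exact (hnP hP).elim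
      · rw [hnext] at k2
        exact ⟨p', g3.frame k1, Or.inr ⟨hst, k2⟩⟩
  · rintro s' ⟨g1, -, p', g3, g4⟩
    refine ⟨g1, p', g3, ?_⟩
    rcases g4 with ⟨h1, -, h2⟩ | ⟨h1, -⟩
    · left
      refine ⟨h1, ?_⟩
      rintro ⟨k, hk, hP⟩
      exact h2 k hk hP
    · exact Or.inr h1

end

/-! ### Correctness of the program: rounds and final allocation -/

section
variable {M n m l V : ℕ} {v : ℕ → ℕ → ℕ} {inp : ℤ → ℤ} {s : Store}

/-- At the largest entry of a kernel vector the item is unsettled, so the start vector is the unit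
vector that `exists_descend_lt` needs. -/
theorem exists_canStep (hI : IsInput n m l V v inp) {D : ℕ} (hD : 0 < D) {w p : ℕ → ℕ → ℤ}
    (hd : ∀ j < m, IsDistr n D p j) (hsm : SmallOn n m (n * l) (scale n m) w p)
    (hF : (n - 1) * (n * l) < (unsettled n m p).card) : ∃ j₀ < m, CanStep n m l w p j₀ := by
  obtain ⟨u, j₀, hj₀, hmax, hne, hst, hu⟩ := exists_kernel (w := w) hD hd hF
  obtain ⟨k, hk, hP⟩ := exists_descend_lt (swapMat n (n * l) w p) (lip_pos hI) hsm.sum_sq_le hj₀ hmax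
    hne hu (y := startVec n p j₀) (by
      intro j hj
      unfold startVec
      by_cases h : j = j₀
      · subst h; simp [hst]
      · simp [h])
  exact ⟨j₀, hj₀, k, hk, hP⟩

/-- A bound for the number of steps of the rounding procedure. -/
def roundSteps (n m l : ℕ) : ℕ := (n * m + 1) * ((m * (itemSteps n m l + 2) + 2) + 2) + 2

/-- The arrays changed by the rounding procedure. -/
abbrev roundArrays : List ℕ := cRound :: cItem :: itemArrays

theorem halts_rounds (hI : IsInput n m l V v inp) (hM : IsBig M n m l V) (hs : s 0 = inp)
    {τ h : ℕ → ℕ} (H : IsPick m (n * n * l) (n * l * (n * n * l)) v τ h)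
    (hp : HasShares n m s (initShare n m l τ)) (hw : HasWeights n m l s (scaled n m v h)) :
    Halts M (forP cRound (nE * mE + 1) (forP cItem mE itemP)) (roundSteps n m l) s fun s' =>
      Frame roundArrays s s' ∧ ∃ p, HasShares n m s' p ∧
        IsNear n m (n * l) (n * unit m) (scale n m) (scaled n m v h) (initShare n m l τ) p ∧
        (unsettled n m p).card ≤ (n - 1) * (n * l) := by
  have hn0 := hI.n_pos
  have hm0 := hI.m_pos
  have hl0 := hI.l_pos
  have hD : 0 < n * unit m := by simp only [unit]; positivity
  set Near := IsNear n m (n * l) (n * unit m) (scale n m) (scaled n m v h) (initShare n m l τ)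
    with hNear
  refine Halts.forP (k := m * (itemSteps n m l + 2) + 2) (n * m + 1) (fun t s' =>
    Frame roundArrays s s' ∧ ∃ p, HasShares n m s' p ∧ Near p ∧
      ((unsettled n m p).card ≤ (n - 1) * (n * l) ∨ t ≤ zeros n m p)) hM.nm ?_ ?_ ?_ ?_ ?_
  · rintro t s1 s2 hf ⟨g1, p, g2, g3⟩
    exact ⟨g1.trans (hf.mono (by simp)), p, g2.frame (hf aShare (by decide)), g3⟩
  · exact ⟨Frame.refl _ _, _, hp, isNear_initShare _ _ _ H, Or.inr (Nat.zero_le _)⟩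
  · rintro t s' - ⟨g1, -⟩
    have hs' : s' 0 = inp := by rw [g1 0 (by decide), hs]
    simp [hI.eval_n hs', hI.eval_m hs']
  · rintro t s' - ⟨g1, p, g2, g3, g4⟩ hct
    -- As long as nothing has moved, all failed trials concern the same shares `p`; a round without
    -- any move thus refutes `exists_canStep`.
    refine Halts.forP (k := itemSteps n m l) m (fun j₀ s'' => Frame roundArrays s s'' ∧
      s'' cRound 0 = t ∧ ∃ p', HasShares n m s'' p' ∧ Near p' ∧
        unsettled n m p' ⊆ unsettled n m p ∧
        ((p' = p ∧ ∀ j < j₀, ¬ CanStep n m l (scaled n m v h) p j) ∨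
          zeros n m p + 1 ≤ zeros n m p')) hM.items ?_ ?_ ?_ ?_ ?_
    · rintro j₀ s1 s2 hf ⟨k1, k2, p', k3, k4⟩
      exact ⟨k1.trans (hf.mono (by simp)), by rw [hf cRound (by decide), k2], p',
        k3.frame (hf aShare (by decide)), k4⟩
    · exact ⟨g1, hct, p, g2, g3, Subset.rfl, Or.inl ⟨rfl, by simp⟩⟩
    · rintro j₀ s1 - ⟨k1, -⟩
      exact hI.eval_m (by rw [k1 0 (by decide), hs])
    · rintro j₀ s1 hj₀ ⟨k1, k2, p', k3, k4, k5, k6⟩ hcj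
      have hsm : SmallOn n m (n * l) (scale n m) (scaled n m v h) p' :=
        smallOn_scaled hD (by positivity) H k4
      have hw1 : HasWeights n m l s1 (scaled n m v h) := by
        unfold HasWeights
        rw [k1 aWeight (by decide)]
        exact hw
      refine (halts_itemP hI hM (by rw [k1 0 (by decide), hs]) hD hM.unit k3 k4.distr hw1 hsm
        hcj).mono le_rfl ?_
      rintro s2 ⟨hf2, p'', hp'', hc⟩
      refine ⟨by rw [hf2 cItem (by decide), hcj], k1.trans (hf2.mono (by simp)),
        by rw [hf2 cRound (by decide), k2], p'', hp'', ?_⟩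
      rcases hc with ⟨rfl, hno⟩ | hst
      · refine ⟨k4, k5, ?_⟩
        rcases k6 with ⟨rfl, h6⟩ | h6
        · left
          refine ⟨rfl, fun j hj => ?_⟩
          rcases Nat.lt_succ_iff_lt_or_eq.mp hj with h' | rfl
          · exact h6 j h'
          · exact hno
        · exact Or.inr h6
      · refine ⟨k4.step hst, (unsettled_subset_of_step hD k4.distr hst).trans k5, Or.inr ?_⟩
        have := hst.zeros_lt
        rcases k6 with ⟨rfl, -⟩ | h6 <;> omega
    · rintro s1 ⟨k1, k2, p', k3, k4, k5, k6⟩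
      refine ⟨k2, k1, p', k3, k4, ?_⟩
      by_cases hF : (unsettled n m p').card ≤ (n - 1) * (n * l)
      · exact Or.inl hF
      · right
        have hF' : ¬ (unsettled n m p).card ≤ (n - 1) * (n * l) := fun h' =>
          hF ((card_le_card k5).trans h')
        have ht : t ≤ zeros n m p := g4.resolve_left hF'
        rcases k6 with ⟨rfl, h6⟩ | h6
        · obtain ⟨j₀, hj₀, hc⟩ := exists_canStep hI hD k4.distr
            (smallOn_scaled hD (by positivity) H k4) (not_le.mp hF)
          exact (h6 j₀ hj₀ hc).elim
        · omega
  · rintro s' ⟨g1, p, g2, g3, g4⟩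
    -- The alternative would give `n * m + 1` zeros among `n * m` shares.
    refine ⟨g1, p, g2, g3, g4.resolve_right ?_⟩
    have := zeros_le n m p
    omega

/-- A bound for the number of steps of `mainP`. -/
def mainSteps (n m l : ℕ) : ℕ :=
  (n * l * (n * n * l) * (m * 6 + 11) + 2) + ((n * m * 4 + 2) + ((n * l * m * 4 + 2) +
    (roundSteps n m l + (m * (n * 6 + 7) + 2))))

theorem halts_mainP (hI : IsInput n m l V v inp) (hM : IsBig M n m l V) (hs : s 0 = inp)
    (h3 : s aTurn = 0) (h4 : s aPrice = 0) :
    Halts M mainP (mainSteps n m l) s fun s' => ∃ τ h p,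
      IsPick m (n * n * l) (n * l * (n * n * l)) v τ h ∧
      IsNear n m (n * l) (n * unit m) (scale n m) (scaled n m v h) (initShare n m l τ) p ∧
      (unsettled n m p).card ≤ (n - 1) * (n * l) ∧ ∀ j < m, s' aOut j = top n p j := by
  have hn0 := hI.n_pos
  have hm0 := hI.m_pos
  have hD : 0 < n * unit m := by simp only [unit]; positivity
  refine Halts.seq (halts_pickP hI hM hs h3 h4) ?_
  rintro s1 ⟨hf1, τ, h, h11, h12, H⟩
  have hs1 : s1 0 = inp := by rw [hf1 0 (by decide), hs]
  refine Halts.seq (halts_initShareP hI hM hs1 h11 H) ?_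
  rintro s2 ⟨hf2, hp2⟩
  have hs2 : s2 0 = inp := by rw [hf2 0 (by decide), hs1]
  refine Halts.seq (halts_scaledP hI hM hs2 (h := h)
    (by rw [hf2 aPrice (by decide)]; exact h12)) ?_
  rintro s3 ⟨hf3, hw3⟩
  have hs3 : s3 0 = inp := by rw [hf3 0 (by decide), hs2]
  refine Halts.seq (halts_rounds hI hM hs3 H (hp2.frame (hf3 aShare (by decide))) hw3) ?_
  rintro s4 ⟨hf4, p, hp4, hn4, hF4⟩
  refine (halts_topP hI hM (by rw [hf4 0 (by decide), hs3]) hp4 hD hM.unit hn4.distr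
    (Or.inr rfl)).mono le_rfl ?_
  rintro s5 ⟨-, h5⟩
  exact ⟨τ, h, p, H, hn4, hF4, h5⟩

end

/-! ### Polynomial bounds -/

/-- `f` is bounded by a polynomial. -/
def PolyBdd (f : ℕ → ℕ) : Prop := ∃ q : Polynomial ℕ, ∀ x, f x ≤ q.eval x

/-- `f` is bounded by an exponential of a polynomial. -/
def ExpBdd (f : ℕ → ℕ) : Prop := ∃ q : Polynomial ℕ, ∀ x, f x ≤ 2 ^ q.eval x

theorem PolyBdd.const (c : ℕ) : PolyBdd fun _ => c := ⟨Polynomial.C c, by simp⟩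

theorem PolyBdd.id : PolyBdd fun x => x := ⟨Polynomial.X, by simp⟩

theorem PolyBdd.add {f g : ℕ → ℕ} (hf : PolyBdd f) (hg : PolyBdd g) :
    PolyBdd fun x => f x + g x := by
  obtain ⟨p, hp⟩ := hf
  obtain ⟨q, hq⟩ := hg
  exact ⟨p + q, fun x => by rw [Polynomial.eval_add]; exact Nat.add_le_add (hp x) (hq x)⟩

theorem PolyBdd.mul {f g : ℕ → ℕ} (hf : PolyBdd f) (hg : PolyBdd g) :
    PolyBdd fun x => f x * g x := by
  obtain ⟨p, hp⟩ := hf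
  obtain ⟨q, hq⟩ := hg
  exact ⟨p * q, fun x => by rw [Polynomial.eval_mul]; exact Nat.mul_le_mul (hp x) (hq x)⟩

theorem PolyBdd.pow {f : ℕ → ℕ} (hf : PolyBdd f) (k : ℕ) : PolyBdd fun x => f x ^ k := by
  obtain ⟨p, hp⟩ := hf
  exact ⟨p ^ k, fun x => by rw [Polynomial.eval_pow]; exact Nat.pow_le_pow_left (hp x) k⟩

theorem PolyBdd.expBdd {f : ℕ → ℕ} (hf : PolyBdd f) : ExpBdd f := by
  obtain ⟨p, hp⟩ := hf
  exact ⟨p, fun x => (hp x).trans Nat.lt_two_pow_self.le⟩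

theorem ExpBdd.two_pow : ExpBdd fun x => 2 ^ x := ⟨Polynomial.X, by simp⟩

theorem ExpBdd.mul {f g : ℕ → ℕ} (hf : ExpBdd f) (hg : ExpBdd g) : ExpBdd fun x => f x * g x := by
  obtain ⟨p, hp⟩ := hf
  obtain ⟨q, hq⟩ := hg
  exact ⟨p + q, fun x => by
    rw [Polynomial.eval_add, pow_add]; exact Nat.mul_le_mul (hp x) (hq x)⟩

theorem ExpBdd.add {f g : ℕ → ℕ} (hf : ExpBdd f) (hg : ExpBdd g) : ExpBdd fun x => f x + g x := by
  obtain ⟨p, hp⟩ := hf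
  obtain ⟨q, hq⟩ := hg
  refine ⟨p + q + 1, fun x => ?_⟩
  have h1 : 2 ^ p.eval x ≤ 2 ^ (p.eval x + q.eval x) := Nat.pow_le_pow_right (by norm_num) (by omega)
  have h2 : 2 ^ q.eval x ≤ 2 ^ (p.eval x + q.eval x) := Nat.pow_le_pow_right (by norm_num) (by omega)
  have h3 := hp x
  have h4 := hq x
  simp only [Polynomial.eval_add, Polynomial.eval_one]
  rw [pow_succ]
  omega

theorem ExpBdd.pow {f g : ℕ → ℕ} (hf : ExpBdd f) (hg : PolyBdd g) : ExpBdd fun x => f x ^ g x := by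
  obtain ⟨p, hp⟩ := hf
  obtain ⟨q, hq⟩ := hg
  refine ⟨p * q, fun x => ?_⟩
  rw [Polynomial.eval_mul, pow_mul]
  exact (Nat.pow_le_pow_left (hp x) _).trans (Nat.pow_le_pow_right (by positivity) (hq x))

theorem ExpBdd.size {f : ℕ → ℕ} (hf : ExpBdd f) : PolyBdd fun x => (f x).size := by
  obtain ⟨p, hp⟩ := hf
  refine ⟨p + 1, fun x => ?_⟩
  rw [Nat.size_le, Polynomial.eval_add, Polynomial.eval_one, pow_succ]
  have := hp x
  have : 0 < 2 ^ p.eval x := by positivity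
  omega

theorem polyBdd_scale : PolyBdd fun x => scale x x := by
  unfold scale
  exact ((PolyBdd.const 4).mul .id).mul .id

theorem polyBdd_unit : PolyBdd fun x => unit x := by
  unfold unit
  exact ((PolyBdd.const 8).mul .id).mul .id

theorem polyBdd_lip : PolyBdd fun x => lip x x x := by
  unfold lip
  exact ((PolyBdd.id.mul (.mul .id .id)).mul .id).mul (polyBdd_scale.pow 2)

theorem polyBdd_iters : PolyBdd fun x => iters x x x := by
  unfold iters
  exact (polyBdd_lip.mul .id).mul .id

/-- Both `L` and the number of iterations are polynomial because the scaled values do not depend on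
the size of the input values. -/
theorem expBdd_vecBound : ExpBdd fun x => vecBound x x x := by
  unfold vecBound
  exact polyBdd_lip.expBdd.pow polyBdd_iters

theorem polyBdd_mainSteps : PolyBdd fun x => mainSteps x x x := by
  have c := PolyBdd.const
  have i := PolyBdd.id
  have hiter : PolyBdd fun x => iterSteps x x x := by
    unfold iterSteps
    repeat first
      | exact c _
      | exact i
      | refine PolyBdd.add ?_ ?_
      | refine PolyBdd.mul ?_ ?_
  have hitem : PolyBdd fun x => itemSteps x x x := by
    unfold itemSteps
    repeat first
      | exact c _
      | exact i
      | exact hiter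
      | exact polyBdd_iters
      | refine PolyBdd.add ?_ ?_
      | refine PolyBdd.mul ?_ ?_
  unfold mainSteps roundSteps
  repeat first
    | exact c _
    | exact i
    | exact hitem
    | refine PolyBdd.add ?_ ?_
    | refine PolyBdd.mul ?_ ?_

/-- A bound for all numbers that occur for inputs of size `x`. -/
def bigBound (x : ℕ) : ℕ :=
  (2 ^ x + 1) + 2 ^ x * scale x x + x * x * (x * x * x) + (x * x + 1) + x + x * x * x +
    x * (x * x) * x + x * (x * x) + iters x x x + x * unit x + scale x x + vecBound x x x +
    vecBound x x x ^ 2 + x * (scale x x * vecBound x x x) +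
    x * (x * x) * (x * (scale x x * vecBound x x x)) ^ 2 +
    x * (x * x) * (scale x x * (x * (scale x x * vecBound x x x)))

theorem expBdd_bigBound : ExpBdd bigBound := by
  have c := fun a => (PolyBdd.const a).expBdd
  have i := PolyBdd.id.expBdd
  unfold bigBound
  repeat first
    | exact c _
    | exact i
    | exact ExpBdd.two_pow
    | exact polyBdd_scale.expBdd
    | exact polyBdd_unit.expBdd
    | exact polyBdd_iters.expBdd
    | exact expBdd_vecBound
    | refine ExpBdd.pow ?_ (.const 2)
    | refine ExpBdd.add ?_ ?_
    | refine ExpBdd.mul ?_ ?_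

theorem isBig_bigBound (x : ℕ) : IsBig (bigBound x) x x x (2 ^ x) := by
  unfold bigBound
  generalize 2 ^ x = y
  constructor <;> omega

section mono
variable {n m l x : ℕ}

theorem scale_mono (hn : n ≤ x) (hm : m ≤ x) : scale n m ≤ scale x x := by
  unfold scale; gcongr

theorem unit_mono (hm : m ≤ x) : unit m ≤ unit x := by
  unfold unit; gcongr

theorem lip_mono (hn : n ≤ x) (hm : m ≤ x) (hl : l ≤ x) : lip n m l ≤ lip x x x := by
  have := scale_mono hn hm
  unfold lip; gcongr

theorem iters_mono (hn : n ≤ x) (hm : m ≤ x) (hl : l ≤ x) : iters n m l ≤ iters x x x := by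
  have := lip_mono hn hm hl
  unfold iters; gcongr

theorem vecBound_mono (hn : n ≤ x) (hm : m ≤ x) (hl : l ≤ x) (h0 : 0 < lip n m l) :
    vecBound n m l ≤ vecBound x x x :=
  (Nat.pow_le_pow_right h0 (iters_mono hn hm hl)).trans
    (Nat.pow_le_pow_left (lip_mono hn hm hl) _)

theorem mainSteps_mono (hn : n ≤ x) (hm : m ≤ x) (hl : l ≤ x) :
    mainSteps n m l ≤ mainSteps x x x := by
  have h1 := iters_mono hn hm hl
  unfold mainSteps roundSteps itemSteps iterSteps
  gcongr

theorem IsBig.mono {M V : ℕ} (h : IsBig M x x x V) (hn : n ≤ x) (hm : m ≤ x) (hl : l ≤ x)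
    (h0 : 0 < lip n m l) : IsBig M n m l V := by
  have h1 := scale_mono hn hm
  have h2 := unit_mono hm
  have h3 := iters_mono hn hm hl
  have h4 := vecBound_mono hn hm hl h0
  constructor
  · exact h.val
  · exact le_trans (by gcongr) h.wt
  · exact le_trans (by gcongr) h.turns
  · exact le_trans (by gcongr) h.nm
  · exact le_trans (by gcongr) h.items
  · exact le_trans (by gcongr) h.agents
  · exact le_trans (by gcongr) h.nlm
  · exact le_trans (by gcongr) h.mat
  · exact le_trans (by gcongr) h.rows
  · exact le_trans h3 h.iters
  · exact le_trans (by gcongr) h.unit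
  · exact le_trans (by gcongr) h.vec
  · exact le_trans (by gcongr) h.vec_sq
  · exact le_trans (by gcongr) h.image
  · exact le_trans (by gcongr) h.image_sq
  · exact le_trans h1 h.scale_le
  · exact le_trans (by gcongr) h.back

end mono

/-! ### The encoding -/

theorem flatten_ofFn {α : Type*} {a b : ℕ} (f : Fin a → Fin b → α) :
    (List.ofFn fun i => List.ofFn (f i)).flatten =
      List.ofFn fun x : Fin (a * b) => f x.divNat x.modNat := by
  rw [List.ofFn_mul]
  congr 2
  funext i
  congr 1
  funext j
  congr 1
  · ext; simp [Fin.divNat, mul_add_div' _ j.2]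
  · ext; simp [Fin.modNat, Nat.mod_eq_of_lt j.2]

theorem Inst.encode_eq (I : Inst) : I.encode = (I.n : ℤ) :: (I.m : ℤ) :: (I.l : ℤ) ::
    List.ofFn fun x : Fin (I.n * (I.m * I.l)) =>
      (I.val x.divNat x.modNat.divNat x.modNat.modNat : ℤ) := by
  unfold Inst.encode
  simp_rw [flatten_ofFn]

/-- Every listed value has length at least one. If there is an item, this bounds `n`, `m` and `l` by
the input length although they are written in binary. -/
theorem Inst.mul_le_inputSize (I : Inst) : I.n * (I.m * I.l) ≤ inputSize I.encode := by
  have h : ∀ w : List ℤ, w.length ≤ inputSize w := by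
    intro w
    induction w with
    | nil => simp
    | cons z w ih => simp only [inputSize, List.length_cons, List.map_cons, List.sum_cons] at *
                     unfold bitSize at *
                     omega
  have := h I.encode
  rw [I.encode_eq] at this ⊢
  simp only [List.length_cons, List.length_ofFn] at this
  omega

theorem natAbs_le_of_mem {w : List ℤ} {z : ℤ} (h : z ∈ w) : z.natAbs ≤ 2 ^ inputSize w := by
  have h1 : bitSize z ≤ inputSize w := List.le_sum_of_mem (List.mem_map_of_mem h)
  have h2 : z.natAbs < 2 ^ z.natAbs.size := Nat.lt_size_self _
  refine h2.le.trans (Nat.pow_le_pow_right (by norm_num) ?_)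
  unfold bitSize at h1
  omega

theorem bdd_initStore {w : List ℤ} {M : ℕ} (hM : 2 ^ inputSize w ≤ M) : (initStore w).Bdd M := by
  intro a j
  unfold initStore
  split_ifs with h
  · rcases Nat.lt_or_ge j.toNat w.length with hj | hj
    · rw [List.getD_eq_getElem _ _ hj]
      rw [← Int.natCast_natAbs]
      exact_mod_cast (natAbs_le_of_mem (List.getElem_mem hj)).trans hM
    · rw [List.getD_eq_default _ _ hj]; simp
  · simp

/-- The values of an instance, by coordinate and item; coordinate `i * l + k` is dimension `k` of
agent `i`. -/
def Inst.coord (I : Inst) (q j : ℕ) : ℕ :=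
  if h : q / I.l < I.n ∧ j < I.m ∧ q % I.l < I.l then I.val ⟨q / I.l, h.1⟩ ⟨j, h.2.1⟩ ⟨q % I.l, h.2.2⟩
  else 0

theorem Inst.coord_eq (I : Inst) (i : Fin I.n) (j : Fin I.m) (k : Fin I.l) :
    I.coord (i * I.l + k) j = I.val i j k := by
  have h1 : (i * I.l + k : ℕ) / I.l = i := mul_add_div' _ k.2
  have h2 : (i * I.l + k : ℕ) % I.l = k := mul_add_mod'' _ k.2
  unfold Inst.coord
  rw [dif_pos ⟨by rw [h1]; exact i.2, j.2, by rw [h2]; exact k.2⟩]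
  congr 1
  · congr 1
  · exact Fin.ext h2

theorem Inst.initStore_val (I : Inst) (i : Fin I.n) (j : Fin I.m) (k : Fin I.l) :
    initStore I.encode 0 ((3 + (i * I.m + j) * I.l + k : ℕ) : ℤ) = I.val i j k := by
  have hidx : 3 + (i * I.m + j) * I.l + k = (i * (I.m * I.l) + (j * I.l + k)) + 1 + 1 + 1 := by ring
  have hjk : (j * I.l + k : ℕ) < I.m * I.l := mul_add_lt_mul j.2 k.2
  have hlt : i * (I.m * I.l) + (j * I.l + k) < I.n * (I.m * I.l) := mul_add_lt_mul i.2 hjk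
  simp only [initStore, true_and]
  rw [if_pos (by positivity), Int.toNat_natCast, I.encode_eq, hidx, List.getD_cons_succ,
    List.getD_cons_succ, List.getD_cons_succ, List.getD_eq_getElem _ _ (by simpa using hlt),
    List.getElem_ofFn]
  congr 2
  · ext; simp only [Fin.coe_divNat]; exact mul_add_div' _ hjk
  · ext
    simp only [Fin.coe_divNat, Fin.coe_modNat]
    rw [mul_add_mod'' _ hjk]
    exact mul_add_div' _ k.2
  · ext
    simp only [Fin.coe_modNat]
    rw [mul_add_mod'' _ hjk]
    exact mul_add_mod'' _ k.2

theorem Inst.isInput (I : Inst) (hm : 0 < I.m) :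
    IsInput I.n I.m I.l (2 ^ inputSize I.encode) I.coord (initStore I.encode 0) := by
  have key : ∀ q < I.n * I.l, ∀ j < I.m, ∃ (i : Fin I.n) (j' : Fin I.m) (k : Fin I.l),
      q / I.l = i ∧ j = j' ∧ q % I.l = k ∧ I.coord q j = I.val i j' k := by
    intro q hq j hj
    refine ⟨⟨q / I.l, div_lt_of_lt_mul' hq⟩, ⟨j, hj⟩, ⟨q % I.l, mod_lt_of_lt_mul hq⟩, rfl, rfl, rfl, ?_⟩
    unfold Inst.coord
    rw [dif_pos ⟨div_lt_of_lt_mul' hq, hj, mod_lt_of_lt_mul hq⟩]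
  refine ⟨by simp [initStore, Inst.encode], by simp [initStore, Inst.encode],
    by simp [initStore, Inst.encode], I.n_pos, hm, I.l_pos, fun q hq j hj => ?_, fun q hq j hj => ?_⟩
  · obtain ⟨i, j', k, h1, rfl, h3, h4⟩ := key q hq j hj
    rw [h1, h3, h4]
    exact I.initStore_val i j' k
  · obtain ⟨i, j', k, h1, rfl, h3, h4⟩ := key q hq j hj
    rw [h4]
    have hb := bdd_initStore (w := I.encode) le_rfl 0 ((3 + (i * I.m + j') * I.l + k : ℕ) : ℤ)
    rw [I.initStore_val, abs_of_nonneg (by positivity)] at hb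
    exact_mod_cast hb

/-! ### Correctness -/

/-- The allocation that gives item `j` to agent `f j`. -/
def Allocation.ofOwner (I : Inst) (f : Fin I.m → Fin I.n) : Allocation I where
  bundle i := univ.filter fun j => f j = i
  disjoint i i' h := disjoint_filter.mpr fun _ _ h1 h2 => h (h1.symm.trans h2)
  cover j := ⟨f j, by simp⟩

theorem isStrongSEF_ofOwner (I : Inst) (hm : 0 < I.m) {τ h : ℕ → ℕ} {p : ℕ → ℕ → ℤ}
    (H : IsPick I.m (I.n * I.n * I.l) (I.n * I.l * (I.n * I.n * I.l)) I.coord τ h)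
    (hn : IsNear I.n I.m (I.n * I.l) (I.n * unit I.m) (scale I.n I.m) (scaled I.n I.m I.coord h)
      (initShare I.n I.m I.l τ) p)
    (hF : (unsettled I.n I.m p).card ≤ (I.n - 1) * (I.n * I.l))
    {f : Fin I.m → Fin I.n} (hf : ∀ j, (f j : ℕ) = top I.n p j) {c : ℕ}
    (hc : I.n ^ 2 * I.l ^ 2 ≤ c) : (Allocation.ofOwner I f).IsStrongSEF c := by
  have hD : 0 < I.n * unit I.m := by
    have := I.n_pos
    simp only [unit]; positivity
  intro i i' hii
  -- The removed set consists of all picks of `i'`; it depends neither on `i` nor on the dimension.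
  refine ⟨univ.filter fun j => f j = i' ∧ τ j ≠ 0, ?_, ?_, fun k => ?_⟩
  · intro j hj
    simp only [mem_filter, mem_univ, true_and, Allocation.ofOwner] at hj ⊢
    exact hj.1
  · refine le_trans ?_ ((card_picked_le I.n_pos I.l_pos H i').trans (le_trans (le_of_eq ?_) hc))
    · refine card_le_card_of_injOn (fun j => (j : ℕ)) ?_ (fun a _ b _ hab => Fin.ext hab)
      intro j hj
      simp only [coe_filter, mem_univ, true_and, Set.mem_ofPred_eq, mem_range] at hj ⊢
      refine ⟨j.2, hj.2, ?_⟩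
      rw [← (picked_settled hD hn j.2 hj.2).1, ← hf, hj.1]
    · ring
  · have hmain := sum_unpicked_le I.n_pos I.l_pos hm H hn hF i.2 i'.2
      (fun h => hii (Fin.ext h)) k.2
    have hset : (Allocation.ofOwner I f).bundle i' \ (univ.filter fun j => f j = i' ∧ τ j ≠ 0) =
        univ.filter fun j : Fin I.m => τ j = 0 ∧ top I.n p j = i' := by
      ext j
      simp only [Allocation.ofOwner, mem_sdiff, mem_filter, mem_univ, true_and, ← hf,
        Fin.val_inj]
      tauto
    have hset' : (Allocation.ofOwner I f).bundle i =
        univ.filter fun j : Fin I.m => top I.n p j = i := by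
      ext j
      simp only [Allocation.ofOwner, mem_filter, mem_univ, true_and, ← hf, Fin.val_inj]
    unfold Inst.value
    rw [hset, hset']
    simp only [sum_filter] at hmain ⊢
    rw [sum_range, sum_range] at hmain
    simp only [I.coord_eq] at hmain
    exact hmain

/-- The program outputs a fair allocation. -/
theorem exec_fairP (I : Inst) : ∃ (t : ℕ) (s : Store), Exec fairP (initStore I.encode) t s ∧
    t ≤ (1 + mainSteps (inputSize I.encode) (inputSize I.encode) (inputSize I.encode) + 1) *
      (fairP.weight * ((bigBound (inputSize I.encode)).size + 1) ^ 2) ∧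
    ∃ A : Allocation I, A.WrittenIn (s 1) ∧
      ∀ c : ℕ, I.n ^ 2 * I.l ^ 2 ≤ c → A.IsStrongSEF c := by
  set x := inputSize I.encode with hx
  have hb : (initStore I.encode).Bdd (bigBound x) :=
    bdd_initStore (by have := (isBig_bigBound x).val; rw [← hx]; omega)
  have hmE : mE.eval (initStore I.encode) = I.m := by
    simp [mE, initStore, Inst.encode]
  have main : Halts (bigBound x) fairP (1 + mainSteps x x x + 1) (initStore I.encode) fun s =>
      ∃ A : Allocation I, A.WrittenIn (s 1) ∧
        ∀ c : ℕ, I.n ^ 2 * I.l ^ 2 ≤ c → A.IsStrongSEF c := by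
    refine Halts.cond ?_ ?_
    · intro hne
      have hm : 0 < I.m := Nat.pos_of_ne_zero fun h0 => hne (by rw [hmE, h0]; rfl)
      have hI := I.isInput hm
      have hsz := I.mul_le_inputSize
      have hn0 := I.n_pos
      have hl0 := I.l_pos
      have hn : I.n ≤ x := (Nat.le_mul_of_pos_right _ (by positivity)).trans hsz
      have hml : I.m * I.l ≤ x := (Nat.le_mul_of_pos_left _ hn0).trans hsz
      have hm' : I.m ≤ x := (Nat.le_mul_of_pos_right _ hl0).trans hml
      have hl' : I.l ≤ x := (Nat.le_mul_of_pos_left _ hm).trans hml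
      refine (halts_mainP hI ((isBig_bigBound x).mono hn hm' hl' (lip_pos hI)) rfl ?_ ?_).mono
        (mainSteps_mono hn hm' hl') ?_
      · funext j; simp [initStore]
      · funext j; simp [initStore]
      rintro s ⟨τ, h, p, H, hnear, hF, hout⟩
      have hD : 0 < I.n * unit I.m := by simp only [unit]; positivity
      let f : Fin I.m → Fin I.n := fun j => ⟨top I.n p j, ((hnear.distr j j.2).top_spec hD).1⟩
      refine ⟨Allocation.ofOwner I f, fun i j hj => ?_, fun c hc =>
        isStrongSEF_ofOwner I hm H hnear hF (f := f) (fun _ => rfl) hc⟩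
      have hfj : f j = i := by simpa [Allocation.ofOwner] using hj
      rw [← hfj]
      exact hout j j.2
    -- Without items `n` and `l` may be exponential in the input length, so no loop over them is
    -- affordable; here the program stops at once, and empty bundles are fair.
    · intro he
      have hm : I.m = 0 := by rw [hmE] at he; exact_mod_cast he
      have hempty : IsEmpty (Fin I.m) := by rw [hm]; infer_instance
      refine .nop ⟨⟨fun _ => ∅, by simp, fun j => hempty.elim j⟩, fun _ j => hempty.elim j,
        fun c _ i i' _ => ⟨∅, by simp, by simp, by simp [Inst.value]⟩⟩
  obtain ⟨k, hk, s, hrun, -, hA⟩ := main hb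
  obtain ⟨t, hexec, ht⟩ := hrun.exec
  exact ⟨t, s, hexec, ht.trans (Nat.mul_le_mul_right _ hk), hA⟩

end MDFA

theorem mainTheorem1 :
    (∀ (I : MDFA.Inst) (c : ℕ), I.n ^ 2 * I.l ^ 2 ≤ c →
      ∃ A : MDFA.Allocation I, A.IsStrongSEF c) ∧
    MDFA.SolvableInPolyTime MDFA.Inst.encode (fun I out =>
      ∃ A : MDFA.Allocation I, A.WrittenIn out ∧
        ∀ c : ℕ, I.n ^ 2 * I.l ^ 2 ≤ c → A.IsStrongSEF c) := by
  refine ⟨fun I c hc => ?_, ?_⟩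
  · obtain ⟨_, _, _, _, A, _, hA⟩ := MDFA.exec_fairP I
    exact ⟨A, hA c hc⟩
  · have hbound : MDFA.PolyBdd fun x => (1 + MDFA.mainSteps x x x + 1) *
        (MDFA.fairP.weight * ((MDFA.bigBound x).size + 1) ^ 2) :=
      (((MDFA.PolyBdd.const 1).add MDFA.polyBdd_mainSteps).add (.const 1)).mul
        ((MDFA.PolyBdd.const _).mul ((MDFA.expBdd_bigBound.size.add (.const 1)).pow 2))
    obtain ⟨q, hq⟩ := hbound
    refine ⟨MDFA.fairP, q, fun I => ?_⟩
    obtain ⟨t, s, h1, h2, h3⟩ := MDFA.exec_fairP I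
    exact ⟨t, s, h1, h2.trans (hq _), h3⟩
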